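/- Let $\mathcal K$ be a complex Hilbert space and $J\subset\mathbb R$ an interval (open, closed or half-open, bounded or not) with $0\in J$. For $t\in J$ let $L(t)$ be a self-adjoint operator on $\mathcal K$ such that, for some $b\in\mathbb R$ independent of $t$, $L_0(t):=L(t)+b$ is positive with bounded inverse; let $\alpha(t)$ be a bounded, boundedly invertible, self-adjoint operator and $W(t)$ an operator on $\mathcal K$. A function $A:J\to B(\mathcal K)$ is called absolutely norm continuous if there is $0\le c\in L^1(J)$ with $\|A(t)-A(s)\|\le\int_s^t c(\tau)\,d\tau$ for $s\le t$ in $J$. Assume: 1. for every $t\in J$ there are $c_1,c_2>0$ with $c_1L_0(0)\le L_0(t)\le c_2L_0(0)$ in the sense of quadratic forms, and $t\mapsto L_0(0)^{-1/2}L_0(t)L_0(0)^{-1/2}$ (defined through forms) is absolutely norm continuous; 2. $t\mapsto\alpha^2(t)$ is absolutely norm continuous; 3. $W(t)$ is defined on $\mathrm{Dom}(L_0(0)^{1/2})$, $t\mapsto W(t)L_0(0)^{-1/2}\in B(\mathcal K)$ is absolutely norm continuous, and there is $a<1$ such that $|(f|W(t)g)|\le a\|\alpha(t)f\|\,\|L_0(t)^{1/2}g\|$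 for all $t\in J$, $f\in\mathcal K$, $g\in\mathrm{Dom}(L_0(t)^{1/2})$. For $0\le\gamma\le1$ let $\mathcal K_\gamma=L_0(0)^{-\gamma/2}\mathcal K$ be the domain of $L_0(0)^{\gamma/2}$ with norm $\|L_0(0)^{\gamma/2}u\|$, and let $\mathcal K_{-\gamma}$ be its antidual, $\mathcal K_0=\mathcal K$ being identified with its antidual. For $|\lambda|\le\frac12$ put $\mathcal W_\lambda=\mathcal K_{\lambda+\frac12}\oplus\mathcal K_{\lambda-\frac12}$, with the charge pairing $(u|Qv)=(u_1|v_2)+(u_2|v_1)$ for $u\in\mathcal W_{-\lambda}$, $v\in\mathcal W_\lambda$. Let $$B(t)=QH(t)=\begin{bmatrix}W(t)&\alpha^2(t)\\ L(t)&W^*(t)\end{bmatrix}:\mathcal W_{\frac12}\to\mathcal W_{-\frac12},$$ where $L(t),W^*(t)$ are interpreted as maps $\mathcal K_1\to\mathcal K_{-1}$, $\mathcal K\to\mathcal K_{-1}$ through forms. Then $B(t)$ is bounded from $\mathcal W_{\frac12}$ to $\mathcal W_{-\frac12}$, and the following holds. (A) $\mathcal W_{\frac12}$ is continuously and densely embedded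 in $\mathcal W_{-\frac12}$, and $Q$ is a bounded pairing on $\mathcal W_{-\frac12}\times\mathcal W_{\frac12}$, Hermitian on $\mathcal W_{\frac12}$. One can write $B(t)=B_0(t)+P(t)$, where $t\mapsto P(t)\in B(\mathcal W_{-\frac12})$ is norm continuous, $t\mapsto B_0(t)\in B(\mathcal W_{\frac12},\mathcal W_{-\frac12})$ is norm continuous, and there are $t$-dependent scalar products, compatible with the topologies of $\mathcal W_{\pm\frac12}$, with norms $\|\cdot\|_{\pm\frac12,t}$, such that $B_0(t)$ with domain $\mathcal W_{\frac12}$ is self-adjoint on $\mathcal W_{-\frac12}$ for the scalar product at time $t$, the part of $B_0(t)$ in $\mathcal W_{\frac12}$ is self-adjoint for the scalar product at time $t$, and $\|w\|_{\pm\frac12,t}\le\|w\|_{\pm\frac12,s}\exp\bigl|\int_s^tC(r)\,dr\bigr|$ for some $0\le C\in L^1_{\rm loc}(J)$ and all $s,t\in J$. For every $t\in J$, $B(t)$ generates a strongly continuous group $e^{-i\tau B(t)}$ on $\mathcal W_{-\frac12}$, its part in $\mathcal W_{\frac12}$ generates such a group on $\mathcal W_{\frac12}$, and $(B(t)v|Qw)=(v|QB(t)w)$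 for $v,w\in\mathcal W_{\frac12}$. (B) There is a unique family $R(t,s)$, $t,s\in J$, of bounded operators on $\mathcal W_{-\frac12}$ such that: $R(t,t)=1$, $R(t,s)R(s,r)=R(t,r)$ and $(t,s)\mapsto R(t,s)$ is strongly continuous on $\mathcal W_{-\frac12}$; $R(t,s)$ restricts to bounded operators on $\mathcal W_{\frac12}$, strongly continuous there; and for $w\in\mathcal W_{\frac12}$, $i\partial_tR(t,s)w=B(t)R(t,s)w$ and $-i\partial_sR(t,s)w=R(t,s)B(s)w$ in $\mathcal W_{-\frac12}$ (one-sided derivatives at end points belonging to $J$). (C) For every $\lambda\in[-\frac12,\frac12]$, $R(t,s)$ restricts to a strongly continuous evolution of bounded operators on $\mathcal W_\lambda$, and $(R(t,s)u|QR(t,s)v)=(u|Qv)$ for $u\in\mathcal W_{-\lambda}$, $v\in\mathcal W_\lambda$. (D) In particular $(\mathcal W_0,Q)$ is a Krein space: $Q$ is a bounded Hermitian form on $\mathcal W_0$ and there is a bounded involution $S$ on $\mathcal W_0$ preserving $Q$ such that $(v|QSw)$ is a scalar product compatible with the topology of $\mathcal W_0$. Moreover $Q$ is nondegenerate on $\mathcal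 W_0$ and each $R(t,s)$ is bounded, invertible and preserves $Q$ there, i.e. it is pseudo-unitary. -/

import Mathlib

open scoped ComplexConjugate NNReal InnerProductSpace

noncomputable section

namespace KleinGordon

/-! ### Scalar products, generators and evolutions on Hilbertizable spaces

A Hilbertizable space is represented by a complex normed space; only its topology matters. -/

section Abstract

variable {X : Type*} [NormedAddCommGroup X] [NormedSpace ℂ X]
variable {V : Type*} [NormedAddCommGroup V] [NormedSpace ℂ V]

/-- A scalar product on `X` compatible with the topology of `X`: a Hermitian form which is bounded
and bounded below by a positive multiple of the square of the given norm. -/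
def IsCompatibleInner (g : X →L⋆[ℂ] X →L[ℂ] ℂ) : Prop :=
  (∀ v w, g v w = conj (g w v)) ∧ ∃ c : ℝ, 0 < c ∧ ∀ v, c * ‖v‖ ^ 2 ≤ (g v v).re

/-- The norm given by a scalar product. -/
def innerNorm (g : X →L⋆[ℂ] X →L[ℂ] ℂ) (v : X) : ℝ := Real.sqrt (g v v).re

/-- The operator with graph `G` is densely defined and equals its own adjoint with respect to the
scalar product `g`. -/
def IsSelfAdjointGraph (g : X →L⋆[ℂ] X →L[ℂ] ℂ) (G : Set (X × X)) : Prop :=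
  Dense (Prod.fst '' G) ∧ ∀ y z, (y, z) ∈ G ↔ ∀ p ∈ G, g y p.2 = g z p.1

/-- The operator `B` with graph `G` is the generator of a strongly continuous one-parameter group
`U t = exp (- i t B)` of bounded operators. -/
def IsGroupGenerator (G : Set (X × X)) : Prop :=
  ∃ U : ℝ → X →L[ℂ] X, U 0 = 1 ∧ (∀ s t, U (s + t) = U s * U t) ∧
    (∀ x, Continuous fun t => U t x) ∧
    ∀ x y, (x, y) ∈ G ↔ HasDerivAt (fun t => U t x) (-Complex.I • y) 0

/-- The graph of `B : V → X`, viewed as an operator on `X` with domain `V` (embedded by `ι`). -/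
def opGraph (ι : V →L[ℂ] X) (B : V →L[ℂ] X) : Set (X × X) := {p | ∃ v, ι v = p.1 ∧ B v = p.2}

/-- The graph of the part of `B` in `V`: `v ↦ B v` for those `v` such that `B v` belongs to `V`. -/
def partGraph (ι : V →L[ℂ] X) (B : V →L[ℂ] X) : Set (V × V) := {p | B p.1 = ι p.2}

/-- A strongly continuous two-parameter evolution on `X` parametrized by `J`. -/
def IsStronglyContinuousEvolution (J : Set ℝ) (R : ℝ → ℝ → X →L[ℂ] X) : Prop :=
  (∀ t ∈ J, R t t = 1) ∧ (∀ t ∈ J, ∀ s ∈ J, ∀ r ∈ J, R t s * R s r = R t r) ∧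
    ∀ x, ContinuousOn (fun p : ℝ × ℝ => R p.1 p.2 x) (J ×ˢ J)

/-- `R` is the evolution on `X` generated by the family `B t : V → X`: it is a strongly continuous
evolution, it preserves `V` and is strongly continuous there, and for `v ∈ V`
`i ∂ₜ R(t,s) v = B(t) R(t,s) v` and `- i ∂ₛ R(t,s) v = R(t,s) B(s) v` in the topology of `X`
(one-sided derivatives at those end points of `J` that belong to `J`). -/
def IsEvolutionGeneratedBy (J : Set ℝ) (ι : V →L[ℂ] X) (B : ℝ → V →L[ℂ] X)
    (R : ℝ → ℝ → X →L[ℂ] X) : Prop :=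
  IsStronglyContinuousEvolution J R ∧
  ∃ RV : ℝ → ℝ → V →L[ℂ] V,
    (∀ t ∈ J, ∀ s ∈ J, ∀ v, ι (RV t s v) = R t s (ι v)) ∧
    IsStronglyContinuousEvolution J RV ∧
    ∀ t ∈ J, ∀ s ∈ J, ∀ v,
      HasDerivWithinAt (fun τ => R τ s (ι v)) (-Complex.I • B t (RV t s v)) J t ∧
      HasDerivWithinAt (fun σ => R t σ (ι v)) (Complex.I • R t s (B s v)) J s

/-- The hypotheses of the generation theorem for almost unitary evolutions, on the pair `V ⊂ X`:
`B₀ t : V → X` is norm continuous, and for suitable scalar products depending on `t`, compatible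
with `X` and `V`, `B₀ t` is self-adjoint on `X` (with domain `V`), its part in `V` is self-adjoint
on `V`, and the norms vary with `t` in a locally absolutely continuous way. -/
def AlmostUnitaryHypotheses (J : Set ℝ) (ι : V →L[ℂ] X) (B₀ : ℝ → V →L[ℂ] X) : Prop :=
  ContinuousOn B₀ J ∧
  ∃ (gX : ℝ → X →L⋆[ℂ] X →L[ℂ] ℂ) (gV : ℝ → V →L⋆[ℂ] V →L[ℂ] ℂ) (C : ℝ → ℝ),
    (∀ t ∈ J, IsCompatibleInner (gX t) ∧ IsCompatibleInner (gV t) ∧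
      IsSelfAdjointGraph (gX t) (opGraph ι (B₀ t)) ∧
      IsSelfAdjointGraph (gV t) (partGraph ι (B₀ t))) ∧
    (∀ τ, 0 ≤ C τ) ∧ MeasureTheory.LocallyIntegrableOn C J ∧
    ∀ s ∈ J, ∀ t ∈ J,
      (∀ w, innerNorm (gX t) w ≤ innerNorm (gX s) w * Real.exp |∫ τ in s..t, C τ|) ∧
      (∀ v, innerNorm (gV t) v ≤ innerNorm (gV s) v * Real.exp |∫ τ in s..t, C τ|)

/-- `B` is a bounded norm continuous perturbation of a family as above. -/
def PerturbedAlmostUnitaryHypotheses (J : Set ℝ) (ι : V →L[ℂ] X) (B : ℝ → V →L[ℂ] X) : Prop :=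
  ∃ (B₀ : ℝ → V →L[ℂ] X) (P : ℝ → X →L[ℂ] X), AlmostUnitaryHypotheses J ι B₀ ∧
    ContinuousOn P J ∧ ∀ t ∈ J, B t = B₀ t + (P t).comp ι

/-- `(X, V, q)` is a nested pre-pseudo-unitary pair: `V` is densely and continuously embedded in
`X` and `q : X × V → ℂ`, `q u v = (u|Qv)`, is a bounded sesquilinear pairing, Hermitian on `V`. -/
def IsNestedPair (ι : V →L[ℂ] X) (q : X → V → ℂ) : Prop :=
  Function.Injective ι ∧ DenseRange ι ∧
  (∃ q' : X →L⋆[ℂ] V →L[ℂ] ℂ, ∀ u v, q' u v = q u v) ∧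
  ∀ v w : V, q (ι v) w = conj (q (ι w) v)

/-- `B`, with domain `V`, infinitesimally preserves `(X, V, q)`: it generates a group on `X`, its
part in `V` generates a group on `V`, and `(Bv|Qw) = (v|QBw)` for `v, w ∈ V`. -/
def InfinitesimallyPreserves (ι : V →L[ℂ] X) (q : X → V → ℂ) (B : V →L[ℂ] X) : Prop :=
  IsGroupGenerator (opGraph ι B) ∧ IsGroupGenerator (partGraph ι B) ∧
  ∀ v w : V, q (B v) w = conj (q (B w) v)

/-- `(X, q)` is a Krein space: `q` is a bounded Hermitian form and there is an admissible
involution `S`, i.e. a bounded involution preserving `q` such that `(v, w) ↦ q v (S w)` is a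
compatible scalar product. -/
def IsKreinSpace (q : X → X → ℂ) : Prop :=
  (∃ q' : X →L⋆[ℂ] X →L[ℂ] ℂ, ∀ v w, q' v w = q v w) ∧
  (∀ v w, q v w = conj (q w v)) ∧
  ∃ S : X →L[ℂ] X, S * S = 1 ∧ (∀ v w, q (S v) (S w) = q v w) ∧
    ∃ g : X →L⋆[ℂ] X →L[ℂ] ℂ, (∀ v w, g v w = q v (S w)) ∧ IsCompatibleInner g

/-- `R` is pseudo-unitary on `(X, q)`: `q` is nondegenerate, and `R` is bounded, invertible and
preserves `q`. -/
def IsPseudoUnitary (q : X → X → ℂ) (R : X →L[ℂ] X) : Prop :=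
  (∀ v, (∀ w, q v w = 0) → v = 0) ∧ IsUnit R ∧ ∀ v w, q (R v) (R w) = q v w

/-- Absolute norm continuity of an operator valued function on the interval `J`. -/
def AbsNormContinuousOn (J : Set ℝ) (A : ℝ → X →L[ℂ] X) : Prop :=
  ∃ c : ℝ → ℝ, (∀ τ, 0 ≤ c τ) ∧ MeasureTheory.IntegrableOn c J ∧
    ∀ s ∈ J, ∀ t ∈ J, s ≤ t → ‖A t - A s‖ ≤ ∫ τ in s..t, c τ

end Abstract

variable {K : Type*} [NormedAddCommGroup K] [InnerProductSpace ℂ K] [CompleteSpace K]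

/-- Value of a partially defined operator, zero outside of its domain. -/
def ap (A : K →ₗ.[ℂ] K) (x : K) : K := by
  classical exact if h : x ∈ A.domain then A ⟨x, h⟩ else 0

/-- `T` is the bounded inverse of the (unbounded) operator `A + b`. -/
def IsBoundedInverse (A : K →ₗ.[ℂ] K) (b : ℝ) (T : K →L[ℂ] K) : Prop :=
  (∀ x, T x ∈ A.domain ∧ ap A (T x) + (b : ℂ) • T x = x) ∧
  ∀ u ∈ A.domain, T (ap A u + (b : ℂ) • u) = u

/-- The operators entering the abstract Klein-Gordon equation on an interval `J ∋ 0`. -/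
structure Data (K : Type*) [NormedAddCommGroup K] [InnerProductSpace ℂ K] [CompleteSpace K]
    (J : Set ℝ) where
  zero_mem : (0 : ℝ) ∈ J
  ordConnected : J.OrdConnected
  L : ℝ → K →ₗ.[ℂ] K
  b : ℝ
  α : ℝ → K →L[ℂ] K
  W : ℝ → K →ₗ.[ℂ] K
  isSelfAdjoint_L : ∀ t ∈ J, IsSelfAdjoint (L t)
  L₀_nonneg : ∀ t ∈ J, ∀ u ∈ (L t).domain, 0 ≤ (⟪u, ap (L t) u + (b : ℂ) • u⟫_ℂ).re
  L₀_invertible : ∀ t ∈ J, ∃ T : K →L[ℂ] K, IsBoundedInverse (L t) b T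
  isSelfAdjoint_α : ∀ t ∈ J, IsSelfAdjoint (α t)
  isUnit_α : ∀ t ∈ J, IsUnit (α t)

namespace Data

variable {J : Set ℝ} (D : Data K J)

/-- `L₀(t)⁻¹`, where `L₀(t) = L(t) + b`. -/
def L₀inv (t : ℝ) : K →L[ℂ] K := by
  classical exact if h : t ∈ J then Classical.choose (D.L₀_invertible t h) else 0

/-- The bounded operator `L₀(t)^(-s)`, `s ≥ 0`, by the continuous functional calculus. -/
def negPow (t : ℝ) (s : ℝ≥0) : K →L[ℂ] K := (D.L₀inv t) ^ (s : ℝ)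

/-- The operator `L₀(t)^(1/2)`, as the inverse of `L₀(t)^(-1/2)`; its domain is the range of
`L₀(t)^(-1/2)`. -/
def sqrtL₀ (t : ℝ) : K →ₗ.[ℂ] K :=
  ((D.negPow t (1 / 2) : K →ₗ[ℂ] K).toPMap ⊤).inverse

theorem isBoundedInverse_L₀inv {t : ℝ} (ht : t ∈ J) :
    IsBoundedInverse (D.L t) D.b (D.L₀inv t) := by
  unfold L₀inv
  rw [dif_pos ht]
  exact Classical.choose_spec (D.L₀_invertible t ht)

theorem ap_of_mem {A : K →ₗ.[ℂ] K} {x : K} (h : x ∈ A.domain) : ap A x = A ⟨x, h⟩ := by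
  unfold ap
  rw [dif_pos h]

theorem L₀inv_injective {t : ℝ} (ht : t ∈ J) : Function.Injective (D.L₀inv t) := by
  intro x y hxy
  have h := D.isBoundedInverse_L₀inv ht
  rw [← (h.1 x).2, ← (h.1 y).2, hxy]

theorem L₀inv_nonneg {t : ℝ} (ht : t ∈ J) : 0 ≤ D.L₀inv t := by
  have h := D.isBoundedInverse_L₀inv ht
  have hsym : ∀ u ∈ (D.L t).domain, ∀ v ∈ (D.L t).domain,
      ⟪ap (D.L t) u, v⟫_ℂ = ⟪u, ap (D.L t) v⟫_ℂ := by
    intro u hu v hv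
    rw [ap_of_mem hu, ap_of_mem hv]
    have hA := D.isSelfAdjoint_L t ht
    have hf := LinearPMap.adjoint_isFormalAdjoint (T := D.L t) hA.dense_domain
    rw [LinearPMap.isSelfAdjoint_def.mp hA] at hf
    exact hf ⟨u, hu⟩ ⟨v, hv⟩
  rw [ContinuousLinearMap.nonneg_iff_isPositive]
  refine ⟨?_, ?_⟩
  · intro x y
    obtain ⟨hx, hx'⟩ := h.1 x
    obtain ⟨hy, hy'⟩ := h.1 y
    change ⟪D.L₀inv t x, y⟫_ℂ = ⟪x, D.L₀inv t y⟫_ℂ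
    conv_lhs => rw [← hy']
    conv_rhs => rw [← hx']
    rw [inner_add_right, inner_add_left, hsym _ hx _ hy, inner_smul_left, inner_smul_right]
    simp
  · intro x
    obtain ⟨hx, hx'⟩ := h.1 x
    have := D.L₀_nonneg t ht _ hx
    rw [hx'] at this
    exact this

theorem negPow_zero {t : ℝ} (ht : t ∈ J) : D.negPow t 0 = 1 := by
  unfold negPow
  exact CFC.rpow_zero _ (D.L₀inv_nonneg ht)

theorem negPow_add {t : ℝ} (ht : t ∈ J) (r s : ℝ≥0) :
    D.negPow t (r + s) = D.negPow t r * D.negPow t s := by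
  rcases eq_or_lt_of_le (zero_le : 0 ≤ r) with hr | hr
  · rw [← hr, D.negPow_zero ht, zero_add, one_mul]
  rcases eq_or_lt_of_le (zero_le : 0 ≤ s) with hs | hs
  · rw [← hs, D.negPow_zero ht, add_zero, mul_one]
  unfold negPow
  rw [← CFC.nnrpow_eq_rpow hr, ← CFC.nnrpow_eq_rpow hs, ← CFC.nnrpow_eq_rpow (add_pos hr hs)]
  exact CFC.nnrpow_add hr hs

theorem negPow_injective {t : ℝ} (ht : t ∈ J) (s : ℝ≥0) :
    Function.Injective (D.negPow t s) := by
  have hnat : ∀ n : ℕ, Function.Injective (D.negPow t n) := by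
    intro n
    induction n with
    | zero =>
      rw [Nat.cast_zero, D.negPow_zero ht]
      exact fun _ _ h => h
    | succ n ih =>
      rw [Nat.cast_succ, D.negPow_add ht]
      have h1 : D.negPow t 1 = D.L₀inv t := by
        unfold negPow
        exact CFC.rpow_one _ (D.L₀inv_nonneg ht)
      rw [h1]
      exact ih.comp (D.L₀inv_injective ht)
  obtain ⟨n, hn⟩ := exists_nat_ge s
  have h := hnat n
  rw [← tsub_add_cancel_of_le hn, D.negPow_add ht] at h
  exact Function.Injective.of_comp (f := D.negPow t (n - s)) h

/-- The space `K_γ = L₀(0)^(-γ/2) K`, `γ ≥ 0`: the domain of `L₀(0)^(γ/2)`, i.e. the range of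
`L₀(0)^(-γ/2)`, with the norm `‖u‖_γ = ‖L₀(0)^(γ/2) u‖`. -/
def KPos (γ : ℝ≥0) : Type _ := LinearMap.range (D.negPow 0 (γ / 2) : K →ₗ[ℂ] K)

instance (γ : ℝ≥0) : AddCommGroup (D.KPos γ) :=
  inferInstanceAs (AddCommGroup (LinearMap.range (D.negPow 0 (γ / 2) : K →ₗ[ℂ] K)))

instance (γ : ℝ≥0) : Module ℂ (D.KPos γ) :=
  inferInstanceAs (Module ℂ (LinearMap.range (D.negPow 0 (γ / 2) : K →ₗ[ℂ] K)))

/-- The inclusion `K_γ ⊂ K`. -/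
def toK {γ : ℝ≥0} : D.KPos γ →ₗ[ℂ] K :=
  (LinearMap.range (D.negPow 0 (γ / 2) : K →ₗ[ℂ] K)).subtype

/-- The bijection `L₀(0)^(-γ/2) : K → K_γ`. -/
def equivK (γ : ℝ≥0) : K ≃ₗ[ℂ] D.KPos γ :=
  LinearEquiv.ofInjective (D.negPow 0 (γ / 2) : K →ₗ[ℂ] K) (D.negPow_injective D.zero_mem _)

instance (γ : ℝ≥0) : NormedAddCommGroup (D.KPos γ) :=
  NormedAddCommGroup.induced (D.KPos γ) K (D.equivK γ).symm (D.equivK γ).symm.injective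

instance (γ : ℝ≥0) : NormedSpace ℂ (D.KPos γ) :=
  NormedSpace.induced ℂ (D.KPos γ) K (D.equivK γ).symm.toLinearMap

theorem norm_equivK (γ : ℝ≥0) (x : K) : ‖D.equivK γ x‖ = ‖x‖ := by
  change ‖(D.equivK γ).symm (D.equivK γ x)‖ = ‖x‖
  rw [LinearEquiv.symm_apply_apply]

theorem toK_equivK (γ : ℝ≥0) (x : K) : D.toK (D.equivK γ x) = D.negPow 0 (γ / 2) x := rfl

theorem toK_injective (γ : ℝ≥0) : Function.Injective (D.toK (γ := γ)) :=
  Subtype.val_injective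

theorem equivK_factor {p q : ℝ≥0} (h : q ≤ p) (x : K) :
    D.toK (D.equivK q (D.negPow 0 ((p - q) / 2) x)) = D.toK (D.equivK p x) := by
  rw [toK_equivK, toK_equivK]
  have hp : p / 2 = q / 2 + (p - q) / 2 := by
    rw [← add_div, add_tsub_cancel_of_le h]
  rw [hp, D.negPow_add D.zero_mem]
  rfl

/-- The continuous inclusion `K_p ⊂ K_q` for `q ≤ p`. -/
def incl {p q : ℝ≥0} (h : q ≤ p) : D.KPos p →L[ℂ] D.KPos q :=
  LinearMap.mkContinuous
    ((D.equivK q).toLinearMap ∘ₗ (D.negPow 0 ((p - q) / 2) : K →ₗ[ℂ] K) ∘ₗ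
      (D.equivK p).symm.toLinearMap)
    ‖D.negPow 0 ((p - q) / 2)‖ (by
      intro u
      obtain ⟨x, rfl⟩ := (D.equivK p).surjective u
      simp only [LinearMap.comp_apply, LinearEquiv.coe_coe, LinearEquiv.symm_apply_apply,
        norm_equivK]
      exact (D.negPow 0 ((p - q) / 2)).le_opNorm x)

theorem toK_incl {p q : ℝ≥0} (h : q ≤ p) (u : D.KPos p) : D.toK (D.incl h u) = D.toK u := by
  obtain ⟨x, rfl⟩ := (D.equivK p).surjective u
  rw [← D.equivK_factor h x]
  change D.toK (D.equivK q (D.negPow 0 ((p - q) / 2) ((D.equivK p).symm (D.equivK p x)))) = _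
  rw [LinearEquiv.symm_apply_apply]

/-- The space `K_{-γ}`, `γ ≥ 0`: the antidual of `K_γ`. An element `φ` acts by `f ↦ (f|φ)`; a
vector `y ∈ K` is identified with the functional `f ↦ (f|y)`. -/
abbrev KNeg (γ : ℝ≥0) : Type _ := D.KPos γ →L⋆[ℂ] ℂ

/-- The scale `W_λ = K_{λ + 1/2} ⊕ K_{λ - 1/2}` for `λ ∈ [-1/2, 1/2]`, where
`K_{λ - 1/2}` is the antidual of `K_{1/2 - λ}`. -/
abbrev Wsp (lam : ℝ) : Type _ :=
  D.KPos (Real.toNNReal (1 / 2 + lam)) × D.KNeg (Real.toNNReal (1 / 2 - lam))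

/-- The continuous inclusion `W_λ ⊂ W_μ` for `μ ≤ λ`; functionals are restricted. -/
def inclW {lam mu : ℝ} (h : mu ≤ lam) : D.Wsp lam →L[ℂ] D.Wsp mu :=
  (D.incl (Real.toNNReal_le_toNNReal (by linarith))).prodMap
    (ContinuousLinearMap.precomp ℂ
      (D.incl (Real.toNNReal_le_toNNReal (by linarith) :
        Real.toNNReal (1 / 2 - lam) ≤ Real.toNNReal (1 / 2 - mu))))

/-- The charge pairing `(u|Qv) = (u₁|v₂) + (u₂|v₁)` between `W_μ` and `W_λ`, defined whenever
`0 ≤ μ + λ`, in particular for `μ = -λ`. -/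
def charge {mu lam : ℝ} (h : 0 ≤ mu + lam) (u : D.Wsp mu) (v : D.Wsp lam) : ℂ :=
  v.2 (D.incl (Real.toNNReal_le_toNNReal (by linarith)) u.1) +
    conj (u.2 (D.incl (Real.toNNReal_le_toNNReal (by linarith)) v.1))

/-- `c₁ L₀(0) ≤ L₀(t) ≤ c₂ L₀(0)` in the sense of quadratic forms. -/
def FormComparable (t c₁ c₂ : ℝ) : Prop :=
  (D.sqrtL₀ t).domain = (D.sqrtL₀ 0).domain ∧
  ∀ u ∈ (D.sqrtL₀ 0).domain,
    c₁ * ‖ap (D.sqrtL₀ 0) u‖ ^ 2 ≤ ‖ap (D.sqrtL₀ t) u‖ ^ 2 ∧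
    ‖ap (D.sqrtL₀ t) u‖ ^ 2 ≤ c₂ * ‖ap (D.sqrtL₀ 0) u‖ ^ 2

/-- The basic assumption on `L(t)`, `α(t)`, `W(t)`. -/
structure Assumption : Prop where
  comparable : ∀ t ∈ J, ∃ c₁ c₂ : ℝ, 0 < c₁ ∧ D.FormComparable t c₁ c₂
  /-- `t ↦ L₀(0)^(-1/2) L₀(t) L₀(0)^(-1/2)` is absolutely norm continuous. -/
  L_absCont : ∃ A : ℝ → K →L[ℂ] K, AbsNormContinuousOn J A ∧ ∀ t ∈ J, ∀ f g,
    ⟪f, A t g⟫_ℂ = ⟪ap (D.sqrtL₀ t) (D.negPow 0 (1 / 2) f),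
      ap (D.sqrtL₀ t) (D.negPow 0 (1 / 2) g)⟫_ℂ
  α_absCont : AbsNormContinuousOn J fun t => D.α t * D.α t
  /-- `t ↦ W(t) L₀(0)^(-1/2)` is everywhere defined, bounded and absolutely norm continuous. -/
  W_absCont : ∃ M : ℝ → K →L[ℂ] K, AbsNormContinuousOn J M ∧ ∀ t ∈ J, ∀ f,
    D.negPow 0 (1 / 2) f ∈ (D.W t).domain ∧ M t f = ap (D.W t) (D.negPow 0 (1 / 2) f)
  W_bound : ∃ a : ℝ, a < 1 ∧ ∀ t ∈ J, ∀ f, ∀ g ∈ (D.sqrtL₀ t).domain,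
    ‖⟪f, ap (D.W t) g⟫_ℂ‖ ≤ a * ‖D.α t f‖ * ‖ap (D.sqrtL₀ t) g‖

/-- `B : W_{1/2} → W_{-1/2}` is the operator `B(t) = Q H(t) = [[W(t), α²(t)], [L(t), W(t)*]]`:
for `u = (x, y)` with `x ∈ K_1` and `y ∈ K`, the first component of `B u` is
`W(t) x + α²(t) y`, and the second one is the functional `L(t) x + W(t)* y` on `K_1`, that is
`f ↦ (L₀(t)^(1/2) f | L₀(t)^(1/2) x) - b (f|x) + (W(t) f|y)`. -/
def IsKGGenerator (t : ℝ) (B : D.Wsp (1 / 2) →L[ℂ] D.Wsp (-(1 / 2))) : Prop :=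
  ∀ (u : D.Wsp (1 / 2)) (y : K), (∀ f, u.2 f = ⟪D.toK f, y⟫_ℂ) →
    D.toK (B u).1 = ap (D.W t) (D.toK u.1) + D.α t (D.α t y) ∧
    ∀ f, (B u).2 f = ⟪ap (D.sqrtL₀ t) (D.toK f), ap (D.sqrtL₀ t) (D.toK u.1)⟫_ℂ
      - (D.b : ℂ) * ⟪D.toK f, D.toK u.1⟫_ℂ + ⟪ap (D.W t) (D.toK f), y⟫_ℂ

/-- The inclusion `W_{1/2} ⊂ W_{-1/2}`. -/
def ι : D.Wsp (1 / 2) →L[ℂ] D.Wsp (-(1 / 2)) := D.inclW (by norm_num)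

/-- The charge pairing between `W_{-1/2}` and `W_{1/2}`. -/
def Q : D.Wsp (-(1 / 2)) → D.Wsp (1 / 2) → ℂ := D.charge (by norm_num)

/-- The charge form on `W_0`. -/
def Q₀ : D.Wsp 0 → D.Wsp 0 → ℂ := D.charge (by norm_num)

end Data

end KleinGordon

end

open scoped ComplexConjugate NNReal InnerProductSpace

set_option linter.unusedSectionVars false

/-! Put H = K ⊕ K. Powers of L₀(0) identify every W_λ with H, and the whole problem turns into one
about bounded operators on H. The inclusion W_{1/2} ⊂ W_{-1/2} becomes the injective positive
operator ℓ = L₀(0)^(-1/2) ⊕ L₀(0)^(-1/2), the inclusion W_λ ⊂ W_{-1/2} becomes ℓ^(λ+1/2), the charge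
becomes (x|σy) with σ the swap, and B(t) becomes σA(t) + Pℓ. Here A(t) has rows (a, m*) and (m, α²),
with a = L₀(0)^(-1/2) L₀(t) L₀(0)^(-1/2) and m = W(t) L₀(0)^(-1/2); the bounded P commutes with ℓ
and accounts for the constant b. The bound on W with constant less than 1 makes A(t) coercive
(`block_coercive`), and absolute norm continuity makes the forms A(t), A(s) comparable up to
exp|γ(t) - γ(s)| with γ monotone and continuous (`exists_comparison`). `ChargedSystem` records
exactly these facts.

The energy norms are given by A(t) on the smaller space and by σA(t)⁻¹σ on the larger one. For both,
σA(t) is self-adjoint.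

To solve i∂ₜ(ℓv) = (σA + Pℓ)v, replace ℓ by the invertible ℓ + ε; the equation for w = (ℓ + ε)v has
bounded coefficients and is solved by a Dyson series. Two facts are uniform in ε. First, with the
form σA⁻¹σ frozen, its derivative along w contains only the P term, because the term coming from A
is the imaginary part of a Hermitian charge form; hence the energy estimate. Second, conservation of
charge identifies the evolution of v with the charge adjoint of R(s,t), so bounds on the smaller
space follow by duality. The same energy estimate applied to a difference shows that the
approximations are Cauchy on the range of ℓ (`exists_regularized_sub_le`), which is dense. The limit
R satisfies R(t,s)ℓ = ℓ·(charge adjoint of R(s,t)). On the smaller space continuity is first weak,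
and becomes strong because the energy norms converge too. The differential equation comes from its
weak integrated form.

Uniqueness (`IsEvolutionGeneratedBy.unique`) follows by differentiating R'(t,σ)R(σ,s)v in σ, and it
allows gluing over compact subintervals. Freezing B at one time and running the same construction on
ℝ gives the groups in (A).

For (C), an operator bounded on H and on the range of ℓ is bounded on the range of ℓ^p
(`exists_interpolation`), by the integral representation of fractional powers and a variational
formula for its integrand. The exponents p and 1 - p are dual for the charge, so its preservation
extends by density. At λ = 0 the swap is itself the admissible involution. -/

namespace KleinGordon

open Set Filter Topology MeasureTheory
open scoped Interval

/-! ### Linear equations with bounded continuous coefficients -/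

section LinearODE

variable {𝔸 : Type*} [NormedRing 𝔸] [NormedAlgebra ℝ 𝔸]

/-- The `n`-th term of the Dyson series of the equation `U' = A U`, `U s = 1`. -/
noncomputable def dysonTerm (A : ℝ → 𝔸) (s : ℝ) : ℕ → ℝ → 𝔸
  | 0, _ => 1
  | n + 1, t => ∫ τ in s..t, A τ * dysonTerm A s n τ

theorem continuous_dysonTerm {A : ℝ → 𝔸} (hA : Continuous A) (s : ℝ) (n : ℕ) :
    Continuous (dysonTerm A s n) := by
  induction n with
  | zero => exact continuous_const
  | succ n ih =>
    exact intervalIntegral.continuous_primitive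
      (fun a b => (hA.mul ih).intervalIntegrable a b) s

variable [CompleteSpace 𝔸]

theorem hasDerivAt_dysonTerm {A : ℝ → 𝔸} (hA : Continuous A) (s : ℝ) (n : ℕ) (t : ℝ) :
    HasDerivAt (dysonTerm A s (n + 1)) (A t * dysonTerm A s n t) t :=
  (hA.mul (continuous_dysonTerm hA s n)).integral_hasStrictDerivAt s t |>.hasDerivAt

theorem norm_dysonTerm_le {A : ℝ → 𝔸} (hA : Continuous A) {M : ℝ} (hM : ∀ t, ‖A t‖ ≤ M)
    (s : ℝ) (n : ℕ) (t : ℝ) : ‖dysonTerm A s n t‖ ≤ ‖(1 : 𝔸)‖ * ((M * |t - s|) ^ n / n.factorial) := by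
  have hM0 : 0 ≤ M := (norm_nonneg _).trans (hM 0)
  induction n generalizing t with
  | zero => simp [dysonTerm]
  | succ n ih =>
    have h1 : ‖dysonTerm A s (n + 1) t‖ ≤
        ∫ τ in Ι s t, ‖(1 : 𝔸)‖ * M ^ (n + 1) / n.factorial * |τ - s| ^ n := by
      rw [dysonTerm]
      refine (intervalIntegral.norm_integral_le_integral_norm_uIoc).trans ?_
      refine setIntegral_mono_on ?_ ?_ measurableSet_uIoc fun τ _ => ?_
      · exact ((hA.mul (continuous_dysonTerm hA s n)).norm.intervalIntegrable s t).def'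
      · exact ((by fun_prop : Continuous fun τ : ℝ =>
          ‖(1 : 𝔸)‖ * M ^ (n + 1) / n.factorial * |τ - s| ^ n).intervalIntegrable s t).def'
      · calc ‖A τ * dysonTerm A s n τ‖ ≤ ‖A τ‖ * ‖dysonTerm A s n τ‖ := norm_mul_le _ _
          _ ≤ M * (‖(1 : 𝔸)‖ * ((M * |τ - s|) ^ n / n.factorial)) := by gcongr; exacts [hM τ, ih τ]
          _ = _ := by ring
    refine h1.trans (le_of_eq ?_)
    rw [integral_const_mul, integral_pow_abs_sub_uIoc, Nat.factorial_succ]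
    push_cast
    rw [mul_pow]
    field_simp

/-- A linear equation with bounded continuous coefficients has global solutions. -/
theorem exists_fundamental_solution {A : ℝ → 𝔸} (hA : Continuous A) {M : ℝ}
    (hM : ∀ t, ‖A t‖ ≤ M) (s : ℝ) :
    ∃ U : ℝ → 𝔸, U s = 1 ∧ ∀ t, HasDerivAt U (A t * U t) t := by
  have hM0 : 0 ≤ M := (norm_nonneg _).trans (hM 0)
  have hsum : ∀ t, Summable fun n => dysonTerm A s n t := fun t =>
    .of_norm_bounded ((Real.summable_pow_div_factorial (M * |t - s|)).mul_left _)
      fun n => norm_dysonTerm_le hA hM s n t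
  refine ⟨fun t => ∑' n, dysonTerm A s n t, ?_, fun t => ?_⟩
  · refine (tsum_eq_single 0 ?_).trans rfl
    intro n hn
    obtain ⟨k, rfl⟩ := Nat.exists_eq_succ_of_ne_zero hn
    simp [dysonTerm]
  -- The constant zeroth term is split off, since only the terms of index n + 1 have derivative A
  -- times the preceding term. Unit balls around t give a summable bound on the derivatives.
  · have key := hasDerivAt_tsum_of_isPreconnected
      (g := fun n => dysonTerm A s (n + 1)) (g' := fun n y => A y * dysonTerm A s n y)
      (u := fun n => M * (‖(1 : 𝔸)‖ * ((M * (|t - s| + 1)) ^ n / n.factorial))) (t := Metric.ball t 1)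
      (y₀ := t) (y := t)
      (((Real.summable_pow_div_factorial _).mul_left _).mul_left M) Metric.isOpen_ball
      (convex_ball t 1).isPreconnected (fun n y _ => hasDerivAt_dysonTerm hA s n y)
      (fun n y hy => ?_) (Metric.mem_ball_self one_pos)
      ((summable_nat_add_iff 1).2 (hsum t)) (Metric.mem_ball_self one_pos)
    · rw [(hsum t).tsum_mul_left] at key
      refine (key.const_add (1 : 𝔸)).congr_of_eventuallyEq (Eventually.of_forall fun y => ?_)
      simp only [(hsum y).tsum_eq_zero_add]
      rfl
    · refine (norm_mul_le _ _).trans ?_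
      have hy' : |y - s| ≤ |t - s| + 1 := by
        have : |y - t| < 1 := by simpa [Real.dist_eq] using hy
        have := abs_sub_le y t s
        linarith
      calc _ ≤ M * (‖(1 : 𝔸)‖ * ((M * |y - s|) ^ n / n.factorial)) := by
            gcongr
            exacts [hM y, norm_dysonTerm_le hA hM s n y]
        _ ≤ _ := by gcongr

/-- The two-parameter propagator of a linear equation with bounded continuous coefficients. -/
theorem exists_propagator {A : ℝ → 𝔸} (hA : Continuous A) {M : ℝ} (hM : ∀ t, ‖A t‖ ≤ M) :
    ∃ U : ℝ → ℝ → 𝔸, (∀ t, U t t = 1) ∧ (∀ t s r, U t s * U s r = U t r) ∧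
      ∀ t s, HasDerivAt (fun τ => U τ s) (A t * U t s) t := by
  choose U hU1 hU2 using exists_fundamental_solution hA hM
  refine ⟨fun t s => U s t, hU1, fun t s r => ?_, fun t s => hU2 s t⟩
  have hlip : ∀ t, LipschitzOnWith (Real.toNNReal M) (fun x : 𝔸 => A t * x) univ := by
    intro t
    refine LipschitzWith.lipschitzOnWith (LipschitzWith.of_dist_le_mul fun x y => ?_)
    rw [dist_eq_norm, dist_eq_norm, ← mul_sub]
    refine (norm_mul_le _ _).trans ?_
    gcongr
    exact (hM t).trans (Real.le_coe_toNNReal M)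
  -- Both sides of the cocycle identity solve the same linear equation in t and agree at t = s.
  have := ODE_solution_unique_univ (v := fun t x => A t * x) (s := fun _ => univ) (t₀ := s)
    (f := fun t => U s t * U r s) (g := U r) hlip
    (fun t => ⟨by simpa [mul_assoc] using (hU2 s t).mul_const (U r s), trivial⟩)
    (fun t => ⟨hU2 r t, trivial⟩) (by simp [hU1])
  exact congrFun this t

end LinearODE

/-! ### Energy estimates for a norm that varies with time -/

section Energy

/-- Only a lower right Dini derivative is controlled. This is what remains when the comparison
function γ is merely continuous and monotone, so that t ↦ N t x need not be differentiable. -/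
theorem antitone_of_slope {f : ℝ → ℝ} {a b : ℝ} (hab : a ≤ b) (hf : ContinuousOn f (Icc a b))
    (bound : ∀ x ∈ Ico a b, ∀ r, 0 < r → ∃ᶠ z in 𝓝[>] x, slope f x z < r) : f b ≤ f a :=
  image_le_of_liminf_slope_right_le_deriv_boundary (B := fun _ => f a) (B' := fun _ => 0) hf le_rfl
    continuousOn_const (fun _ _ => hasDerivWithinAt_const _ _ _) bound (right_mem_Icc.2 hab)

/-- Energy estimate, forward in time: `N t` is a quadratic form depending on `t` in a controlled
way, along a curve `u` on which `N t (u t)` has a controlled derivative for `t` frozen. -/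
theorem energy_forward {X : Type*} {N : ℝ → X → ℝ} {γ : ℝ → ℝ} {s t k η : ℝ} {u : ℝ → X}
    {N' : ℝ → ℝ} (hst : s ≤ t) (hγ : ContinuousOn γ (Icc s t)) (hmono : MonotoneOn γ (Icc s t))
    (hη : 0 ≤ η)
    (hN : ∀ p ∈ Icc s t, ∀ q ∈ Icc s t, ∀ x, N p x ≤ Real.exp |γ p - γ q| * N q x)
    (hcont : ContinuousOn (fun τ => N τ (u τ)) (Icc s t))
    (hder : ∀ τ ∈ Icc s t, HasDerivAt (fun z => N τ (u z)) (N' τ) τ)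
    (hN' : ∀ τ ∈ Icc s t, N' τ ≤ k * (N τ (u τ) + η)) :
    N t (u t) + η ≤ Real.exp (γ t - γ s + k * (t - s)) * (N s (u s) + η) := by
  set f : ℝ → ℝ := fun τ => Real.exp (-γ τ - k * τ) * (N τ (u τ) + η) with hf
  have key : f t ≤ f s := by
    refine antitone_of_slope hst ?_ fun x hx r hr => ?_
    · exact (Real.continuous_exp.comp_continuousOn (by fun_prop)).mul (hcont.add continuousOn_const)
    · have hx' := Ico_subset_Icc_self hx
      -- The form is frozen at time x. To the right of x the comparison of forms gives f ≤ g, with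
      -- equality at x, so a slope bound for the differentiable g is one for f.
      set g : ℝ → ℝ := fun z => Real.exp (-γ x - k * z) * (N x (u z) + η) with hg
      have hgd : HasDerivAt g (Real.exp (-γ x - k * x) * (N' x - k * (N x (u x) + η))) x := by
        have h1 : HasDerivAt (fun z => Real.exp (-γ x - k * z))
            (Real.exp (-γ x - k * x) * (-(k * 1))) x :=
          (((hasDerivAt_id x).const_mul k).const_sub (-γ x)).exp
        refine (h1.mul ((hder x hx').add_const η)).congr_deriv ?_
        ring
      have hneg : Real.exp (-γ x - k * x) * (N' x - k * (N x (u x) + η)) < r :=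
        lt_of_le_of_lt (mul_nonpos_of_nonneg_of_nonpos (Real.exp_nonneg _)
          (by linarith [hN' x hx'])) hr
      have h2 : ∀ᶠ z in 𝓝[>] x, slope g x z < r :=
        ((hasDerivAt_iff_tendsto_slope.1 hgd).mono_left
          (nhdsWithin_mono x fun z hz => (ne_of_gt hz : z ≠ x))).eventually_lt_const hneg
      have h3 : ∀ᶠ z in 𝓝[>] x, z ∈ Ioc x t := Ioc_mem_nhdsGT hx.2
      refine (Eventually.frequently ?_)
      filter_upwards [h2, h3] with z hz hz3
      refine lt_of_le_of_lt ?_ hz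
      rw [slope_def_field, slope_def_field]
      have hz' : z ∈ Icc s t := ⟨hx.1.trans hz3.1.le, hz3.2⟩
      have hzx : 0 < z - x := sub_pos.2 hz3.1
      refine div_le_div_of_nonneg_right (sub_le_sub_right ?_ _) hzx.le
      have h4 := hN z hz' x hx' (u z)
      have h5 : 0 ≤ γ z - γ x := sub_nonneg.2 (hmono hx' hz' hz3.1.le)
      rw [abs_of_nonneg h5] at h4
      have h6 : η ≤ Real.exp (γ z - γ x) * η := le_mul_of_one_le_left hη (Real.one_le_exp h5)
      calc f z ≤ Real.exp (-γ z - k * z) * (Real.exp (γ z - γ x) * (N x (u z) + η)) := by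
            refine mul_le_mul_of_nonneg_left ?_ (Real.exp_nonneg _)
            linarith
        _ = g z := by
            rw [hg, ← mul_assoc, ← Real.exp_add]
            congr 2
            ring
  have h7 : N t (u t) + η = Real.exp (γ t + k * t) * f t := by
    simp only [hf, ← mul_assoc, ← Real.exp_add]
    rw [show γ t + k * t + (-γ t - k * t) = 0 by ring, Real.exp_zero, one_mul]
  have h8 : Real.exp (γ t - γ s + k * (t - s)) * (N s (u s) + η) = Real.exp (γ t + k * t) * f s := by
    simp only [hf, ← mul_assoc, ← Real.exp_add]
    congr 2
    ring
  rw [h7, h8]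
  gcongr

/-- Energy estimate in both time directions. -/
theorem energy_estimate {X : Type*} {N : ℝ → X → ℝ} {γ : ℝ → ℝ} {a b k η : ℝ} {u : ℝ → X}
    {N' : ℝ → ℝ} (hγ : ContinuousOn γ (Icc a b)) (hmono : MonotoneOn γ (Icc a b)) (hη : 0 ≤ η)
    (hN : ∀ p ∈ Icc a b, ∀ q ∈ Icc a b, ∀ x, N p x ≤ Real.exp |γ p - γ q| * N q x)
    (hcont : ContinuousOn (fun τ => N τ (u τ)) (Icc a b))
    (hder : ∀ τ ∈ Icc a b, HasDerivAt (fun z => N τ (u z)) (N' τ) τ)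
    (hN' : ∀ τ ∈ Icc a b, |N' τ| ≤ k * (N τ (u τ) + η)) {s t : ℝ} (hs : s ∈ Icc a b)
    (ht : t ∈ Icc a b) :
    N t (u t) + η ≤ Real.exp (|γ t - γ s| + k * |t - s|) * (N s (u s) + η) := by
  rcases le_total s t with hst | hst
  · have hsub : Icc s t ⊆ Icc a b := Icc_subset_Icc hs.1 ht.2
    rw [abs_of_nonneg (sub_nonneg.2 (hmono hs ht hst)), abs_of_nonneg (sub_nonneg.2 hst)]
    exact energy_forward hst (hγ.mono hsub) (hmono.mono hsub) hη
      (fun p hp q hq => hN p (hsub hp) q (hsub hq)) (hcont.mono hsub)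
      (fun τ hτ => hder τ (hsub hτ)) (fun τ hτ => (le_abs_self _).trans (hN' τ (hsub hτ)))
  · have hmem : ∀ p ∈ Icc (-s) (-t), -p ∈ Icc a b := fun p hp =>
      ⟨ht.1.trans (by linarith [hp.2]), le_trans (by linarith [hp.1]) hs.2⟩
    have hcn : ContinuousOn (fun p : ℝ => -p) (Icc (-s) (-t)) := continuousOn_id.neg
    -- Time is reversed; γ is negated as well, so that it stays increasing.
    have h := energy_forward (N := fun p => N (-p)) (γ := fun p => -γ (-p)) (u := fun p => u (-p))
      (N' := fun p => -N' (-p)) (s := -s) (t := -t) (k := k) (η := η) (neg_le_neg hst)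
      ((hγ.comp hcn hmem).neg)
      (fun p hp q hq hpq => neg_le_neg (hmono (hmem q hq) (hmem p hp) (neg_le_neg hpq))) hη
      (fun p hp q hq x => by
        rw [show |-γ (-p) - -γ (-q)| = |γ (-p) - γ (-q)| by
          rw [← abs_neg]; congr 1; ring]
        exact hN _ (hmem p hp) _ (hmem q hq) x)
      (hcont.comp hcn hmem)
      (fun p hp => by
        have := (hder (-p) (hmem p hp)).scomp p (hasDerivAt_neg p)
        simpa [Function.comp_def] using this)
      (fun p hp => (neg_le_abs _).trans (hN' _ (hmem p hp)))
    simp only [neg_neg] at h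
    rw [abs_of_nonpos (sub_nonpos.2 (hmono ht hs hst)), abs_of_nonpos (sub_nonpos.2 hst)]
    convert h using 3
    ring

end Energy

end KleinGordon

/-! ### Coercive forms and charged systems -/

namespace KleinGordon

open Set Filter Topology MeasureTheory
open scoped Interval

variable {H : Type*} [NormedAddCommGroup H] [InnerProductSpace ℂ H] [CompleteSpace H]

/-- Lax–Milgram. -/
theorem isUnit_of_coercive {T : H →L[ℂ] H} {m : ℝ} (hm : 0 < m)
    (h : ∀ x, m * ‖x‖ ^ 2 ≤ (⟪x, T x⟫_ℂ).re) : IsUnit T := by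
  refine ContinuousLinearMap.isUnit_of_forall_le_norm_inner_map T (c := ⟨m, hm.le⟩) hm fun x => ?_
  have h1 : (⟪x, T x⟫_ℂ).re ≤ ‖⟪T x, x⟫_ℂ‖ := by
    rw [← norm_inner_symm]
    exact Complex.re_le_norm _
  calc _ = m * ‖x‖ ^ 2 := by rw [mul_comm]; rfl
    _ ≤ _ := (h x).trans h1

theorem inverse_apply_apply {T : H →L[ℂ] H} (h : IsUnit T) (x : H) : Ring.inverse T (T x) = x := by
  have := Ring.inverse_mul_cancel T h
  simpa using congrArg (fun S : H →L[ℂ] H => S x) this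

theorem apply_inverse_apply {T : H →L[ℂ] H} (h : IsUnit T) (x : H) : T (Ring.inverse T x) = x := by
  have := Ring.mul_inverse_cancel T h
  simpa using congrArg (fun S : H →L[ℂ] H => S x) this

theorem inverse_symm {T : H →L[ℂ] H} (h : IsUnit T) (hs : ∀ x y, ⟪T x, y⟫_ℂ = ⟪x, T y⟫_ℂ) (x y : H) :
    ⟪Ring.inverse T x, y⟫_ℂ = ⟪x, Ring.inverse T y⟫_ℂ := by
  conv_lhs => rw [← apply_inverse_apply h y]
  conv_rhs => rw [← apply_inverse_apply h x]
  rw [hs]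

theorem inverse_commute {T S : H →L[ℂ] H} (h : IsUnit T) (hc : ∀ x, S (T x) = T (S x)) (x : H) :
    S (Ring.inverse T x) = Ring.inverse T (S x) := by
  conv_rhs => rw [← apply_inverse_apply h x]
  rw [hc, inverse_apply_apply h]

/-- A symmetric quadratic form with operator `T`. -/
noncomputable def quadForm (T : H →L[ℂ] H) (x : H) : ℝ := (⟪x, T x⟫_ℂ).re

theorem hasDerivAt_quadForm {T : H →L[ℂ] H} (hs : ∀ x y, ⟪T x, y⟫_ℂ = ⟪x, T y⟫_ℂ) {u : ℝ → H}
    {u' : H} {τ : ℝ} (hu : HasDerivAt u u' τ) :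
    HasDerivAt (fun z => quadForm T (u z)) (2 * (⟪u τ, T u'⟫_ℂ).re) τ := by
  have hT : HasDerivAt (fun z => T (u z)) (T u') τ :=
    (T.restrictScalars ℝ).hasFDerivAt.comp_hasDerivAt τ hu
  have h := (Complex.reCLM.hasFDerivAt.comp_hasDerivAt τ (hu.inner ℂ hT))
  refine h.congr_deriv ?_
  have : ⟪u', T (u τ)⟫_ℂ = conj ⟪u τ, T u'⟫_ℂ := by
    rw [← hs, inner_conj_symm]
  have h2 : (⟪T u', u τ⟫_ℂ).re = (⟪u τ, T u'⟫_ℂ).re := inner_re_symm (𝕜 := ℂ) _ _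
  rw [this]
  simp [two_mul, h2]

/-- Inversion reverses the order of positive forms. It transfers the comparison of the energies A(t)
to the dual energies. -/
theorem quadForm_inverse_le {S T : H →L[ℂ] H} {κ : ℝ} (hκ : 0 < κ) (hS : IsUnit S) (hT : IsUnit T)
    (hSs : ∀ x y, ⟪S x, y⟫_ℂ = ⟪x, S y⟫_ℂ)
    (hS0 : ∀ x, 0 ≤ quadForm S x) (hle : ∀ x, quadForm S x ≤ κ * quadForm T x) (f : H) :
    quadForm (Ring.inverse T) f ≤ κ * quadForm (Ring.inverse S) f := by
  set p := Ring.inverse T f with hp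
  set r := Ring.inverse S f with hr
  have hSr : S r = f := apply_inverse_apply hS f
  have hTp : T p = f := apply_inverse_apply hT f
  -- Expanding the nonnegative number S(p - κr), with Sr = Tp = f, gives S(p) - 2κ(f|p) + κ²(f|r);
  -- since S(p) ≤ κ(f|p), the claim follows after division by κ.
  have h1 := hS0 (p - (κ : ℂ) • r)
  have h2 : quadForm S (p - (κ : ℂ) • r) =
      quadForm S p - 2 * κ * (⟪f, p⟫_ℂ).re + κ ^ 2 * (⟪f, r⟫_ℂ).re := by
    have e1 : ⟪r, S p⟫_ℂ = ⟪f, p⟫_ℂ := by rw [← hSs, hSr]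
    have e2 : (⟪p, f⟫_ℂ).re = (⟪f, p⟫_ℂ).re := inner_re_symm (𝕜 := ℂ) p f
    have e3 : (⟪r, f⟫_ℂ).re = (⟪f, r⟫_ℂ).re := inner_re_symm (𝕜 := ℂ) r f
    simp only [quadForm, map_sub, map_smul, hSr, inner_sub_left, inner_sub_right, inner_smul_left,
      inner_smul_right, e1, Complex.sub_re, Complex.conj_ofReal, Complex.re_ofReal_mul, e2, e3]
    ring
  have h3 := hle p
  have h4 : quadForm T p = (⟪f, p⟫_ℂ).re := by
    rw [quadForm, hTp]
    exact inner_re_symm (𝕜 := ℂ) p f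
  have h5 : quadForm (Ring.inverse T) f = (⟪f, p⟫_ℂ).re := rfl
  have h6 : quadForm (Ring.inverse S) f = (⟪f, r⟫_ℂ).re := rfl
  rw [h5, h6]
  rw [h2] at h1
  rw [h4] at h3
  have h7 : κ * (⟪f, p⟫_ℂ).re ≤ κ * (κ * (⟪f, r⟫_ℂ).re) := by nlinarith
  exact le_of_mul_le_mul_left h7 hκ

/-- The data of an equation `i ∂ₜ (ℓ v) = (σ A(t) + P ℓ) v` on a Hilbert space: `ℓ` represents the
inclusion of the form domain, `σ` the charge, `A t` the energy and `P` a bounded perturbation. The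
energy forms at different times are compared by the function `γ`. -/
structure ChargedSystem (J : Set ℝ) (ℓ σ P : H →L[ℂ] H) (A : ℝ → H →L[ℂ] H) (γ : ℝ → ℝ) :
    Prop where
  ℓ_nonneg : 0 ≤ ℓ
  ℓ_inj : Function.Injective ℓ
  σ_symm : ∀ x y, ⟪σ x, y⟫_ℂ = ⟪x, σ y⟫_ℂ
  σ_sq : ∀ x, σ (σ x) = x
  σ_comm : ∀ x, σ (ℓ x) = ℓ (σ x)
  P_comm : ∀ x, P (ℓ x) = ℓ (P x)
  P_symm : ∀ x y, ⟪σ (P x), y⟫_ℂ = ⟪x, σ (P y)⟫_ℂ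
  A_symm : ∀ t ∈ J, ∀ x y, ⟪A t x, y⟫_ℂ = ⟪x, A t y⟫_ℂ
  A_coercive : ∀ t ∈ J, ∃ m : ℝ, 0 < m ∧ ∀ x, m * ‖x‖ ^ 2 ≤ quadForm (A t) x
  A_cont : ContinuousOn A J
  γ_cont : ContinuousOn γ J
  γ_mono : MonotoneOn γ J
  A_comp : ∀ t ∈ J, ∀ s ∈ J, ∀ x, quadForm (A t) x ≤ Real.exp |γ t - γ s| * quadForm (A s) x

/-- The energy form on the larger space. -/
noncomputable def dualEnergy (σ : H →L[ℂ] H) (A : ℝ → H →L[ℂ] H) (t : ℝ) : H →L[ℂ] H :=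
  σ * Ring.inverse (A t) * σ

/-- The operator adjoint to `R` with respect to the charge. -/
noncomputable def chargeAdjoint (σ R : H →L[ℂ] H) : H →L[ℂ] H :=
  σ * ContinuousLinearMap.adjoint R * σ

namespace ChargedSystem

variable {J J' : Set ℝ} {ℓ σ P : H →L[ℂ] H} {A : ℝ → H →L[ℂ] H} {γ : ℝ → ℝ}

theorem mono (S : ChargedSystem J ℓ σ P A γ) (h : J' ⊆ J) : ChargedSystem J' ℓ σ P A γ where
  ℓ_nonneg := S.ℓ_nonneg
  ℓ_inj := S.ℓ_inj
  σ_symm := S.σ_symm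
  σ_sq := S.σ_sq
  σ_comm := S.σ_comm
  P_comm := S.P_comm
  P_symm := S.P_symm
  A_symm t ht := S.A_symm t (h ht)
  A_coercive t ht := S.A_coercive t (h ht)
  A_cont := S.A_cont.mono h
  γ_cont := S.γ_cont.mono h
  γ_mono := S.γ_mono.mono h
  A_comp t ht s hs := S.A_comp t (h ht) s (h hs)

variable (S : ChargedSystem J ℓ σ P A γ)
include S

theorem ℓ_symm (x y : H) : ⟪ℓ x, y⟫_ℂ = ⟪x, ℓ y⟫_ℂ :=
  ((ContinuousLinearMap.nonneg_iff_isPositive ℓ).1 S.ℓ_nonneg).inner_left_eq_inner_right x y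

theorem denseRange_ℓ : DenseRange ℓ := by
  have h : (ℓ.range)ᗮ = ⊥ := by
    rw [Submodule.eq_bot_iff]
    intro x hx
    refine S.ℓ_inj ?_
    rw [map_zero, ← inner_self_eq_zero (𝕜 := ℂ), ← S.ℓ_symm]
    have := (Submodule.mem_orthogonal _ _).1 hx (ℓ (ℓ x)) ⟨ℓ x, rfl⟩
    exact this
  have h2 := (Submodule.topologicalClosure_eq_top_iff (K := ℓ.range)).2 h
  exact Submodule.dense_iff_topologicalClosure_eq_top.2 h2

theorem isUnit_A {t : ℝ} (ht : t ∈ J) : IsUnit (A t) := by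
  obtain ⟨m, hm, h⟩ := S.A_coercive t ht
  exact isUnit_of_coercive hm h

theorem quadForm_A_nonneg {t : ℝ} (ht : t ∈ J) (x : H) : 0 ≤ quadForm (A t) x := by
  obtain ⟨m, hm, h⟩ := S.A_coercive t ht
  exact le_trans (by positivity) (h x)

theorem dualEnergy_symm {t : ℝ} (ht : t ∈ J) (x y : H) :
    ⟪dualEnergy σ A t x, y⟫_ℂ = ⟪x, dualEnergy σ A t y⟫_ℂ := by
  simp only [dualEnergy, mul_apply_eq_comp]
  rw [S.σ_symm, inverse_symm (S.isUnit_A ht) (S.A_symm t ht), S.σ_symm]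

theorem quadForm_dualEnergy (t : ℝ) (x : H) :
    quadForm (dualEnergy σ A t) x = quadForm (Ring.inverse (A t)) (σ x) := by
  simp only [quadForm, dualEnergy, mul_apply_eq_comp]
  rw [S.σ_symm]

theorem dualEnergy_σ_A {t : ℝ} (ht : t ∈ J) (x : H) : dualEnergy σ A t (σ (A t x)) = σ x := by
  simp only [dualEnergy, mul_apply_eq_comp]
  rw [S.σ_sq, inverse_apply_apply (S.isUnit_A ht)]

/-- The leading part σA(t) of the generator is an isometry from the energy norm onto the dual energy
norm. Coercivity of the dual form and duality of the bounds both rest on this. -/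
theorem quadForm_dualEnergy_σ_A {t : ℝ} (ht : t ∈ J) (x : H) :
    quadForm (dualEnergy σ A t) (σ (A t x)) = quadForm (A t) x := by
  rw [quadForm, S.dualEnergy_σ_A ht, S.σ_symm, S.σ_sq, S.A_symm t ht, quadForm]

theorem σ_A_dualEnergy {t : ℝ} (ht : t ∈ J) (x : H) : σ (A t (σ (dualEnergy σ A t x))) = x := by
  simp only [dualEnergy, mul_apply_eq_comp]
  rw [S.σ_sq, apply_inverse_apply (S.isUnit_A ht), S.σ_sq]

theorem dualEnergy_comp {t s : ℝ} (ht : t ∈ J) (hs : s ∈ J) (x : H) :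
    quadForm (dualEnergy σ A t) x ≤ Real.exp |γ t - γ s| * quadForm (dualEnergy σ A s) x := by
  rw [S.quadForm_dualEnergy, S.quadForm_dualEnergy, abs_sub_comm]
  exact quadForm_inverse_le (Real.exp_pos _) (S.isUnit_A hs) (S.isUnit_A ht) (S.A_symm s hs)
    (S.quadForm_A_nonneg hs) (S.A_comp s hs t ht) _

theorem continuousOn_dualEnergy : ContinuousOn (dualEnergy σ A) J := by
  have h : ContinuousOn (fun t => Ring.inverse (A t)) J := by
    intro t ht
    obtain ⟨u, hu⟩ := S.isUnit_A ht
    have := NormedRing.inverse_continuousAt u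
    rw [hu] at this
    exact this.comp_continuousWithinAt (S.A_cont t ht)
  exact (continuousOn_const.mul h).mul continuousOn_const

theorem dualEnergy_coercive {t : ℝ} (ht : t ∈ J) :
    ∃ m : ℝ, 0 < m ∧ ∀ x, m * ‖x‖ ^ 2 ≤ quadForm (dualEnergy σ A t) x := by
  obtain ⟨m, hm, h⟩ := S.A_coercive t ht
  refine ⟨m / (‖σ‖ ^ 2 * ‖A t‖ ^ 2 + 1), by positivity, fun x => ?_⟩
  have h1 := S.σ_A_dualEnergy ht x
  have h2 := S.quadForm_dualEnergy_σ_A ht (σ (dualEnergy σ A t x))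
  rw [h1] at h2
  rw [h2, div_mul_eq_mul_div, div_le_iff₀ (by positivity)]
  set y := σ (dualEnergy σ A t x)
  have h3 : ‖x‖ ≤ ‖σ‖ * (‖A t‖ * ‖y‖) := by
    rw [← h1]
    exact (σ.le_opNorm _).trans (by gcongr; exact (A t).le_opNorm _)
  calc m * ‖x‖ ^ 2 ≤ m * (‖σ‖ * (‖A t‖ * ‖y‖)) ^ 2 := by gcongr
    _ = (m * ‖y‖ ^ 2) * (‖σ‖ ^ 2 * ‖A t‖ ^ 2) := by ring
    _ ≤ quadForm (A t) y * (‖σ‖ ^ 2 * ‖A t‖ ^ 2 + 1) := by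
        have := h y
        have h0 := S.quadForm_A_nonneg ht y
        gcongr
        linarith

theorem quadForm_dualEnergy_nonneg {t : ℝ} (ht : t ∈ J) (x : H) :
    0 ≤ quadForm (dualEnergy σ A t) x := by
  obtain ⟨m, hm, h⟩ := S.dualEnergy_coercive ht
  exact le_trans (by positivity) (h x)

/-- Stability of `R` for the energy on the larger space gives stability of its charge adjoint for
the energy on the smaller space. -/
theorem quadForm_chargeAdjoint_le {R : H →L[ℂ] H} {t s κ : ℝ} (ht : t ∈ J) (hs : s ∈ J)
    (hκ : 0 < κ)
    (hR : ∀ x, quadForm (dualEnergy σ A s) (R x) ≤ κ * quadForm (dualEnergy σ A t) x) (v : H) :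
    quadForm (A t) (chargeAdjoint σ R v) ≤ κ * quadForm (A s) v := by
  set w := chargeAdjoint σ R v with hw
  set z := R (σ (A t w)) with hz
  set E := quadForm (A t) w with hE
  have h1 : quadForm (dualEnergy σ A s) z ≤ κ * E := by
    have := hR (σ (A t w))
    rwa [S.quadForm_dualEnergy_σ_A ht] at this
  have h2 : E = (⟪v, σ z⟫_ℂ).re := by
    rw [hE, quadForm]
    have e : ⟪w, A t w⟫_ℂ = ⟪σ (ContinuousLinearMap.adjoint R (σ v)), A t w⟫_ℂ := rfl
    rw [e, S.σ_symm, ContinuousLinearMap.adjoint_inner_left, S.σ_symm]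
  set y := Ring.inverse (A s) (σ z) with hy
  have hAy : A s y = σ z := apply_inverse_apply (S.isUnit_A hs) _
  have h3 : quadForm (A s) y = quadForm (dualEnergy σ A s) z := by
    rw [S.quadForm_dualEnergy, quadForm, hAy, quadForm]
    exact inner_re_symm (𝕜 := ℂ) _ _
  -- A Cauchy–Schwarz argument for the form A(s): here E = Re(v|A(s)y) and A(s) evaluated at y is at
  -- most κE, so nonnegativity at κv - y gives κE ≤ κ² times the form at v.
  have h4 := S.quadForm_A_nonneg hs ((κ : ℂ) • v - y)
  have h5 : quadForm (A s) ((κ : ℂ) • v - y) =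
      κ ^ 2 * quadForm (A s) v - 2 * κ * E + quadForm (A s) y := by
    have e1 : (⟪y, A s v⟫_ℂ).re = (⟪v, σ z⟫_ℂ).re := by
      rw [← S.A_symm s hs, hAy]
      exact inner_re_symm (𝕜 := ℂ) _ _
    rw [h2]
    simp only [quadForm, map_sub, map_smul, inner_sub_left, inner_sub_right, inner_smul_left,
      inner_smul_right, Complex.sub_re, Complex.conj_ofReal, Complex.re_ofReal_mul, e1, hAy]
    ring
  rw [h5, h3] at h4
  have h6 : κ * E ≤ κ * (κ * quadForm (A s) v) := by nlinarith
  exact le_of_mul_le_mul_left h6 hκ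

end ChargedSystem

end KleinGordon

/-! ### Regularized propagators -/

namespace KleinGordon

open Set Filter Topology MeasureTheory
open scoped Interval

variable {H : Type*} [NormedAddCommGroup H] [InnerProductSpace ℂ H] [CompleteSpace H]

namespace ChargedSystem

variable {ℓ σ P : H →L[ℂ] H} {A : ℝ → H →L[ℂ] H} {γ : ℝ → ℝ} {a b : ℝ}
variable (S : ChargedSystem (Icc a b) ℓ σ P A γ)
include S

/-- On a compact interval the energies are uniformly equivalent to the norm. -/
theorem exists_uniform_bounds (hab : a ≤ b) : ∃ m M : ℝ, 0 < m ∧ 0 < M ∧ (∀ t ∈ Icc a b, ‖A t‖ ≤ M) ∧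
    ∀ t ∈ Icc a b, ‖dualEnergy σ A t‖ ≤ M ∧
      ∀ x, m * ‖x‖ ^ 2 ≤ quadForm (dualEnergy σ A t) x ∧
        quadForm (dualEnergy σ A t) x ≤ M * ‖x‖ ^ 2 := by
  obtain ⟨M₁, hM₁⟩ := isCompact_Icc.exists_bound_of_continuousOn S.A_cont
  obtain ⟨M₂, hM₂⟩ := isCompact_Icc.exists_bound_of_continuousOn S.continuousOn_dualEnergy
  have ha := left_mem_Icc.2 hab
  obtain ⟨m, hm, h⟩ := S.dualEnergy_coercive ha
  -- Coercivity is assumed only pointwise in t. The constant at `a` is carried to all other times by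
  -- the comparison of forms, at the cost of the total variation of γ.
  refine ⟨Real.exp (-|γ b - γ a|) * m, max 1 (max M₁ M₂), by positivity, by positivity,
    fun t ht => (hM₁ t ht).trans (by simp), fun t ht => ?_⟩
  have hM := (hM₂ t ht).trans (by simp : M₂ ≤ max 1 (max M₁ M₂))
  refine ⟨hM, fun x => ⟨?_, ?_⟩⟩
  · have h1 := (h x).trans (S.dualEnergy_comp ha ht x)
    have h2 : |γ a - γ t| ≤ |γ b - γ a| := by
      rw [abs_sub_comm, abs_of_nonneg (sub_nonneg.2 (S.γ_mono ha ht ht.1)),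
        abs_of_nonneg (sub_nonneg.2 (S.γ_mono ha (right_mem_Icc.2 hab) hab))]
      linarith [S.γ_mono ht (right_mem_Icc.2 hab) ht.2]
    have h3 := S.quadForm_dualEnergy_nonneg ht x
    calc Real.exp (-|γ b - γ a|) * m * ‖x‖ ^ 2 = Real.exp (-|γ b - γ a|) * (m * ‖x‖ ^ 2) := by ring
      _ ≤ Real.exp (-|γ b - γ a|) *
          (Real.exp |γ b - γ a| * quadForm (dualEnergy σ A t) x) := by
        refine mul_le_mul_of_nonneg_left (h1.trans ?_) (Real.exp_nonneg _)
        gcongr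
      _ = quadForm (dualEnergy σ A t) x := by
        rw [← mul_assoc, ← Real.exp_add, neg_add_cancel, Real.exp_zero, one_mul]
  · calc quadForm (dualEnergy σ A t) x ≤ ‖⟪x, dualEnergy σ A t x⟫_ℂ‖ := Complex.re_le_norm _
      _ ≤ ‖x‖ * ‖dualEnergy σ A t x‖ := norm_inner_le_norm _ _
      _ ≤ ‖x‖ * (max 1 (max M₁ M₂) * ‖x‖) := by
        gcongr
        exact (dualEnergy σ A t).le_of_opNorm_le hM x
      _ = _ := by ring

/-- The dual energy cancels A(t), so the leading term reduces to a charge pairing of z with d. Its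
imaginary part vanishes if z = (ℓ + ε)d and is small for a difference of two regularized solutions.
-/
theorem re_dualEnergy_generator {t : ℝ} (ht : t ∈ Icc a b) (z d : H) :
    (⟪z, dualEnergy σ A t (-Complex.I • (σ (A t d) + P z))⟫_ℂ).re =
      (⟪z, σ d⟫_ℂ).im + (⟪z, dualEnergy σ A t (P z)⟫_ℂ).im := by
  rw [map_smul, map_add, S.dualEnergy_σ_A ht, inner_smul_right, inner_add_right]
  simp

omit S in
theorem continuousOn_quadForm {T : ℝ → H →L[ℂ] H} {u : ℝ → H} {s : Set ℝ} (hT : ContinuousOn T s)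
    (hu : ContinuousOn u s) : ContinuousOn (fun τ => quadForm (T τ) (u τ)) s :=
  Complex.continuous_re.comp_continuousOn (hu.inner (hT.clm_apply hu))

omit S in
theorem abs_im_inner_le {T Q : H →L[ℂ] H} {m M : ℝ} (hm : 0 < m) {z : H}
    (hT : ‖T‖ ≤ M) (h : m * ‖z‖ ^ 2 ≤ quadForm T z) :
    |(⟪z, T (Q z)⟫_ℂ).im| ≤ M * ‖Q‖ / m * quadForm T z := by
  have hM : 0 ≤ M := (norm_nonneg _).trans hT
  calc |(⟪z, T (Q z)⟫_ℂ).im| ≤ ‖⟪z, T (Q z)⟫_ℂ‖ := Complex.abs_im_le_norm _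
    _ ≤ ‖z‖ * ‖T (Q z)‖ := norm_inner_le_norm _ _
    _ ≤ ‖z‖ * (M * (‖Q‖ * ‖z‖)) := by
      gcongr
      exact (T.le_of_opNorm_le hT _).trans (by gcongr; exact Q.le_opNorm z)
    _ = M * ‖Q‖ / m * (m * ‖z‖ ^ 2) := by field_simp
    _ ≤ _ := by gcongr

omit S in
theorem isUnit_add_smul {ℓ : H →L[ℂ] H} (hℓ : 0 ≤ ℓ) {ε : ℝ} (hε : 0 < ε) :
    IsUnit (ℓ + (ε : ℂ) • (1 : H →L[ℂ] H)) := by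
  refine isUnit_of_coercive hε fun x => ?_
  have h2 : (0 : ℝ) ≤ (⟪x, ℓ x⟫_ℂ).re :=
    ((ContinuousLinearMap.nonneg_iff_isPositive ℓ).1 hℓ).re_inner_nonneg_right x
  have h3 : (((‖x‖ : ℂ) ^ 2).re) = ‖x‖ ^ 2 := by rw [← Complex.ofReal_pow, Complex.ofReal_re]
  change _ ≤ (⟪x, ℓ x + (ε : ℂ) • x⟫_ℂ).re
  rw [inner_add_right, inner_smul_right, Complex.add_re, Complex.re_ofReal_mul,
    inner_self_eq_norm_sq_to_K]
  simp only [Complex.coe_algebraMap, h3]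
  linarith

/-- The propagator of the equation in which `ℓ` is replaced by an invertible operator with inverse
`E`. -/
theorem exists_propagator_of_inverse (hab : a ≤ b) (E : H →L[ℂ] H)
    (hEs : ∀ x y, ⟪E x, y⟫_ℂ = ⟪x, E y⟫_ℂ) (hEσ : ∀ x, σ (E x) = E (σ x))
    (hEP : ∀ x, P (E x) = E (P x)) :
    ∃ R : ℝ → ℝ → H →L[ℂ] H, (∀ t, R t t = 1) ∧ (∀ t s r, R t s * R s r = R t r) ∧
      (∀ t ∈ Icc a b, ∀ s x, HasDerivAt (fun τ => R τ s x)
        (-Complex.I • (σ (A t (E (R t s x))) + P (R t s x))) t) ∧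
      ∀ t s x y, ⟪R t s x, σ (E (R t s y))⟫_ℂ = ⟪x, σ (E y)⟫_ℂ := by
  obtain ⟨M, hMA⟩ := isCompact_Icc.exists_bound_of_continuousOn S.A_cont
  -- Times are clamped to [a, b], which makes the coefficients continuous and bounded on all of ℝ.
  -- The propagator then exists for all times but solves the original equation only on [a, b].
  have hπc : Continuous fun t => (projIcc a b hab t : ℝ) :=
    continuous_subtype_val.comp continuous_projIcc
  have hπm : ∀ t, (projIcc a b hab t : ℝ) ∈ Icc a b := fun t => (projIcc a b hab t).2
  generalize hπ : (fun t => (projIcc a b hab t : ℝ)) = π at hπc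
  have hπm : ∀ t, π t ∈ Icc a b := fun t => by rw [← hπ]; exact hπm t
  have hπe : ∀ t ∈ Icc a b, π t = t := fun t ht => by simp [← hπ, projIcc_of_mem hab ht]
  have hAc : Continuous fun t => A (π t) := S.A_cont.comp_continuous hπc hπm
  have hGc : Continuous fun t => -Complex.I • (σ * A (π t) * E + P) := by
    have h1 : Continuous fun t => σ * A (π t) * E + P :=
      (((continuous_const (y := σ)).mul hAc).mul (continuous_const (y := E))).add
        (continuous_const (y := P))
    exact h1.const_smul (-Complex.I)
  have hGb : ∀ t, ‖-Complex.I • (σ * A (π t) * E + P)‖ ≤ ‖σ‖ * M * ‖E‖ + ‖P‖ := fun t => by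
    rw [norm_smul, norm_neg, Complex.norm_I, one_mul]
    refine (norm_add_le _ _).trans (add_le_add_left ((norm_mul_le _ _).trans ?_) _)
    refine mul_le_mul_of_nonneg_right ((norm_mul_le _ _).trans ?_) (norm_nonneg _)
    exact mul_le_mul_of_nonneg_left (hMA _ (hπm t)) (norm_nonneg _)
  obtain ⟨R, hR1, hR2, hR3⟩ := exists_propagator hGc hGb
  have hder : ∀ t s x, HasDerivAt (fun τ => R τ s x)
      (-Complex.I • (σ (A (π t) (E (R t s x))) + P (R t s x))) t := fun t s x =>
    ((ContinuousLinearMap.apply ℂ H x).restrictScalars ℝ).hasFDerivAt.comp_hasDerivAt t (hR3 t s)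
  refine ⟨R, hR1, hR2, fun t ht s x => by simpa only [hπe t ht] using hder t s x,
    fun t s x y => ?_⟩
  -- The charge form σE is conserved: its derivative vanishes because A and σP are symmetric and E
  -- commutes with σ and P.
  have hd : ∀ τ, HasDerivAt (fun τ => ⟪R τ s x, σ (E (R τ s y))⟫_ℂ) 0 τ := by
    intro τ
    have h2 : HasDerivAt (fun τ => σ (E (R τ s y)))
        (σ (E (-Complex.I • (σ (A (π τ) (E (R τ s y))) + P (R τ s y))))) τ :=
      ((σ * E).restrictScalars ℝ).hasFDerivAt.comp_hasDerivAt τ (hder τ s y)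
    refine ((hder τ s x).inner ℂ h2).congr_deriv ?_
    generalize R τ s x = x'
    generalize R τ s y = y'
    have e1 : ⟪σ (A (π τ) (E x')), σ (E y')⟫_ℂ = ⟪x', σ (E (σ (A (π τ) (E y'))))⟫_ℂ := by
      rw [S.σ_symm, S.σ_sq, S.A_symm _ (hπm τ), hEs, hEσ, S.σ_sq]
    have e2 : ⟪P x', σ (E y')⟫_ℂ = ⟪x', σ (E (P y'))⟫_ℂ := by
      rw [← S.σ_symm, S.P_symm, hEP]
    simp only [map_smul, map_add, inner_smul_left, inner_smul_right, inner_add_left,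
      inner_add_right, e1, e2, map_neg, Complex.conj_I]
    ring
  have := is_const_of_deriv_eq_zero (fun τ => (hd τ).differentiableAt) (fun τ => (hd τ).deriv) t s
  simpa [hR1] using this

omit S in
theorem norm_le_of_quadForm_le {R : H →L[ℂ] H} {q r : H → ℝ} {m M K : ℝ} (hm : 0 < m)
    (hK : 0 ≤ K) (hq : ∀ x, m * ‖x‖ ^ 2 ≤ q x) (hr : ∀ x, r x ≤ M * ‖x‖ ^ 2)
    (h : ∀ x, q (R x) ≤ K * r x) : ‖R‖ ≤ Real.sqrt (K * M / m) := by
  refine ContinuousLinearMap.opNorm_le_bound _ (Real.sqrt_nonneg _) fun x => ?_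
  have h1 : ‖R x‖ ^ 2 ≤ K * M / m * ‖x‖ ^ 2 := by
    rw [div_mul_eq_mul_div, le_div_iff₀ hm]
    have h2 := mul_le_mul_of_nonneg_left (hr x) hK
    linarith [hq (R x), h x]
  calc ‖R x‖ = Real.sqrt (‖R x‖ ^ 2) := (Real.sqrt_sq (norm_nonneg _)).symm
    _ ≤ Real.sqrt (K * M / m * ‖x‖ ^ 2) := Real.sqrt_le_sqrt h1
    _ = _ := by rw [Real.sqrt_mul' _ (sq_nonneg _), Real.sqrt_sq (norm_nonneg _)]

end ChargedSystem

/-- A bounded approximation of the propagator, obtained by replacing `ℓ` by `ℓ + ε`. -/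
structure IsRegularized (a b : ℝ) (ℓ σ P : H →L[ℂ] H) (A : ℝ → H →L[ℂ] H) (γ : ℝ → ℝ)
    (k C ε : ℝ) (R : ℝ → ℝ → H →L[ℂ] H) : Prop where
  self : ∀ t, R t t = 1
  mul : ∀ t s r, R t s * R s r = R t r
  inter : ∀ t s v, R t s (ℓ v + (ε : ℂ) • v) =
    ℓ (chargeAdjoint σ (R s t) v) + (ε : ℂ) • chargeAdjoint σ (R s t) v
  hasDerivAt : ∀ t ∈ Icc a b, ∀ s v, HasDerivAt (fun τ => R τ s (ℓ v + (ε : ℂ) • v))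
    (-Complex.I • (σ (A t (chargeAdjoint σ (R s t) v)) + P (R t s (ℓ v + (ε : ℂ) • v)))) t
  continuousOn : ∀ s v, ContinuousOn (fun τ => chargeAdjoint σ (R s τ) v) (Icc a b)
  norm_le : ∀ t ∈ Icc a b, ∀ s ∈ Icc a b, ‖R t s‖ ≤ C
  energy_le : ∀ t ∈ Icc a b, ∀ s ∈ Icc a b, ∀ x, quadForm (dualEnergy σ A t) (R t s x) ≤
    Real.exp (|γ t - γ s| + k * |t - s|) * quadForm (dualEnergy σ A s) x

namespace ChargedSystem

variable {ℓ σ P : H →L[ℂ] H} {A : ℝ → H →L[ℂ] H} {γ : ℝ → ℝ} {a b : ℝ}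
variable (S : ChargedSystem (Icc a b) ℓ σ P A γ)
include S

/-- The point is that k and C do not depend on ε. The norm of (ℓ + ε)⁻¹ blows up as ε tends to 0,
but it never enters the energy estimate. -/
theorem exists_regularized (hab : a ≤ b) : ∃ k C : ℝ, 0 ≤ k ∧ 0 ≤ C ∧ ∀ ε : ℝ, 0 < ε →
    ∃ R : ℝ → ℝ → H →L[ℂ] H, IsRegularized a b ℓ σ P A γ k C ε R := by
  obtain ⟨m, M, hm, hM, hMA, hG⟩ := S.exists_uniform_bounds hab
  have hk0 : 0 ≤ 2 * (M * ‖P‖ / m) := by positivity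
  refine ⟨2 * (M * ‖P‖ / m),
    Real.sqrt (Real.exp (|γ b - γ a| + 2 * (M * ‖P‖ / m) * |b - a|) * M / m), hk0,
    Real.sqrt_nonneg _, fun ε hε => ?_⟩
  have hunit := isUnit_add_smul S.ℓ_nonneg hε
  have hℓe_apply : ∀ v, (ℓ + (ε : ℂ) • (1 : H →L[ℂ] H)) v = ℓ v + (ε : ℂ) • v := fun v => rfl
  generalize ℓ + (ε : ℂ) • (1 : H →L[ℂ] H) = ℓe at hunit hℓe_apply
  have hEs := inverse_symm hunit fun x y => by
    rw [hℓe_apply, hℓe_apply, inner_add_left, inner_add_right, inner_smul_left, inner_smul_right,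
      S.ℓ_symm, Complex.conj_ofReal]
  have hEσ := inverse_commute (S := σ) hunit fun x => by simp [hℓe_apply, S.σ_comm]
  have hEP := inverse_commute (S := P) hunit fun x => by simp [hℓe_apply, S.P_comm]
  obtain ⟨R, hR1, hR2, hder, hinv⟩ := S.exists_propagator_of_inverse hab _ hEs hEσ hEP
  have hcancel : ∀ t s x, R t s (R s t x) = x := fun t s x => by
    have := congrArg (fun T : H →L[ℂ] H => T x) (hR2 t s t)
    simpa [hR1] using this
  -- Conservation of charge, read as a formula for the adjoint of R(s,t): conjugating R(t,s) by ℓ +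
  -- ε gives an operator whose bound is uniform in ε by duality.
  have hadj : ∀ t s v, Ring.inverse ℓe (R t s (ℓe v)) = chargeAdjoint σ (R s t) v := by
    intro t s v
    have h1 : σ (Ring.inverse ℓe (R t s (ℓe v))) =
        ContinuousLinearMap.adjoint (R s t) (σ v) := by
      refine ext_inner_left ℂ fun u => ?_
      rw [ContinuousLinearMap.adjoint_inner_right]
      have := hinv t s (R s t u) (ℓe v)
      rwa [hcancel, inverse_apply_apply hunit] at this
    rw [← S.σ_sq (Ring.inverse ℓe (R t s (ℓe v))), h1]
    rfl
  have hinter : ∀ t s v, R t s (ℓe v) = ℓe (chargeAdjoint σ (R s t) v) := fun t s v => by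
    rw [← hadj, apply_inverse_apply hunit]
  have henergy : ∀ t ∈ Icc a b, ∀ s ∈ Icc a b, ∀ x, quadForm (dualEnergy σ A t) (R t s x) ≤
        Real.exp (|γ t - γ s| + 2 * (M * ‖P‖ / m) * |t - s|) *
          quadForm (dualEnergy σ A s) x := by
    intro t ht s hs x
    have := energy_estimate (N := fun t x => quadForm (dualEnergy σ A t) x) (u := fun t => R t s x)
      (k := 2 * (M * ‖P‖ / m)) (η := 0) S.γ_cont S.γ_mono le_rfl
      (fun p hp q hq x => S.dualEnergy_comp hp hq x)
      (continuousOn_quadForm S.continuousOn_dualEnergy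
        (fun τ hτ => (hder τ hτ s x).continuousAt.continuousWithinAt))
      (fun τ hτ => hasDerivAt_quadForm (S.dualEnergy_symm hτ) (hder τ hτ s x)) (fun τ hτ => ?_)
      hs ht
    · simpa [hR1] using this
    · rw [S.re_dualEnergy_generator hτ]
      have e0 : (⟪R τ s x, σ (Ring.inverse ℓe (R τ s x))⟫_ℂ).im = 0 := by
        rw [← Complex.conj_eq_iff_im, inner_conj_symm, S.σ_symm, hEs, hEσ]
      rw [e0, zero_add, abs_mul, abs_two, add_zero, mul_assoc]
      exact mul_le_mul_of_nonneg_left (abs_im_inner_le hm (hG τ hτ).1 ((hG τ hτ).2 _).1)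
        zero_le_two
  refine ⟨R, hR1, hR2, by simpa only [hℓe_apply] using hinter, fun t ht s v => ?_,
    fun s v t ht => ?_, fun t ht s hs => ?_, henergy⟩
  · have := hder t ht s (ℓe v)
    rw [hadj] at this
    simpa only [hℓe_apply] using this
  · simp only [← hadj]
    exact ((Ring.inverse ℓe).continuous.continuousAt.comp
      (hder t ht s (ℓe v)).continuousAt).continuousWithinAt
  · refine norm_le_of_quadForm_le hm (Real.exp_nonneg _) (fun x => ((hG t ht).2 x).1)
      (fun x => ((hG s hs).2 x).2) fun x => (henergy t ht s hs x).trans ?_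
    refine mul_le_mul_of_nonneg_right (Real.exp_le_exp.2 (add_le_add ?_ ?_))
      (S.quadForm_dualEnergy_nonneg hs x)
    · rw [abs_of_nonneg (sub_nonneg.2
        (S.γ_mono (left_mem_Icc.2 hab) (right_mem_Icc.2 hab) hab)), abs_le]
      have h1 := fun p (hp : p ∈ Icc a b) => S.γ_mono (left_mem_Icc.2 hab) hp hp.1
      have h2 := fun p (hp : p ∈ Icc a b) => S.γ_mono hp (right_mem_Icc.2 hab) hp.2
      constructor <;> linarith [h1 t ht, h1 s hs, h2 t ht, h2 s hs]
    · refine mul_le_mul_of_nonneg_left ?_ hk0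
      rw [abs_of_nonneg (sub_nonneg.2 hab), abs_le]
      constructor <;> linarith [ht.1, ht.2, hs.1, hs.2]

end ChargedSystem

end KleinGordon

/-! ### Strong convergence, and closeness of two regularizations -/

namespace KleinGordon

open Set Filter Topology MeasureTheory
open scoped Interval

section StrongConvergence

variable {X Y : Type*} [NormedAddCommGroup X] [NormedSpace ℂ X] [NormedAddCommGroup Y]
  [NormedSpace ℂ Y] {α : Type*} {l : Filter α}

theorem tendsto_clm_apply_of_bounded {T : α → X →L[ℂ] Y} {T₀ : X →L[ℂ] Y} {y : α → X} {y₀ : X}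
    {C : ℝ} (hb : ∀ᶠ i in l, ‖T i‖ ≤ C) (hT : Tendsto (fun i => T i y₀) l (𝓝 (T₀ y₀)))
    (hy : Tendsto y l (𝓝 y₀)) : Tendsto (fun i => T i (y i)) l (𝓝 (T₀ y₀)) := by
  have h1 : Tendsto (fun i => T i (y i - y₀)) l (𝓝 0) := by
    refine squeeze_zero_norm' (a := fun i => C * ‖y i - y₀‖) ?_ ?_
    · filter_upwards [hb] with i hi
      exact (T i).le_of_opNorm_le hi _
    · have := (tendsto_iff_norm_sub_tendsto_zero.1 hy).const_mul C
      simpa using this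
  have h2 := h1.add hT
  simp only [zero_add] at h2
  exact h2.congr fun i => by rw [← map_add, sub_add_cancel]

/-- Strong convergence of bounded operators to the identity, or to any bounded operator, only has to
be checked on a dense set. -/
theorem tendsto_clm_of_dense {Z : Type*} {T : α → X →L[ℂ] Y} {T₀ : X →L[ℂ] Y} {C : ℝ}
    (hb : ∀ᶠ i in l, ‖T i‖ ≤ C) {j : Z → X} (hj : DenseRange j)
    (hT : ∀ z, Tendsto (fun i => T i (j z)) l (𝓝 (T₀ (j z)))) (x : X) :
    Tendsto (fun i => T i x) l (𝓝 (T₀ x)) := by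
  rw [Metric.tendsto_nhds]
  intro ε hε
  set D : ℝ := |C| + ‖T₀‖ + 1 with hD
  have hD0 : 0 < D := by positivity
  obtain ⟨z, hz⟩ := hj.exists_dist_lt x (show 0 < ε / 2 / D by positivity)
  filter_upwards [hb, Metric.tendsto_nhds.1 (hT z) (ε / 2) (half_pos hε)] with i hi h2
  rw [dist_eq_norm] at hz h2 ⊢
  have h3 : T i x - T₀ x = T i (x - j z) + (T i (j z) - T₀ (j z)) - T₀ (x - j z) := by
    simp only [map_sub]; abel
  have h4 : ‖T i (x - j z)‖ ≤ |C| * ‖x - j z‖ :=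
    (T i).le_of_opNorm_le (hi.trans (le_abs_self C)) _
  have h5 := T₀.le_opNorm (x - j z)
  have h6 : D * ‖x - j z‖ < ε / 2 := by
    rw [lt_div_iff₀ hD0] at hz
    linarith
  rw [h3]
  have h7 := norm_sub_le (T i (x - j z) + (T i (j z) - T₀ (j z))) (T₀ (x - j z))
  have h8 := norm_add_le (T i (x - j z)) (T i (j z) - T₀ (j z))
  have h9 : D * ‖x - j z‖ = |C| * ‖x - j z‖ + ‖T₀‖ * ‖x - j z‖ + ‖x - j z‖ := by rw [hD]; ring
  linarith [norm_nonneg (x - j z)]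

/-- A bounded sequence of operators which converges on a dense set converges strongly. -/
theorem exists_strong_limit [CompleteSpace X] [CompleteSpace Y] {Z : Type*} {T : ℕ → X →L[ℂ] Y}
    {C : ℝ} (hb : ∀ n, ‖T n‖ ≤ C) {j : Z → X} (hj : DenseRange j)
    (hT : ∀ z, CauchySeq fun n => T n (j z)) :
    ∃ T₀ : X →L[ℂ] Y, ∀ x, Tendsto (fun n => T n x) atTop (𝓝 (T₀ x)) := by
  have hC : 0 ≤ C := (norm_nonneg _).trans (hb 0)
  have hc : ∀ x, CauchySeq fun n => T n x := by
    intro x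
    rw [Metric.cauchySeq_iff]
    intro ε hε
    obtain ⟨z, hz⟩ := hj.exists_dist_lt x (show 0 < ε / 3 / (C + 1) by positivity)
    obtain ⟨N, hN⟩ := Metric.cauchySeq_iff.1 (hT z) (ε / 3) (by positivity)
    refine ⟨N, fun m hm n hn => ?_⟩
    have h2 := hN m hm n hn
    rw [dist_eq_norm] at hz h2 ⊢
    rw [lt_div_iff₀ (by positivity)] at hz
    have h4 := (T m).le_of_opNorm_le (hb m) (x - j z)
    have h5 := (T n).le_of_opNorm_le (hb n) (x - j z)
    have h3 : T m x - T n x = T m (x - j z) + (T m (j z) - T n (j z)) - T n (x - j z) := by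
      simp only [map_sub]; abel
    rw [h3]
    have h7 := norm_sub_le (T m (x - j z) + (T m (j z) - T n (j z))) (T n (x - j z))
    have h8 := norm_add_le (T m (x - j z)) (T m (j z) - T n (j z))
    have h9 : ‖x - j z‖ * (C + 1) = C * ‖x - j z‖ + ‖x - j z‖ := by ring
    linarith [norm_nonneg (x - j z)]
  choose f hf using fun x => cauchySeq_tendsto_of_complete (hc x)
  exact ⟨continuousLinearMapOfTendsto T (f := f) (tendsto_pi_nhds.2 hf), hf⟩

/-- A locally bounded evolution is jointly strongly continuous if it is strongly continuous on the
diagonal. -/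
theorem isStronglyContinuousEvolution_of_diagonal {J : Set ℝ} {R : ℝ → ℝ → X →L[ℂ] X}
    (h1 : ∀ t ∈ J, R t t = 1) (h2 : ∀ t ∈ J, ∀ s ∈ J, ∀ r ∈ J, R t s * R s r = R t r)
    (hb : ∀ s ∈ J, ∃ C : ℝ, ∀ᶠ t in 𝓝[J] s, ‖R t s‖ ≤ C ∧ ‖R s t‖ ≤ C)
    (hc : ∀ s ∈ J, ∀ x, Tendsto (fun t => R t s x) (𝓝[J] s) (𝓝 x)) :
    IsStronglyContinuousEvolution J R := by
  refine ⟨h1, h2, ?_⟩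
  rintro x ⟨t₀, s₀⟩ ⟨ht₀, hs₀⟩
  change Tendsto (fun p : ℝ × ℝ => R p.1 p.2 x) (𝓝[J ×ˢ J] (t₀, s₀)) (𝓝 (R t₀ s₀ x))
  have hfst : Tendsto Prod.fst (𝓝[J ×ˢ J] (t₀, s₀)) (𝓝[J] t₀) := by
    rw [nhdsWithin_prod_eq]; exact tendsto_fst
  have hsnd : Tendsto Prod.snd (𝓝[J ×ˢ J] (t₀, s₀)) (𝓝[J] s₀) := by
    rw [nhdsWithin_prod_eq]; exact tendsto_snd
  obtain ⟨C₁, hC₁⟩ := hb t₀ ht₀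
  obtain ⟨C₂, hC₂⟩ := hb s₀ hs₀
  have hback : Tendsto (fun s => R s₀ s x) (𝓝[J] s₀) (𝓝 x) := by
    have h3 : Tendsto (fun s => R s₀ s (x - R s s₀ x)) (𝓝[J] s₀)
        (𝓝 ((0 : X →L[ℂ] X) 0)) :=
      tendsto_clm_apply_of_bounded (hC₂.mono fun _ h => h.2)
        (by simp only [map_zero]; exact tendsto_const_nhds)
        (by simpa using (tendsto_const_nhds (x := x)).sub (hc s₀ hs₀ x))
    have h4 := h3.add_const x
    simp only [zero_apply, zero_add] at h4
    refine h4.congr' ?_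
    filter_upwards [self_mem_nhdsWithin] with s hs
    have := congrArg (fun T : X →L[ℂ] X => T x) (h2 s₀ hs₀ s hs s₀ hs₀)
    simp only [h1 s₀ hs₀, mul_apply_eq_comp, one_apply_eq_self] at this
    rw [map_sub, this, sub_add_cancel]
  have h5 : Tendsto (fun p : ℝ × ℝ => R p.1 t₀ (R t₀ s₀ (R s₀ p.2 x))) (𝓝[J ×ˢ J] (t₀, s₀))
      (𝓝 ((1 : X →L[ℂ] X) (R t₀ s₀ x))) :=
    tendsto_clm_apply_of_bounded (hfst.eventually (hC₁.mono fun _ h => h.1))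
      ((hc t₀ ht₀ _).comp hfst)
      (((R t₀ s₀).continuous.tendsto x).comp (hback.comp hsnd))
  refine Tendsto.congr' ?_ h5
  filter_upwards [self_mem_nhdsWithin] with p hp
  have e1 := congrArg (fun T : X →L[ℂ] X => T x) (h2 t₀ ht₀ s₀ hs₀ p.2 hp.2)
  have e2 := congrArg (fun T : X →L[ℂ] X => T x) (h2 p.1 hp.1 t₀ ht₀ p.2 hp.2)
  simp only [mul_apply_eq_comp] at e1 e2
  rw [e1, e2]

end StrongConvergence

variable {H : Type*} [NormedAddCommGroup H] [InnerProductSpace ℂ H] [CompleteSpace H]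

theorem norm_chargeAdjoint_le {σ R : H →L[ℂ] H} {C : ℝ} (h : ‖R‖ ≤ C) :
    ‖chargeAdjoint σ R‖ ≤ ‖σ‖ * C * ‖σ‖ := by
  refine (norm_mul_le _ _).trans (mul_le_mul_of_nonneg_right ((norm_mul_le _ _).trans ?_)
    (norm_nonneg _))
  rw [LinearIsometryEquiv.norm_map]
  exact mul_le_mul_of_nonneg_left h (norm_nonneg _)

namespace ChargedSystem

variable {ℓ σ P : H →L[ℂ] H} {A : ℝ → H →L[ℂ] H} {γ : ℝ → ℝ} {a b : ℝ}
variable (S : ChargedSystem (Icc a b) ℓ σ P A γ)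
include S

theorem inner_chargeAdjoint (R : H →L[ℂ] H) (u v : H) :
    ⟪u, chargeAdjoint σ R v⟫_ℂ = ⟪R (σ u), σ v⟫_ℂ := by
  change ⟪u, σ (ContinuousLinearMap.adjoint R (σ v))⟫_ℂ = _
  rw [← S.σ_symm, ContinuousLinearMap.adjoint_inner_right]

theorem chargeAdjoint_one : chargeAdjoint σ 1 = 1 := by
  have h : ContinuousLinearMap.adjoint (1 : H →L[ℂ] H) = 1 := star_one (H →L[ℂ] H)
  ext v
  rw [chargeAdjoint, h, mul_one]
  exact S.σ_sq v

theorem chargeAdjoint_mul (R R' : H →L[ℂ] H) :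
    chargeAdjoint σ (R * R') = chargeAdjoint σ R' * chargeAdjoint σ R := by
  have h : ContinuousLinearMap.adjoint (R * R') =
      ContinuousLinearMap.adjoint R' * ContinuousLinearMap.adjoint R := star_mul R R'
  ext v
  simp only [chargeAdjoint, h, mul_apply_eq_comp, S.σ_sq]

/-- Two approximations of the propagator are close to each other. -/
theorem exists_regularized_sub_le (hab : a ≤ b) {k C : ℝ} (hC : 0 ≤ C) :
    ∃ D : ℝ, ∀ ε δ : ℝ, 0 < ε → 0 < δ → ε ≤ 1 → δ ≤ 1 → ∀ R R' : ℝ → ℝ → H →L[ℂ] H,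
      IsRegularized a b ℓ σ P A γ k C ε R → IsRegularized a b ℓ σ P A γ k C δ R' →
      ∀ t ∈ Icc a b, ∀ s ∈ Icc a b, ∀ v,
        ‖R t s (ℓ v + (ε : ℂ) • v) - R' t s (ℓ v + (δ : ℂ) • v)‖ ^ 2 ≤ D * (ε + δ) * ‖v‖ ^ 2 := by
  obtain ⟨m, M, hm, hM, hMA, hG⟩ := S.exists_uniform_bounds hab
  -- The first summand controls P, as for a single approximation; the additional 1 absorbs the
  -- source term of size η created by ε ≠ δ.
  set q : ℝ := 2 * (M * ‖P‖ / m) + 1 with hq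
  have hq1 : 1 ≤ q := by
    have : 0 ≤ 2 * (M * ‖P‖ / m) := by positivity
    linarith
  set B : ℝ := ‖σ‖ * C * ‖σ‖ with hB
  have hB0 : 0 ≤ B := by positivity
  -- Chosen so that the charge pairing left over from ε and δ is at most η/2, with η as below.
  set c : ℝ := 4 * (B * ‖σ‖ * B) with hc
  have hc0 : 0 ≤ c := by positivity
  set K : ℝ := Real.exp (|γ b - γ a| + q * |b - a|) with hK
  refine ⟨K * (M + c) / m, fun ε δ hε hδ hε1 hδ1 R R' hR hR' t ht s hs v => ?_⟩
  set V : ℝ → H := fun τ => chargeAdjoint σ (R s τ) v with hV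
  set V' : ℝ → H := fun τ => chargeAdjoint σ (R' s τ) v with hV'
  have hVb : ∀ τ ∈ Icc a b, ‖V τ‖ ≤ B * ‖v‖ := fun τ hτ =>
    ContinuousLinearMap.le_of_opNorm_le _ (norm_chargeAdjoint_le (hR.norm_le s hs τ hτ)) v
  have hVb' : ∀ τ ∈ Icc a b, ‖V' τ‖ ≤ B * ‖v‖ := fun τ hτ =>
    ContinuousLinearMap.le_of_opNorm_le _ (norm_chargeAdjoint_le (hR'.norm_le s hs τ hτ)) v
  set z : ℝ → H := fun τ => R τ s (ℓ v + (ε : ℂ) • v) - R' τ s (ℓ v + (δ : ℂ) • v) with hz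
  set η : ℝ := c * (ε + δ) * ‖v‖ ^ 2 with hη
  have hη0 : 0 ≤ η := by positivity
  have hzd : ∀ τ ∈ Icc a b,
      HasDerivAt z (-Complex.I • (σ (A τ (V τ - V' τ)) + P (z τ))) τ := by
    intro τ hτ
    refine ((hR.hasDerivAt τ hτ s v).sub (hR'.hasDerivAt τ hτ s v)).congr_deriv ?_
    simp only [hz, map_sub, ← smul_sub]
    congr 1
    abel
  have hen := energy_estimate (N := fun t x => quadForm (dualEnergy σ A t) x) (u := z)
    (k := q) (η := η) S.γ_cont S.γ_mono hη0 (fun p hp r hr x => S.dualEnergy_comp hp hr x)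
    (continuousOn_quadForm S.continuousOn_dualEnergy
      (fun τ hτ => (hzd τ hτ).continuousAt.continuousWithinAt))
    (fun τ hτ => hasDerivAt_quadForm (S.dualEnergy_symm hτ) (hzd τ hτ)) (fun τ hτ => ?_) hs ht
  · have hzs : z s = ((ε - δ : ℝ) : ℂ) • v := by
      simp only [hz, hR.self, hR'.self, one_apply_eq_self]
      push_cast
      rw [sub_smul]
      abel
    have h1 : quadForm (dualEnergy σ A s) (z s) ≤ M * (ε + δ) * ‖v‖ ^ 2 := by
      refine ((hG s hs).2 _).2.trans ?_
      rw [hzs, norm_smul, Complex.norm_real, Real.norm_eq_abs, mul_pow, sq_abs, ← mul_assoc]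
      gcongr
      nlinarith
    have h2 := ((hG t ht).2 (z t)).1
    have hexp : Real.exp (|γ t - γ s| + q * |t - s|) ≤ K := by
      refine Real.exp_le_exp.2 (add_le_add ?_ (mul_le_mul_of_nonneg_left ?_ (by linarith)))
      · rw [abs_of_nonneg (sub_nonneg.2
          (S.γ_mono (left_mem_Icc.2 hab) (right_mem_Icc.2 hab) hab)), abs_le]
        have h1 := fun p (hp : p ∈ Icc a b) => S.γ_mono (left_mem_Icc.2 hab) hp hp.1
        have h2 := fun p (hp : p ∈ Icc a b) => S.γ_mono hp (right_mem_Icc.2 hab) hp.2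
        constructor <;> linarith [h1 t ht, h1 s hs, h2 t ht, h2 s hs]
      · rw [abs_of_nonneg (sub_nonneg.2 hab), abs_le]
        constructor <;> linarith [ht.1, ht.2, hs.1, hs.2]
    have h3 : m * ‖z t‖ ^ 2 ≤ K * (M * (ε + δ) * ‖v‖ ^ 2 + η) := by
      calc m * ‖z t‖ ^ 2 ≤ quadForm (dualEnergy σ A t) (z t) + η := by linarith
        _ ≤ Real.exp (|γ t - γ s| + q * |t - s|) * (quadForm (dualEnergy σ A s) (z s) + η) := hen
        _ ≤ K * (M * (ε + δ) * ‖v‖ ^ 2 + η) := by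
          have := S.quadForm_dualEnergy_nonneg hs (z s)
          gcongr
    have h4 : K * (M + c) / m * (ε + δ) * ‖v‖ ^ 2 = K * (M * (ε + δ) * ‖v‖ ^ 2 + η) / m := by
      rw [hη]
      field_simp
    rw [h4, le_div_iff₀ hm, mul_comm]
    exact h3
  · rw [S.re_dualEnergy_generator hτ]
    set d := V τ - V' τ with hd
    -- The part ℓd pairs with σd to a real number, so only the remainder of order ε + δ contributes.
    -- It is bounded because V and V' are bounded independently of ε and δ.
    have hzτ : z τ = ℓ d + ((ε : ℂ) • V τ - (δ : ℂ) • V' τ) := by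
      simp only [hz, hR.inter, hR'.inter, hd, map_sub]
      abel
    have e0 : (⟪ℓ d, σ d⟫_ℂ).im = 0 := by
      rw [← Complex.conj_eq_iff_im, inner_conj_symm, S.σ_symm, S.σ_comm, S.ℓ_symm]
    have hdb : ‖d‖ ≤ 2 * (B * ‖v‖) := by
      linarith [norm_sub_le (V τ) (V' τ), hVb τ hτ, hVb' τ hτ]
    have h5 : |(⟪z τ, σ d⟫_ℂ).im| ≤ η / 2 := by
      conv_lhs => rw [hzτ]
      rw [inner_add_left, Complex.add_im, e0, zero_add]
      refine (Complex.abs_im_le_norm _).trans ((norm_inner_le_norm _ _).trans ?_)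
      have h6 : ‖(ε : ℂ) • V τ - (δ : ℂ) • V' τ‖ ≤ (ε + δ) * (B * ‖v‖) := by
        refine (norm_sub_le _ _).trans ?_
        rw [norm_smul, norm_smul, Complex.norm_real, Complex.norm_real, Real.norm_of_nonneg hε.le,
          Real.norm_of_nonneg hδ.le, add_mul]
        exact add_le_add (mul_le_mul_of_nonneg_left (hVb τ hτ) hε.le)
          (mul_le_mul_of_nonneg_left (hVb' τ hτ) hδ.le)
      have h7 : ‖σ d‖ ≤ ‖σ‖ * (2 * (B * ‖v‖)) :=
        (σ.le_opNorm d).trans (mul_le_mul_of_nonneg_left hdb (norm_nonneg _))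
      calc _ ≤ (ε + δ) * (B * ‖v‖) * (‖σ‖ * (2 * (B * ‖v‖))) := by gcongr
        _ = η / 2 := by rw [hη, hc]; ring
    have h8 := abs_im_inner_le (Q := P) hm (hG τ hτ).1 ((hG τ hτ).2 (z τ)).1
    have h9 := abs_add_le (⟪z τ, σ d⟫_ℂ).im (⟪z τ, dualEnergy σ A τ (P (z τ))⟫_ℂ).im
    have h10 := S.quadForm_dualEnergy_nonneg hτ (z τ)
    rw [abs_mul, abs_two, hq]
    have h11 : 0 ≤ 2 * (M * ‖P‖ / m) * η := by positivity
    nlinarith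

end ChargedSystem

end KleinGordon

/-! ### The limit propagator on a compact interval -/

namespace KleinGordon

open Set Filter Topology MeasureTheory
open scoped Interval

variable {H : Type*} [NormedAddCommGroup H] [InnerProductSpace ℂ H] [CompleteSpace H]

/-- `R` is the evolution of a charged system on the interval `J`, on the larger space; the evolution
on the smaller space is its charge adjoint with times exchanged. -/
structure IsChargedEvolution (J : Set ℝ) (ℓ σ P : H →L[ℂ] H) (A : ℝ → H →L[ℂ] H)
    (R : ℝ → ℝ → H →L[ℂ] H) : Prop where
  evolution : IsStronglyContinuousEvolution J R
  evolution_adjoint : IsStronglyContinuousEvolution J fun t s => chargeAdjoint σ (R s t)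
  inter : ∀ t ∈ J, ∀ s ∈ J, ∀ v, R t s (ℓ v) = ℓ (chargeAdjoint σ (R s t) v)
  hasDerivWithinAt : ∀ t ∈ J, ∀ s ∈ J, ∀ v, HasDerivWithinAt (fun τ => R τ s (ℓ v))
    (-Complex.I • (σ (A t (chargeAdjoint σ (R s t) v)) + P (ℓ (chargeAdjoint σ (R s t) v)))) J t

/-- `R` is a strong limit of approximate propagators. -/
structure IsLimitPropagator (a b : ℝ) (ℓ σ P : H →L[ℂ] H) (A : ℝ → H →L[ℂ] H) (γ : ℝ → ℝ)
    (k C : ℝ) (ε : ℕ → ℝ) (Rn : ℕ → ℝ → ℝ → H →L[ℂ] H) (R : ℝ → ℝ → H →L[ℂ] H) : Prop where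
  nonneg : 0 ≤ C
  pos_le : ∀ n, 0 < ε n ∧ ε n ≤ 1
  tendsto_zero : Tendsto ε atTop (𝓝 0)
  regularized : ∀ n, IsRegularized a b ℓ σ P A γ k C (ε n) (Rn n)
  tendsto : ∀ t ∈ Icc a b, ∀ s ∈ Icc a b, ∀ x,
    Tendsto (fun n => Rn n t s x) atTop (𝓝 (R t s x))

namespace ChargedSystem

variable {ℓ σ P : H →L[ℂ] H} {A : ℝ → H →L[ℂ] H} {γ : ℝ → ℝ} {a b : ℝ}
variable (S : ChargedSystem (Icc a b) ℓ σ P A γ)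
include S

/-- Taking adjoints preserves only weak convergence. For this reason limits on the smaller space are
first obtained weakly. -/
theorem tendsto_inner_chargeAdjoint {α : Type*} {l : Filter α} {T : α → H →L[ℂ] H} {T₀ : H →L[ℂ] H}
    (hT : ∀ x, Tendsto (fun i => T i x) l (𝓝 (T₀ x))) (u v : H) :
    Tendsto (fun i => ⟪u, chargeAdjoint σ (T i) v⟫_ℂ) l (𝓝 ⟪u, chargeAdjoint σ T₀ v⟫_ℂ) := by
  simp only [S.inner_chargeAdjoint]
  exact (hT (σ u)).inner tendsto_const_nhds

/-- The strong limit of the approximations of the propagator. -/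
theorem exists_strong_limit_regularized (hab : a ≤ b) :
    ∃ k C ε Rn R, IsLimitPropagator a b ℓ σ P A γ k C ε Rn R := by
  obtain ⟨k, C, hk, hC, hreg⟩ := S.exists_regularized hab
  have hpos : ∀ n : ℕ, 0 < 1 / ((n : ℝ) + 1) := fun n => by positivity
  have hle : ∀ n : ℕ, 1 / ((n : ℝ) + 1) ≤ 1 := fun n => by
    rw [div_le_one (by positivity)]
    linarith [(Nat.cast_nonneg n : (0 : ℝ) ≤ n)]
  choose Rn hRn using fun n : ℕ => hreg _ (hpos n)
  obtain ⟨D, hD⟩ := S.exists_regularized_sub_le (k := k) hab hC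
  have hlim : ∀ t ∈ Icc a b, ∀ s ∈ Icc a b, ∃ T : H →L[ℂ] H,
      ∀ x, Tendsto (fun n => Rn n t s x) atTop (𝓝 (T x)) := by
    intro t ht s hs
    refine exists_strong_limit (fun n => (hRn n).norm_le t ht s hs) S.denseRange_ℓ fun v => ?_
    have h0 : Tendsto (fun n : ℕ => 1 / ((n : ℝ) + 1)) atTop (𝓝 0) :=
      tendsto_one_div_add_atTop_nhds_zero_nat
    have h1 : CauchySeq fun n : ℕ => Rn n t s (ℓ v + ((1 / ((n : ℝ) + 1) : ℝ) : ℂ) • v) := by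
      rw [Metric.cauchySeq_iff']
      intro r hr
      have h2 : Tendsto (fun n : ℕ => |D| * (1 / ((n : ℝ) + 1)  * 2) * ‖v‖ ^ 2) atTop (𝓝 0) := by
        simpa using ((h0.mul_const 2).const_mul |D|).mul_const (‖v‖ ^ 2)
      obtain ⟨N, hN⟩ := (h2.eventually_lt_const (show 0 < r ^ 2 by positivity)).exists
      refine ⟨N, fun n hn => ?_⟩
      have h3 := hD _ _ (hpos n) (hpos N) (hle n) (hle N) _ _ (hRn n) (hRn N) t ht s hs v
      have h4 : (1 : ℝ) / ((n : ℝ) + 1) ≤ 1 / ((N : ℝ) + 1) := by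
        gcongr
      rw [dist_eq_norm]
      refine lt_of_pow_lt_pow_left₀ 2 hr.le (h3.trans_lt (lt_of_le_of_lt ?_ hN))
      have h6 := hpos n
      have h7 := hpos N
      refine mul_le_mul_of_nonneg_right ?_ (sq_nonneg _)
      exact mul_le_mul (le_abs_self D) (by linarith) (by linarith) (abs_nonneg D)
    -- The estimate concerns initial values (ℓ + ε)v; uniform boundedness removes the term with ε,
    -- leaving the fixed vector ℓv.
    have h5 : Tendsto (fun n : ℕ => ((1 / ((n : ℝ) + 1) : ℝ) : ℂ) • Rn n t s v) atTop (𝓝 0) := by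
      refine squeeze_zero_norm (a := fun n : ℕ => 1 / ((n : ℝ) + 1) * (C * ‖v‖)) (fun n => ?_) ?_
      · rw [norm_smul, Complex.norm_real, Real.norm_of_nonneg (hpos n).le]
        exact mul_le_mul_of_nonneg_left
          ((Rn n t s).le_of_opNorm_le ((hRn n).norm_le t ht s hs) v) (hpos n).le
      · simpa using h0.mul_const (C * ‖v‖)
    obtain ⟨w, hw⟩ := cauchySeq_tendsto_of_complete h1
    refine ((hw.sub h5).congr fun n => ?_).cauchySeq
    rw [map_add, map_smul, add_sub_cancel_right]
  classical
  choose! R hR using hlim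
  exact ⟨k, C, _, Rn, R, hC, fun n => ⟨hpos n, hle n⟩,
    tendsto_one_div_add_atTop_nhds_zero_nat, hRn, hR⟩

omit S in
theorem _root_.KleinGordon.IsLimitPropagator.tendsto_shift {k C : ℝ} {ε : ℕ → ℝ}
    {Rn : ℕ → ℝ → ℝ → H →L[ℂ] H} {R : ℝ → ℝ → H →L[ℂ] H}
    (hR : IsLimitPropagator a b ℓ σ P A γ k C ε Rn R) (v : H) :
    Tendsto (fun n => ℓ v + (ε n : ℂ) • v) atTop (𝓝 (ℓ v)) := by
  have : Tendsto (fun n => (ε n : ℂ)) atTop (𝓝 0) :=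
    (Complex.continuous_ofReal.tendsto' 0 0 (by simp)).comp hR.tendsto_zero
  simpa using (this.smul_const v).const_add (ℓ v)

variable {k C : ℝ} {ε : ℕ → ℝ} {Rn : ℕ → ℝ → ℝ → H →L[ℂ] H} {R : ℝ → ℝ → H →L[ℂ] H}
  (hR : IsLimitPropagator a b ℓ σ P A γ k C ε Rn R)
include hR

omit S in
theorem limit_norm_le : ∀ t ∈ Icc a b, ∀ s ∈ Icc a b, ‖R t s‖ ≤ C := by
  have hε := hR.tendsto_shift
  obtain ⟨hC, hε0, hεlim, hRn, hlim⟩ := id hR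
  exact fun t ht s hs =>
    ContinuousLinearMap.opNorm_le_bound _ hC fun x => le_of_tendsto (hlim t ht s hs x).norm
      (Eventually.of_forall fun n => (Rn n t s).le_of_opNorm_le ((hRn n).norm_le t ht s hs) x)

omit S in
theorem limit_tendsto_apply : ∀ t ∈ Icc a b, ∀ s ∈ Icc a b, ∀ (y : ℕ → H) (y₀ : H), Tendsto y atTop (𝓝 y₀) →
      Tendsto (fun n => Rn n t s (y n)) atTop (𝓝 (R t s y₀)) := by
  have hε := hR.tendsto_shift
  obtain ⟨hC, hε0, hεlim, hRn, hlim⟩ := id hR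
  exact fun t ht s hs y y₀ hy =>
    tendsto_clm_apply_of_bounded
      (Eventually.of_forall fun n => (hRn n).norm_le t ht s hs) (hlim t ht s hs y₀) hy

omit S in
theorem limit_self : ∀ t ∈ Icc a b, R t t = 1 := by
  have hε := hR.tendsto_shift
  obtain ⟨hC, hε0, hεlim, hRn, hlim⟩ := id hR
  exact fun t ht => by
    ext x
    refine tendsto_nhds_unique (hlim t ht t ht x) ?_
    simp only [(hRn _).self, one_apply_eq_self]
    exact tendsto_const_nhds

omit S in
theorem limit_mul : ∀ t ∈ Icc a b, ∀ s ∈ Icc a b, ∀ r ∈ Icc a b, R t s * R s r = R t r := by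
  have hε := hR.tendsto_shift
  obtain ⟨hC, hε0, hεlim, hRn, hlim⟩ := id hR
  have hlim2 := limit_tendsto_apply hR
  intro t ht s hs r hr
  ext x
  refine tendsto_nhds_unique (hlim2 t ht s hs _ _ (hlim s hs r hr x)) ?_
  refine (hlim t ht r hr x).congr fun n => ?_
  rw [← (hRn n).mul t s r]
  rfl

/-- Paired with f, the approximate relation moves ℓ + ε and the charge adjoint to the other side.
Only R(s,t) applied to a convergent sequence remains, and there strong convergence suffices. -/
theorem limit_inter : ∀ t ∈ Icc a b, ∀ s ∈ Icc a b, ∀ v,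
      R t s (ℓ v) = ℓ (chargeAdjoint σ (R s t) v) := by
  have hε := hR.tendsto_shift
  obtain ⟨hC, hε0, hεlim, hRn, hlim⟩ := id hR
  have hlim2 := limit_tendsto_apply hR
  intro t ht s hs v
  refine ext_inner_left ℂ fun f => ?_
  refine tendsto_nhds_unique
    (Tendsto.inner (tendsto_const_nhds (x := f)) (hlim2 t ht s hs _ _ (hε v))) ?_
  have e : ∀ n, ⟪f, Rn n t s (ℓ v + (ε n : ℂ) • v)⟫_ℂ =
      ⟪Rn n s t (σ (ℓ f + (ε n : ℂ) • f)), σ v⟫_ℂ := fun n => by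
    rw [(hRn n).inter, ← S.inner_chargeAdjoint, inner_add_right, inner_add_left,
      inner_smul_left, inner_smul_right, S.ℓ_symm, Complex.conj_ofReal]
  simp only [e]
  rw [← S.ℓ_symm, S.inner_chargeAdjoint]
  exact (hlim2 s hs t ht _ _ ((σ.continuous.tendsto _).comp (hε f))).inner tendsto_const_nhds

omit S in
theorem limit_energy : ∀ t ∈ Icc a b, ∀ s ∈ Icc a b, ∀ x, quadForm (dualEnergy σ A t) (R t s x) ≤
      Real.exp (|γ t - γ s| + k * |t - s|) * quadForm (dualEnergy σ A s) x := by
  have hε := hR.tendsto_shift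
  obtain ⟨hC, hε0, hεlim, hRn, hlim⟩ := id hR
  intro t ht s hs x
  refine le_of_tendsto (f := fun n => quadForm (dualEnergy σ A t) (Rn n t s x)) (x := atTop) ?_
    (Eventually.of_forall fun n => (hRn n).energy_le t ht s hs x)
  have h1 := hlim t ht s hs x
  exact (Complex.continuous_re.tendsto _).comp
    (h1.inner (((dualEnergy σ A t).continuous.tendsto _).comp h1))

/-- The velocities of the approximations are bounded uniformly in n when the initial value comes
from the smaller space. The first bound gives continuity of R on a dense set, the second a
dominating function for the integrated equation. -/
theorem limit_lipschitz (hab : a ≤ b) : ∃ L : ℝ → ℝ, ∀ t ∈ Icc a b, ∀ s ∈ Icc a b, ∀ v,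
      ‖R t s (ℓ v) - ℓ v‖ ≤ L ‖v‖ * |t - s| ∧ ∀ n,
        ‖-Complex.I • (σ (A t (chargeAdjoint σ (Rn n s t) v)) +
          P (Rn n t s (ℓ v + (ε n : ℂ) • v)))‖ ≤ L ‖v‖ := by
  have hε := hR.tendsto_shift
  obtain ⟨hC, hε0, hεlim, hRn, hlim⟩ := id hR
  have hlim2 := limit_tendsto_apply hR
  obtain ⟨m, M, hm, hM, hMA, hG⟩ := S.exists_uniform_bounds hab
  have hVb : ∀ n, ∀ t ∈ Icc a b, ∀ s ∈ Icc a b, ∀ v,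
      ‖chargeAdjoint σ (Rn n s t) v‖ ≤ ‖σ‖ * C * ‖σ‖ * ‖v‖ := fun n t ht s hs v =>
    ContinuousLinearMap.le_of_opNorm_le _ (norm_chargeAdjoint_le ((hRn n).norm_le s hs t ht)) v
  -- a bound for the time derivative of the approximations
  refine ⟨fun r => ‖σ‖ * (M * (‖σ‖ * C * ‖σ‖ * r)) + ‖P‖ * (C * (‖ℓ‖ * r + r)),
    fun t ht s hs v => ?_⟩
  have hε1 : ∀ n, ‖ℓ v + (ε n : ℂ) • v‖ ≤ ‖ℓ‖ * ‖v‖ + ‖v‖ := fun n => by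
    refine (norm_add_le _ _).trans (add_le_add (ℓ.le_opNorm v) ?_)
    rw [norm_smul, Complex.norm_real, Real.norm_of_nonneg (hε0 n).1.le]
    exact mul_le_of_le_one_left (norm_nonneg _) (hε0 n).2
  have hder : ∀ n, ∀ τ ∈ Icc a b,
      ‖-Complex.I • (σ (A τ (chargeAdjoint σ (Rn n s τ) v)) +
        P (Rn n τ s (ℓ v + (ε n : ℂ) • v)))‖ ≤
      ‖σ‖ * (M * (‖σ‖ * C * ‖σ‖ * ‖v‖)) + ‖P‖ * (C * (‖ℓ‖ * ‖v‖ + ‖v‖)) := by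
    intro n τ hτ
    rw [norm_smul, norm_neg, Complex.norm_I, one_mul]
    refine (norm_add_le _ _).trans (add_le_add ?_ ?_)
    · refine (σ.le_opNorm _).trans (mul_le_mul_of_nonneg_left ?_ (norm_nonneg _))
      exact ((A τ).le_of_opNorm_le (hMA τ hτ) _).trans
        (mul_le_mul_of_nonneg_left (hVb n τ hτ s hs v) hM.le)
    · refine (P.le_opNorm _).trans (mul_le_mul_of_nonneg_left ?_ (norm_nonneg _))
      exact ((Rn n τ s).le_of_opNorm_le ((hRn n).norm_le τ hτ s hs) _).trans
        (mul_le_mul_of_nonneg_left (hε1 n) hC)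
  refine ⟨?_, fun n => hder n t ht⟩
  refine le_of_tendsto ((hlim2 t ht s hs _ _ (hε v)).sub (hε v)).norm
    (Eventually.of_forall fun n => ?_)
  have := (convex_Icc a b).norm_image_sub_le_of_norm_hasDerivWithin_le
    (fun τ hτ => ((hRn n).hasDerivAt τ hτ s v).hasDerivWithinAt) (hder n) hs ht
  simpa only [(hRn n).self, one_apply_eq_self, Real.norm_eq_abs] using this

theorem limit_evolution (hab : a ≤ b) : IsStronglyContinuousEvolution (Icc a b) R := by
  have hb := limit_norm_le hR
  have hself := limit_self hR
  have hmul := limit_mul hR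
  obtain ⟨L, hL⟩ := S.limit_lipschitz hR hab
  refine isStronglyContinuousEvolution_of_diagonal hself hmul (fun s hs => ⟨C, ?_⟩) ?_
  · filter_upwards [self_mem_nhdsWithin] with t ht using ⟨hb t ht s hs, hb s hs t ht⟩
  · intro s hs
    refine tendsto_clm_of_dense (T₀ := 1) (C := C) ?_ S.denseRange_ℓ fun v => ?_
    · filter_upwards [self_mem_nhdsWithin] with t ht using hb t ht s hs
    · rw [one_apply_eq_self, tendsto_iff_norm_sub_tendsto_zero]
      refine squeeze_zero' (g := fun t => L ‖v‖ * |t - s|)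
        (Eventually.of_forall fun t => norm_nonneg _) ?_ ?_
      · filter_upwards [self_mem_nhdsWithin] with t ht using (hL t ht s hs v).1
      · have : Continuous fun t : ℝ => L ‖v‖ * |t - s| := by fun_prop
        exact (this.tendsto' s 0 (by simp)).mono_left nhdsWithin_le_nhds

/-- Adjoints of a strongly continuous evolution are a priori only weakly continuous. Weak
convergence of w to v, together with a limsup bound on the energy of w by the energy of v, gives
norm convergence. -/
theorem limit_evolution_adjoint (hab : a ≤ b) : IsStronglyContinuousEvolution (Icc a b) fun t s => chargeAdjoint σ (R s t) := by
  have hb := limit_norm_le hR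
  have hself := limit_self hR
  have hmul := limit_mul hR
  have henergy := limit_energy hR
  have hevol := S.limit_evolution hR hab
  have hb' : ∀ t ∈ Icc a b, ∀ s ∈ Icc a b, ‖chargeAdjoint σ (R s t)‖ ≤ ‖σ‖ * C * ‖σ‖ :=
    fun t ht s hs => norm_chargeAdjoint_le (hb s hs t ht)
  have hdiag : ∀ s ∈ Icc a b, ∀ x, Tendsto (fun t => R s t x) (𝓝[Icc a b] s) (𝓝 x) := by
    intro s hs x
    have h1 : Tendsto (fun t => ((s, t) : ℝ × ℝ)) (𝓝[Icc a b] s)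
        (𝓝[Icc a b ×ˢ Icc a b] (s, s)) := by
      rw [nhdsWithin_prod_eq]
      exact (tendsto_const_nhdsWithin hs).prodMk tendsto_id
    have h2 := (hevol.2.2 x (s, s) ⟨hs, hs⟩).tendsto.comp h1
    simpa only [Function.comp_def, hself s hs, one_apply_eq_self] using h2
  refine isStronglyContinuousEvolution_of_diagonal (fun t ht => ?_) (fun t ht s hs r hr => ?_)
    (fun s hs => ⟨‖σ‖ * C * ‖σ‖, ?_⟩) fun s hs v => ?_
  · rw [hself t ht, S.chargeAdjoint_one]
  · rw [← hmul r hr s hs t ht, S.chargeAdjoint_mul]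
  · filter_upwards [self_mem_nhdsWithin] with t ht using ⟨hb' t ht s hs, hb' s hs t ht⟩
  · obtain ⟨m', hm', hcoer⟩ := S.A_coercive s hs
    have hweak : Tendsto (fun t => (⟪A s v, chargeAdjoint σ (R s t) v⟫_ℂ).re) (𝓝[Icc a b] s)
        (𝓝 (quadForm (A s) v)) := by
      have h1 := S.tendsto_inner_chargeAdjoint (T₀ := 1) (hdiag s hs) (A s v) v
      have h2 := (Complex.continuous_re.tendsto _).comp h1
      have h3 : chargeAdjoint σ 1 v = v := by rw [S.chargeAdjoint_one]; rfl
      rw [h3, S.A_symm s hs] at h2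
      exact h2
    have hγs : Tendsto γ (𝓝[Icc a b] s) (𝓝 (γ s)) := S.γ_cont s hs
    have hid : Tendsto (fun t : ℝ => t) (𝓝[Icc a b] s) (𝓝 s) := tendsto_nhdsWithin_of_tendsto_nhds
      tendsto_id
    -- One summand |γ s - γ t| is the cost of passing from the energy form at time t to the one at
    -- time s; the other belongs to the stability estimate of the evolution.
    have hbound : Tendsto (fun t => ((Real.exp (|γ s - γ t| + (|γ s - γ t| + k * |s - t|)) + 1) *
        quadForm (A s) v - 2 * (⟪A s v, chargeAdjoint σ (R s t) v⟫_ℂ).re) / m')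
        (𝓝[Icc a b] s) (𝓝 0) := by
      have h1 : Tendsto (fun t => |γ s - γ t|) (𝓝[Icc a b] s) (𝓝 0) := by
        simpa using (hγs.const_sub (γ s)).abs
      have h2 : Tendsto (fun t => |s - t|) (𝓝[Icc a b] s) (𝓝 0) := by
        simpa using (hid.const_sub s).abs
      have h3 := (Real.continuous_exp.tendsto _).comp (h1.add (h1.add (h2.const_mul k)))
      have h4 := (((h3.add_const 1).mul_const (quadForm (A s) v)).sub
        (hweak.const_mul 2)).div_const m'
      refine h4.trans (le_of_eq ?_)
      congr 1
      simp
      ring_nf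
      simp
    rw [tendsto_iff_norm_sub_tendsto_zero]
    have hsq : Tendsto (fun t => ‖chargeAdjoint σ (R s t) v - v‖ ^ 2) (𝓝[Icc a b] s) (𝓝 0) := by
      refine squeeze_zero' (Eventually.of_forall fun t => sq_nonneg _) ?_ hbound
      filter_upwards [self_mem_nhdsWithin] with t ht
      set w := chargeAdjoint σ (R s t) v
      rw [le_div_iff₀ hm', mul_comm]
      refine (hcoer _).trans ?_
      have h1 : quadForm (A s) (w - v) =
          quadForm (A s) w + quadForm (A s) v - 2 * (⟪A s v, w⟫_ℂ).re := by
        have e1 : ⟪v, A s w⟫_ℂ = ⟪A s v, w⟫_ℂ := (S.A_symm s hs v w).symm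
        have e2 : (⟪w, A s v⟫_ℂ).re = (⟪A s v, w⟫_ℂ).re := inner_re_symm (𝕜 := ℂ) _ _
        simp only [quadForm, map_sub, inner_sub_left, inner_sub_right, Complex.sub_re, e1, e2]
        ring
      have h2 := S.quadForm_chargeAdjoint_le ht hs (Real.exp_pos _) (henergy s hs t ht) v
      have h3 := S.A_comp s hs t ht w
      have h4 : quadForm (A s) w ≤ Real.exp (|γ s - γ t| + (|γ s - γ t| + k * |s - t|)) *
          quadForm (A s) v := by
        rw [Real.exp_add, mul_assoc]
        exact h3.trans (mul_le_mul_of_nonneg_left h2 (Real.exp_nonneg _))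
      rw [h1]
      linarith
    have := hsq.sqrt
    simpa only [Real.sqrt_sq (norm_nonneg _), Real.sqrt_zero] using this

theorem limit_continuousOn_velocity (hab : a ≤ b) {s : ℝ} (hs : s ∈ Icc a b) (v : H) :
    ContinuousOn (fun τ => -Complex.I • (σ (A τ (chargeAdjoint σ (R s τ) v)) +
      P (ℓ (chargeAdjoint σ (R s τ) v)))) (Icc a b) := by
  have hVc : ContinuousOn (fun τ => chargeAdjoint σ (R s τ) v) (Icc a b) :=
    ContinuousOn.comp (g := fun p : ℝ × ℝ => chargeAdjoint σ (R p.2 p.1) v)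
      (f := fun τ => (τ, s)) ((S.limit_evolution_adjoint hR hab).2.2 v)
      (Continuous.continuousOn (by fun_prop)) fun τ hτ => ⟨hτ, hs⟩
  have h1 : ContinuousOn (fun τ => σ (A τ (chargeAdjoint σ (R s τ) v))) (Icc a b) :=
    σ.continuous.comp_continuousOn (S.A_cont.clm_apply hVc)
  have h2 : ContinuousOn (fun τ => P (ℓ (chargeAdjoint σ (R s τ) v))) (Icc a b) :=
    P.continuous.comp_continuousOn (ℓ.continuous.comp_continuousOn hVc)
  exact (h1.add h2).const_smul (-Complex.I)

theorem limit_tendsto_inner_velocity {s : ℝ} (hs : s ∈ Icc a b) {τ : ℝ} (hτ : τ ∈ Icc a b)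
    (v f : H) : Tendsto (fun n => ⟪f, -Complex.I • (σ (A τ (chargeAdjoint σ (Rn n s τ) v)) +
      P (Rn n τ s (ℓ v + (ε n : ℂ) • v)))⟫_ℂ) atTop
      (𝓝 ⟪f, -Complex.I • (σ (A τ (chargeAdjoint σ (R s τ) v)) +
        P (ℓ (chargeAdjoint σ (R s τ) v)))⟫_ℂ) := by
  have h3 : ∀ w z : H, ⟪f, -Complex.I • (σ (A τ w) + P z)⟫_ℂ =
      -Complex.I * (⟪A τ (σ f), w⟫_ℂ + ⟪f, P z⟫_ℂ) := fun w z => by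
    rw [inner_smul_right, inner_add_right, ← S.σ_symm, S.A_symm τ hτ]
  simp only [h3]
  refine Tendsto.const_mul _ (Tendsto.add ?_ ?_)
  · exact S.tendsto_inner_chargeAdjoint (hR.tendsto s hs τ hτ) _ _
  · rw [← S.limit_inter hR τ hτ s hs]
    exact tendsto_const_nhds.inner
      ((P.continuous.tendsto _).comp (limit_tendsto_apply hR τ hτ s hs _ _ (hR.tendsto_shift v)))

/-- The velocities converge only weakly, so the equation is integrated against a fixed f before
passing to the limit by dominated convergence. -/
theorem limit_inner_integral_eq (hab : a ≤ b) {s : ℝ} (hs : s ∈ Icc a b) (v f : H) {t₁ t₂ : ℝ}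
    (h₁ : t₁ ∈ Icc a b) (h₂ : t₂ ∈ Icc a b) :
    ⟪f, R t₂ s (ℓ v) - R t₁ s (ℓ v)⟫_ℂ = ∫ τ in t₁..t₂,
      ⟪f, -Complex.I • (σ (A τ (chargeAdjoint σ (R s τ) v)) +
        P (ℓ (chargeAdjoint σ (R s τ) v)))⟫_ℂ := by
  obtain ⟨L, hL⟩ := S.limit_lipschitz hR hab
  have hsub : uIcc t₁ t₂ ⊆ Icc a b := ordConnected_Icc.uIcc_subset h₁ h₂
  have hβnc : ∀ n, ContinuousOn (fun τ =>
      ⟪f, -Complex.I • (σ (A τ (chargeAdjoint σ (Rn n s τ) v)) +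
        P (Rn n τ s (ℓ v + (ε n : ℂ) • v)))⟫_ℂ) (Icc a b) := fun n => by
    refine continuousOn_const.inner (ContinuousOn.const_smul (ContinuousOn.add ?_ ?_) _)
    · exact σ.continuous.comp_continuousOn
        (S.A_cont.clm_apply ((hR.regularized n).continuousOn s v))
    · exact P.continuous.comp_continuousOn fun τ hτ =>
        ((hR.regularized n).hasDerivAt τ hτ s v).continuousAt.continuousWithinAt
  have e2 : ∀ n, ∫ τ in t₁..t₂, ⟪f, -Complex.I • (σ (A τ (chargeAdjoint σ (Rn n s τ) v)) +
        P (Rn n τ s (ℓ v + (ε n : ℂ) • v)))⟫_ℂ =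
      ⟪f, Rn n t₂ s (ℓ v + (ε n : ℂ) • v) - Rn n t₁ s (ℓ v + (ε n : ℂ) • v)⟫_ℂ := by
    intro n
    rw [inner_sub_right]
    refine intervalIntegral.integral_eq_sub_of_hasDerivAt
      (f := fun τ => ⟪f, Rn n τ s (ℓ v + (ε n : ℂ) • v)⟫_ℂ) (fun τ hτ => ?_)
      ((hβnc n).mono hsub).intervalIntegrable
    have := (hasDerivAt_const τ f).inner ℂ ((hR.regularized n).hasDerivAt τ (hsub hτ) s v)
    simpa only [inner_zero_left, add_zero] using this
  refine tendsto_nhds_unique (l := atTop) (f := fun n =>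
    ⟪f, Rn n t₂ s (ℓ v + (ε n : ℂ) • v) - Rn n t₁ s (ℓ v + (ε n : ℂ) • v)⟫_ℂ) ?_ ?_
  · exact tendsto_const_nhds.inner
      ((limit_tendsto_apply hR t₂ h₂ s hs _ _ (hR.tendsto_shift v)).sub
        (limit_tendsto_apply hR t₁ h₁ s hs _ _ (hR.tendsto_shift v)))
  · simp only [← e2]
    refine intervalIntegral.tendsto_integral_filter_of_dominated_convergence
      (fun _ => ‖f‖ * L ‖v‖) (Eventually.of_forall fun n => ?_)
      (Eventually.of_forall fun n => Eventually.of_forall fun τ hτ => ?_) (by simp)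
      (Eventually.of_forall fun τ hτ => ?_)
    · exact (((hβnc n).mono hsub).mono uIoc_subset_uIcc).aestronglyMeasurable measurableSet_uIoc
    · exact (norm_inner_le_norm _ _).trans (mul_le_mul_of_nonneg_left
        ((hL τ (hsub (uIoc_subset_uIcc hτ)) s hs v).2 n) (norm_nonneg _))
    · exact S.limit_tendsto_inner_velocity hR hs (hsub (uIoc_subset_uIcc hτ)) v f

/-- The limiting velocity is norm continuous, because the charge adjoints form a strongly continuous
evolution. The weak integral identity therefore becomes a strong one and can be differentiated. -/
theorem limit_hasDerivWithinAt (hab : a ≤ b) {t : ℝ} (ht : t ∈ Icc a b) {s : ℝ}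
    (hs : s ∈ Icc a b) (v : H) : HasDerivWithinAt (fun τ => R τ s (ℓ v))
      (-Complex.I • (σ (A t (chargeAdjoint σ (R s t) v)) + P (ℓ (chargeAdjoint σ (R s t) v))))
      (Icc a b) t := by
  have hBc := S.limit_continuousOn_velocity hR hab hs v
  have hinner := fun (t₂ : ℝ) (h₂ : t₂ ∈ Icc a b) (f : H) =>
    S.limit_inner_integral_eq hR hab hs v f ht h₂
  obtain ⟨β, hβ⟩ : ∃ β : ℝ → H, ∀ τ, -Complex.I • (σ (A τ (chargeAdjoint σ (R s τ) v)) +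
      P (ℓ (chargeAdjoint σ (R s τ) v))) = β τ := ⟨_, fun _ => rfl⟩
  simp only [hβ] at hBc hinner ⊢
  have hpc : Continuous fun τ => β (projIcc a b hab τ) :=
    hBc.comp_continuous (continuous_subtype_val.comp continuous_projIcc)
      fun τ => (projIcc a b hab τ).2
  have hpe : ∀ τ ∈ Icc a b, β (projIcc a b hab τ) = β τ := fun τ hτ => by
    rw [projIcc_of_mem hab hτ]
  have hd : HasDerivWithinAt
      (fun τ => R t s (ℓ v) + ∫ r in t..τ, β (projIcc a b hab r)) (β t) (Icc a b) t := by
    have := (hpc.integral_hasStrictDerivAt t t).hasDerivAt.const_add (R t s (ℓ v))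
    rw [hpe t ht] at this
    exact this.hasDerivWithinAt
  refine hd.congr_of_mem (fun τ hτ => ?_) ht
  have hsub : uIcc t τ ⊆ Icc a b := ordConnected_Icc.uIcc_subset ht hτ
  have e3 : ∫ r in t..τ, β (projIcc a b hab r) = ∫ r in t..τ, β r :=
    intervalIntegral.integral_congr fun r hr => hpe r (hsub hr)
  have e1 : R τ s (ℓ v) - R t s (ℓ v) = ∫ r in t..τ, β r := by
    refine ext_inner_left ℂ fun f => ?_
    rw [hinner τ hτ f]
    exact (innerSL ℂ f).intervalIntegral_comp_comm (hBc.mono hsub).intervalIntegrable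
  rw [e3, ← e1]
  abel

omit hR in
/-- Existence of the evolution on a compact interval. -/
theorem exists_evolution_Icc (hab : a ≤ b) : ∃ R, IsChargedEvolution (Icc a b) ℓ σ P A R := by
  obtain ⟨k, C, ε, Rn, R, hR⟩ := S.exists_strong_limit_regularized hab
  exact ⟨R, S.limit_evolution hR hab, S.limit_evolution_adjoint hR hab, S.limit_inter hR,
    fun t ht s hs v => S.limit_hasDerivWithinAt hR hab ht hs v⟩

end ChargedSystem

end KleinGordon

/-! ### Generated evolutions: local bounds, uniqueness, transport, groups -/

namespace KleinGordon

open Set Filter Topology MeasureTheory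
open scoped Interval

section Generated

variable {X : Type*} [NormedAddCommGroup X] [NormedSpace ℂ X] [CompleteSpace X]
variable {V : Type*} [NormedAddCommGroup V] [NormedSpace ℂ V]
variable {J J' : Set ℝ}

/-- Reduces local questions on J to compact subintervals, for all kinds of interval at once: at an
end point that belongs to J, that point itself serves as an end of the compact interval. -/
theorem exists_Icc_mem_nhdsWithin (hJ : J.OrdConnected) {t s : ℝ} (ht : t ∈ J) (hs : s ∈ J) :
    ∃ a ∈ J, ∃ b ∈ J, a ≤ b ∧ t ∈ Icc a b ∧ s ∈ Icc a b ∧ Icc a b ⊆ J ∧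
      Icc a b ∈ 𝓝[J] t ∧ Icc a b ∈ 𝓝[J] s := by
  have key : ∀ r ∈ J, ∃ a ∈ J, ∃ b ∈ J, r ∈ Icc a b ∧ Icc a b ∈ 𝓝[J] r := by
    intro r hr
    have h1 : ∃ a ∈ J, a ≤ r ∧ Ici a ∈ 𝓝[J] r := by
      by_cases h : ∃ a ∈ J, a < r
      · obtain ⟨a, ha, har⟩ := h
        exact ⟨a, ha, har.le, mem_nhdsWithin_of_mem_nhds (Ici_mem_nhds har)⟩
      · refine ⟨r, hr, le_rfl, ?_⟩
        filter_upwards [self_mem_nhdsWithin] with x hx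
        by_contra hlt
        exact h ⟨x, hx, not_le.1 hlt⟩
    have h2 : ∃ b ∈ J, r ≤ b ∧ Iic b ∈ 𝓝[J] r := by
      by_cases h : ∃ b ∈ J, r < b
      · obtain ⟨b, hb, hrb⟩ := h
        exact ⟨b, hb, hrb.le, mem_nhdsWithin_of_mem_nhds (Iic_mem_nhds hrb)⟩
      · refine ⟨r, hr, le_rfl, ?_⟩
        filter_upwards [self_mem_nhdsWithin] with x hx
        by_contra hlt
        exact h ⟨x, hx, not_le.1 hlt⟩
    obtain ⟨a, ha, har, han⟩ := h1
    obtain ⟨b, hb, hrb, hbn⟩ := h2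
    exact ⟨a, ha, b, hb, ⟨har, hrb⟩, inter_mem han hbn⟩
  obtain ⟨a, ha, b, hb, h1, h2⟩ := key t ht
  obtain ⟨c, hc, d, hd, h3, h4⟩ := key s hs
  have hmin : min a c ∈ J := by rcases min_choice a c with h | h <;> rwa [h]
  have hmax : max b d ∈ J := by rcases max_choice b d with h | h <;> rwa [h]
  have s1 : Icc a b ⊆ Icc (min a c) (max b d) := Icc_subset_Icc (min_le_left _ _) (le_max_left _ _)
  have s2 : Icc c d ⊆ Icc (min a c) (max b d) :=
    Icc_subset_Icc (min_le_right _ _) (le_max_right _ _)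
  exact ⟨_, hmin, _, hmax, (s1 h1).1.trans (s1 h1).2, s1 h1, s2 h3, hJ.out hmin hmax,
    mem_of_superset h2 s1, mem_of_superset h4 s2⟩

theorem IsStronglyContinuousEvolution.exists_bound {R : ℝ → ℝ → X →L[ℂ] X}
    (h : IsStronglyContinuousEvolution J R) {a b : ℝ} (hab : Icc a b ⊆ J) :
    ∃ C : ℝ, ∀ t ∈ Icc a b, ∀ s ∈ Icc a b, ‖R t s‖ ≤ C := by
  obtain ⟨C, hC⟩ := banach_steinhaus
    (g := fun p : (Icc a b ×ˢ Icc a b : Set (ℝ × ℝ)) => R p.1.1 p.1.2) fun x => by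
      obtain ⟨C, hC⟩ := (isCompact_Icc.prod isCompact_Icc).exists_bound_of_continuousOn
        ((h.2.2 x).mono (prod_mono hab hab))
      exact ⟨C, fun p => hC p.1 p.2⟩
  exact ⟨C, fun t ht s hs => hC ⟨(t, s), ht, hs⟩⟩

theorem IsStronglyContinuousEvolution.mono {R : ℝ → ℝ → X →L[ℂ] X}
    (h : IsStronglyContinuousEvolution J R) (hJ : J' ⊆ J) : IsStronglyContinuousEvolution J' R :=
  ⟨fun t ht => h.1 t (hJ ht), fun t ht s hs r hr => h.2.1 t (hJ ht) s (hJ hs) r (hJ hr),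
    fun x => (h.2.2 x).mono (prod_mono hJ hJ)⟩

theorem IsStronglyContinuousEvolution.eventually_bound {R : ℝ → ℝ → X →L[ℂ] X}
    (h : IsStronglyContinuousEvolution J R) (hJ : J.OrdConnected) {t s : ℝ} (ht : t ∈ J)
    (hs : s ∈ J) : ∃ C : ℝ, ∀ᶠ σ in 𝓝[J] s, ‖R t σ‖ ≤ C ∧ ‖R σ t‖ ≤ C := by
  obtain ⟨a, ha, b, hb, hab, hta, hsa, hsub, hnt, hns⟩ := exists_Icc_mem_nhdsWithin hJ ht hs
  obtain ⟨C, hC⟩ := h.exists_bound hsub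
  exact ⟨C, by filter_upwards [hns] with σ hσ using ⟨hC t hta σ hσ, hC σ hσ t hta⟩⟩

theorem IsStronglyContinuousEvolution.tendsto_right {R : ℝ → ℝ → X →L[ℂ] X}
    (h : IsStronglyContinuousEvolution J R) {t s : ℝ} (ht : t ∈ J) (hs : s ∈ J) (x : X) :
    Tendsto (fun σ => R t σ x) (𝓝[J] s) (𝓝 (R t s x)) := by
  have h1 : Tendsto (fun σ => ((t, σ) : ℝ × ℝ)) (𝓝[J] s) (𝓝[J ×ˢ J] (t, s)) := by
    rw [nhdsWithin_prod_eq]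
    exact (tendsto_const_nhdsWithin ht).prodMk tendsto_id
  exact (h.2.2 x (t, s) ⟨ht, hs⟩).tendsto.comp h1

theorem IsStronglyContinuousEvolution.tendsto_left {R : ℝ → ℝ → X →L[ℂ] X}
    (h : IsStronglyContinuousEvolution J R) {t s : ℝ} (ht : t ∈ J) (hs : s ∈ J) (x : X) :
    Tendsto (fun τ => R τ s x) (𝓝[J] t) (𝓝 (R t s x)) := by
  have h1 : Tendsto (fun τ => ((τ, s) : ℝ × ℝ)) (𝓝[J] t) (𝓝[J ×ˢ J] (t, s)) := by
    rw [nhdsWithin_prod_eq]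
    exact tendsto_id.prodMk (tendsto_const_nhdsWithin hs)
  exact (h.2.2 x (t, s) ⟨ht, hs⟩).tendsto.comp h1

/-- A product rule for a family of operators that need not be norm continuous: strong continuity and
local boundedness suffice, and T is differentiated only on the vector w σ. -/
theorem hasDerivWithinAt_clm_apply_of_bounded {T : ℝ → X →L[ℂ] X} {w : ℝ → X} {w' y' : X} {σ C : ℝ}
    (hb : ∀ᶠ τ in 𝓝[J] σ, ‖T τ‖ ≤ C) (hc : ∀ x, Tendsto (fun τ => T τ x) (𝓝[J] σ) (𝓝 (T σ x)))
    (hT : HasDerivWithinAt (fun τ => T τ (w σ)) y' J σ) (hw : HasDerivWithinAt w w' J σ) :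
    HasDerivWithinAt (fun τ => T τ (w τ)) (T σ w' + y') J σ := by
  rw [hasDerivWithinAt_iff_tendsto_slope] at hT hw ⊢
  have hle : 𝓝[J \ {σ}] σ ≤ 𝓝[J] σ := nhdsWithin_mono _ sdiff_subset
  have h1 := tendsto_clm_apply_of_bounded (T₀ := T σ) (hle hb) ((hc w').mono_left hle) hw
  refine (h1.add hT).congr fun τ => ?_
  simp only [slope, vsub_eq_sub]
  have : T τ ((τ - σ)⁻¹ • (w τ - w σ)) = (τ - σ)⁻¹ • T τ (w τ - w σ) :=
    (T τ).map_smul_of_tower _ _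
  rw [this, ← smul_add, map_sub]
  congr 1
  abel

/-- The evolution generated by a family of operators is unique. -/
theorem IsEvolutionGeneratedBy.unique {ι : V →L[ℂ] X} {B : ℝ → V →L[ℂ] X}
    {R R' : ℝ → ℝ → X →L[ℂ] X} (hJ : J.OrdConnected) (hι : DenseRange ι)
    (h : IsEvolutionGeneratedBy J ι B R) (h' : IsEvolutionGeneratedBy J ι B R') {t s : ℝ}
    (ht : t ∈ J) (hs : s ∈ J) : R' t s = R t s := by
  obtain ⟨hR, RV, hRV, -, hd⟩ := h
  obtain ⟨hR', RV', hRV', -, hd'⟩ := h'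
  have key : ∀ v, R' t s (ι v) = R t s (ι v) := by
    intro v
    -- This function interpolates between R' t s v at σ = s and R t s v at σ = t; the derivatives of
    -- the two factors cancel.
    have hder : ∀ σ ∈ J, HasDerivWithinAt (fun σ => R' t σ (R σ s (ι v))) 0 J σ := by
      intro σ hσ
      obtain ⟨C, hC⟩ := hR'.eventually_bound hJ ht hσ
      have h1 := (hd' t ht σ hσ (RV σ s v)).2
      rw [hRV σ hσ s hs v] at h1
      have h2 := hasDerivWithinAt_clm_apply_of_bounded (hC.mono fun _ h => h.1)
        (fun x => hR'.tendsto_right ht hσ x) h1 (hd σ hσ s hs v).1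
      refine h2.congr_deriv ?_
      rw [map_smul, neg_smul, neg_add_cancel]
    have hc := hJ.convex.norm_image_sub_le_of_norm_hasDerivWithin_le (C := 0) hder (by simp) hs ht
    rw [zero_mul, norm_le_zero_iff, sub_eq_zero, hR'.1 t ht, hR.1 s hs] at hc
    exact hc.symm
  exact ContinuousLinearMap.ext fun x =>
    congrFun (hι.equalizer (R' t s).continuous (R t s).continuous (funext key)) x

theorem IsStronglyContinuousEvolution.transport {X' : Type*} [NormedAddCommGroup X']
    [NormedSpace ℂ X'] {Y : Type*} [NormedAddCommGroup Y] [NormedSpace ℂ Y] (g : Y ≃L[ℂ] X')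
    {T : ℝ → ℝ → Y →L[ℂ] Y} {T' : ℝ → ℝ → X' →L[ℂ] X'} (hT : IsStronglyContinuousEvolution J T)
    (hTT : ∀ t ∈ J, ∀ s ∈ J, ∀ x, T' t s (g x) = g (T t s x)) :
    IsStronglyContinuousEvolution J T' := by
  refine ⟨fun t ht => ?_, fun t ht s hs r hr => ?_, fun x => ?_⟩
  · ext x
    obtain ⟨x, rfl⟩ := g.surjective x
    rw [hTT t ht t ht, hT.1 t ht]
    rfl
  · ext x
    obtain ⟨x, rfl⟩ := g.surjective x
    rw [mul_apply_eq_comp, hTT s hs r hr, hTT t ht s hs, hTT t ht r hr, ← hT.2.1 t ht s hs r hr]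
    rfl
  · obtain ⟨x, rfl⟩ := g.surjective x
    exact (g.continuous.comp_continuousOn (hT.2.2 x)).congr fun p hp => hTT _ hp.1 _ hp.2 x

theorem IsEvolutionGeneratedBy.transport {X' V' : Type*} [NormedAddCommGroup X'] [NormedSpace ℂ X']
    [NormedAddCommGroup V'] [NormedSpace ℂ V'] (e : X ≃L[ℂ] X') (f : V ≃L[ℂ] V')
    {ι : V →L[ℂ] X} {B : ℝ → V →L[ℂ] X} {R : ℝ → ℝ → X →L[ℂ] X} {ι' : V' →L[ℂ] X'}
    {B' : ℝ → V' →L[ℂ] X'} {R' : ℝ → ℝ → X' →L[ℂ] X'}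
    (h : IsEvolutionGeneratedBy J ι B R) (hι : ∀ v, ι' (f v) = e (ι v))
    (hB : ∀ t ∈ J, ∀ v, B' t (f v) = e (B t v)) (hR : ∀ t ∈ J, ∀ s ∈ J, ∀ x, R' t s (e x) = e (R t s x)) :
    IsEvolutionGeneratedBy J ι' B' R' := by
  obtain ⟨h1, RV, h2, h3, h4⟩ := h
  refine ⟨h1.transport e hR, fun t s => (f : V →L[ℂ] V') ∘L RV t s ∘L (f.symm : V' →L[ℂ] V), ?_,
    h3.transport f fun t ht s hs x => by simp, ?_⟩
  · intro t ht s hs v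
    obtain ⟨v, rfl⟩ := f.surjective v
    simp [hι, hR t ht s hs, h2 t ht s hs]
  · intro t ht s hs v
    obtain ⟨v, rfl⟩ := f.surjective v
    have e1 := (e.toContinuousLinearMap.restrictScalars ℝ).hasFDerivAt.comp_hasDerivWithinAt t
      (h4 t ht s hs v).1
    have e2 := (e.toContinuousLinearMap.restrictScalars ℝ).hasFDerivAt.comp_hasDerivWithinAt s
      (h4 t ht s hs v).2
    constructor
    · refine (e1.congr_of_mem (fun τ hτ => ?_) ht).congr_deriv ?_
      · rw [hι, hR τ hτ s hs]; rfl
      · simp [hB t ht]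
    · refine (e2.congr_of_mem (fun τ hτ => ?_) hs).congr_deriv ?_
      · rw [hι, hR t ht τ hτ]; rfl
      · simp [hB s hs, hR t ht s hs]

end Generated

section Group

variable {X : Type*} [NormedAddCommGroup X] [NormedSpace ℂ X] [CompleteSpace X]
variable {V : Type*} [NormedAddCommGroup V] [NormedSpace ℂ V] [CompleteSpace V]
variable {ι : V →L[ℂ] X} {B : V →L[ℂ] X} {R : ℝ → ℝ → X →L[ℂ] X}

theorem IsStronglyContinuousEvolution.shift {T : ℝ → ℝ → V →L[ℂ] V}
    (hT : IsStronglyContinuousEvolution univ T) (c : ℝ) :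
    IsStronglyContinuousEvolution univ fun t s => T (t + c) (s + c) := by
  refine ⟨fun t _ => hT.1 _ trivial, fun t _ s _ r _ => hT.2.1 _ trivial _ trivial _ trivial,
    fun x => ?_⟩
  have h1 := hT.2.2 x
  rw [univ_prod_univ, continuousOn_univ] at h1 ⊢
  exact h1.comp (by fun_prop : Continuous fun p : ℝ × ℝ => (p.1 + c, p.2 + c))

theorem IsStronglyContinuousEvolution.continuous_left {T : ℝ → ℝ → V →L[ℂ] V}
    (hT : IsStronglyContinuousEvolution univ T) (s : ℝ) (x : V) : Continuous fun t => T t s x := by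
  have h1 := hT.2.2 x
  rw [univ_prod_univ, continuousOn_univ] at h1
  exact h1.comp (by fun_prop : Continuous fun t : ℝ => (t, s))

theorem IsEvolutionGeneratedBy.shift (h : IsEvolutionGeneratedBy univ ι (fun _ => B) R) (c : ℝ) :
    IsEvolutionGeneratedBy univ ι (fun _ => B) fun t s => R (t + c) (s + c) := by
  obtain ⟨h1, RV, h2, h3, h4⟩ := h
  refine ⟨h1.shift c, fun t s => RV (t + c) (s + c), fun t _ s _ => h2 _ trivial _ trivial, h3.shift c,
    fun t _ s _ v => ?_⟩
  have := h4 (t + c) trivial (s + c) trivial v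
  simp only [hasDerivWithinAt_univ] at this ⊢
  exact ⟨this.1.comp_add_const t c, this.2.comp_add_const s c⟩

/-- A time independent operator generating an evolution generates a group, and so does its part in
the smaller space. -/
theorem IsEvolutionGeneratedBy.isGroupGenerator (hinj : Function.Injective ι) (hι : DenseRange ι)
    (hclosed : ∀ (v : ℕ → V) (x y : X), Tendsto (fun n => ι (v n)) atTop (𝓝 x) →
      Tendsto (fun n => B (v n)) atTop (𝓝 y) → ∃ w, ι w = x ∧ B w = y)
    (h : IsEvolutionGeneratedBy univ ι (fun _ => B) R) :
    IsGroupGenerator (opGraph ι B) ∧ IsGroupGenerator (partGraph ι B) := by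
  have hshift : ∀ c t s, R (t + c) (s + c) = R t s := fun c t s =>
    h.unique ordConnected_univ hι (h.shift c) trivial trivial
  obtain ⟨h1, RV, h2, h3, h4⟩ := h
  have h2 : ∀ t s v, ι (RV t s v) = R t s (ι v) := fun t s => h2 t trivial s trivial
  have h4 : ∀ t s v, HasDerivAt (fun τ => R τ s (ι v)) (-Complex.I • B (RV t s v)) t ∧
      HasDerivAt (fun σ => R t σ (ι v)) (Complex.I • R t s (B v)) s := fun t s v => by
    simpa only [hasDerivWithinAt_univ] using h4 t trivial s trivial v
  have hshiftV : ∀ c t s, RV (t + c) (s + c) = RV t s := fun c t s => by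
    ext v
    refine hinj ?_
    rw [h2, h2, hshift]
  have hc : ∀ x, Continuous fun t => R t 0 x := h1.continuous_left 0
  have hcV : ∀ x, Continuous fun t => RV t 0 x := h3.continuous_left 0
  have h10 : R 0 0 = 1 := h1.1 0 trivial
  have h30 : RV 0 0 = 1 := h3.1 0 trivial
  have hd0 : ∀ v, HasDerivAt (fun τ => R τ 0 (ι v)) (-Complex.I • B v) 0 := fun v => by
    have := (h4 0 0 v).1
    rwa [h30, one_apply_eq_self] at this
  constructor
  · refine ⟨fun t => R t 0, h10, fun s t => ?_, hc, fun x y => ⟨?_, fun hxy => ?_⟩⟩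
    · have := hshift t s 0
      rw [zero_add] at this
      change R (s + t) 0 = R s 0 * R t 0
      rw [← this]
      exact (h1.2.1 _ trivial _ trivial _ trivial).symm
    · rintro ⟨v, rfl, rfl⟩
      exact hd0 v
    -- Time averages of any orbit lie in the domain, by closedness and density. Dividing by r and
    -- letting r tend to 0, closedness once more puts x in the domain as soon as its orbit is
    -- differentiable at 0.
    · have hint : ∀ r : ℝ, ∃ v, ι v = ∫ τ in (0 : ℝ)..r, R τ 0 x ∧
          B v = Complex.I • (R r 0 x - x) := by
        intro r
        obtain ⟨C, hC⟩ := h1.exists_bound (subset_univ (Icc (min 0 r) (max 0 r)))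
        have h0m : (0 : ℝ) ∈ Icc (min 0 r) (max 0 r) := ⟨min_le_left _ _, le_max_left _ _⟩
        obtain ⟨w, hw, hwx⟩ := mem_closure_iff_seq_limit.1 (hι x)
        choose u hu using hw
        rw [← funext hu] at hwx
        refine hclosed (fun n => ∫ τ in (0 : ℝ)..r, RV τ 0 (u n)) _ _ ?_ ?_
        · have e1 : ∀ n, ι (∫ τ in (0 : ℝ)..r, RV τ 0 (u n)) = ∫ τ in (0 : ℝ)..r, R τ 0 (ι (u n)) :=
            fun n => by
              rw [← ι.intervalIntegral_comp_comm ((hcV _).intervalIntegrable _ _)]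
              simp only [h2]
          simp only [e1]
          rw [tendsto_iff_norm_sub_tendsto_zero]
          refine squeeze_zero (fun n => norm_nonneg _)
            (g := fun n => C * ‖ι (u n) - x‖ * |r - 0|) (fun n => ?_) ?_
          · rw [← intervalIntegral.integral_sub ((hc _).intervalIntegrable _ _)
              ((hc _).intervalIntegrable _ _)]
            refine intervalIntegral.norm_integral_le_of_norm_le_const fun τ hτ => ?_
            rw [← map_sub]
            exact (R τ 0).le_of_opNorm_le (hC τ (uIoc_subset_uIcc hτ) 0 h0m) _
          · have := ((tendsto_iff_norm_sub_tendsto_zero.1 hwx).const_mul C).mul_const |r - 0|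
            simpa using this
        · have e2 : ∀ n, B (∫ τ in (0 : ℝ)..r, RV τ 0 (u n)) =
              Complex.I • (R r 0 (ι (u n)) - ι (u n)) := fun n => by
            have hcont : Continuous fun τ => -Complex.I • B (RV τ 0 (u n)) :=
              (B.continuous.comp (hcV (u n))).const_smul (-Complex.I)
            have e3 := intervalIntegral.integral_eq_sub_of_hasDerivAt (a := 0) (b := r)
              (fun τ _ => (h4 τ 0 (u n)).1) (hcont.intervalIntegrable _ _)
            rw [intervalIntegral.integral_smul,
              B.intervalIntegral_comp_comm ((hcV _).intervalIntegrable _ _), h10,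
              one_apply_eq_self] at e3
            rw [← e3, smul_smul]
            simp
          simp only [e2]
          exact ((((R r 0).continuous.tendsto x).comp hwx).sub hwx).const_smul Complex.I
      choose v hv1 hv2 using hint
      have hseq : Tendsto (fun n : ℕ => (1 / ((n : ℝ) + 1))) atTop (𝓝[≠] 0) :=
        tendsto_nhdsWithin_iff.2 ⟨tendsto_one_div_add_atTop_nhds_zero_nat,
          Eventually.of_forall fun n => by
            have : (0 : ℝ) < 1 / ((n : ℝ) + 1) := by positivity
            exact this.ne'⟩
      have hI : HasDerivAt (fun r => ∫ τ in (0 : ℝ)..r, R τ 0 x) x 0 := by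
        have := ((hc x).integral_hasStrictDerivAt 0 0).hasDerivAt
        rwa [h10, one_apply_eq_self] at this
      have t1 := (hasDerivAt_iff_tendsto_slope.1 hI).comp hseq
      have t2 := ((hasDerivAt_iff_tendsto_slope.1 hxy).comp hseq).const_smul Complex.I
      refine hclosed
        (fun n : ℕ => ((1 / ((n : ℝ) + 1))⁻¹ : ℝ) • v (1 / ((n : ℝ) + 1))) x y ?_ ?_
      · refine t1.congr fun n => ?_
        rw [ι.map_smul_of_tower, hv1]
        simp [slope]
      · rw [smul_smul, mul_neg, Complex.I_mul_I, neg_neg, one_smul] at t2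
        refine t2.congr fun n => ?_
        rw [B.map_smul_of_tower, hv2]
        simp only [slope, Function.comp_apply, h10, one_apply_eq_self, vsub_eq_sub, sub_zero]
        exact smul_comm _ _ _
  · refine ⟨fun t => RV t 0, h30, fun s t => ?_, hcV, fun v w => ⟨fun hvw => ?_, fun hvw => ?_⟩⟩
    · have := hshiftV t s 0
      rw [zero_add] at this
      change RV (s + t) 0 = RV s 0 * RV t 0
      rw [← this]
      exact (h3.2.1 _ trivial _ trivial _ trivial).symm
    · have hvw : B v = ι w := hvw
      -- By time invariance the orbit can be differentiated in the second variable, which puts B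
      -- directly on v. The velocity then lies in the smaller space and can be integrated there.
      have hU : ∀ τ, HasDerivAt (fun τ => R τ 0 (ι v)) (-Complex.I • ι (RV τ 0 w)) τ := by
        intro τ
        have e1 : ∀ r, R r 0 = R 0 (-r) := fun r => by
          have := hshift r 0 (-r)
          rwa [zero_add, neg_add_cancel] at this
        have := ((h4 0 (-τ) v).2).scomp τ (hasDerivAt_neg τ)
        rw [hvw, ← e1, ← h2] at this
        refine (this.congr_of_eventuallyEq (Eventually.of_forall fun r => ?_)).congr_deriv ?_
        · rw [e1]; rfl
        · simp
      have hcont : Continuous fun τ => -Complex.I • RV τ 0 w := (hcV w).const_smul (-Complex.I)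
      have hform : ∀ τ, RV τ 0 v = v + ∫ r in (0 : ℝ)..τ, -Complex.I • RV r 0 w := by
        intro τ
        refine hinj ?_
        have e3 := intervalIntegral.integral_eq_sub_of_hasDerivAt (a := 0) (b := τ)
          (fun τ _ => hU τ) ((ι.continuous.comp (hcV w)).const_smul (-Complex.I)
            |>.intervalIntegrable _ _)
        rw [map_add, ← ι.intervalIntegral_comp_comm (hcont.intervalIntegrable _ _), h2]
        simp only [map_smul]
        rw [e3, h10, one_apply_eq_self]
        abel
      have := ((hcont.integral_hasStrictDerivAt 0 0).hasDerivAt).const_add v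
      rw [h30, one_apply_eq_self] at this
      exact this.congr_of_eventuallyEq (Eventually.of_forall hform)
    · have e1 := (ι.restrictScalars ℝ).hasFDerivAt.comp_hasDerivAt 0 hvw
      have e2 : HasDerivAt (fun τ => R τ 0 (ι v)) (-Complex.I • ι w) 0 := by
        refine (e1.congr_of_eventuallyEq (Eventually.of_forall fun τ => ?_)).congr_deriv ?_
        · exact (h2 τ 0 v).symm
        · simp
      have e3 := (hd0 v).unique e2
      exact smul_right_injective X (neg_ne_zero.2 Complex.I_ne_zero) e3

end Group

end KleinGordon

/-! ### From compact intervals to J -/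

namespace KleinGordon

open Set Filter Topology MeasureTheory
open scoped Interval

section Local

variable {X : Type*} [NormedAddCommGroup X] [NormedSpace ℂ X] {J : Set ℝ}

theorem IsStronglyContinuousEvolution.congr {R R' : ℝ → ℝ → X →L[ℂ] X}
    (h : IsStronglyContinuousEvolution J R) (hR : ∀ t ∈ J, ∀ s ∈ J, R' t s = R t s) :
    IsStronglyContinuousEvolution J R' :=
  ⟨fun t ht => by rw [hR t ht t ht, h.1 t ht],
    fun t ht s hs r hr => by rw [hR t ht s hs, hR s hs r hr, hR t ht r hr, h.2.1 t ht s hs r hr],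
    fun x => (h.2.2 x).congr fun p hp => by rw [hR _ hp.1 _ hp.2]⟩

theorem isStronglyContinuousEvolution_of_Icc (hJ : J.OrdConnected) {R : ℝ → ℝ → X →L[ℂ] X}
    (h : ∀ a ∈ J, ∀ b ∈ J, a ≤ b → IsStronglyContinuousEvolution (Icc a b) R) :
    IsStronglyContinuousEvolution J R := by
  refine ⟨fun t ht => (h t ht t ht le_rfl).1 t ⟨le_rfl, le_rfl⟩, fun t ht s hs r hr => ?_,
    fun x => ?_⟩
  · have hmin : min t (min s r) ∈ J := by
      rcases min_choice t (min s r) with h | h <;> rw [h]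
      · exact ht
      · rcases min_choice s r with h | h <;> rwa [h]
    have hmax : max t (max s r) ∈ J := by
      rcases max_choice t (max s r) with h | h <;> rw [h]
      · exact ht
      · rcases max_choice s r with h | h <;> rwa [h]
    refine (h _ hmin _ hmax ((min_le_left _ _).trans (le_max_left _ _))).2.1 t ⟨?_, ?_⟩ s ⟨?_, ?_⟩
      r ⟨?_, ?_⟩ <;> simp
  · rintro ⟨t, s⟩ ⟨ht, hs⟩
    obtain ⟨a, ha, b, hb, hab, hta, hsa, -, hnt, hns⟩ := exists_Icc_mem_nhdsWithin hJ ht hs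
    refine ((h a ha b hb hab).2.2 x (t, s) ⟨hta, hsa⟩).mono_of_mem_nhdsWithin ?_
    rw [nhdsWithin_prod_eq]
    exact prod_mem_prod hnt hns

end Local

variable {H : Type*} [NormedAddCommGroup H] [InnerProductSpace ℂ H] [CompleteSpace H]
variable {J J' : Set ℝ} {ℓ σ P : H →L[ℂ] H} {A : ℝ → H →L[ℂ] H} {γ : ℝ → ℝ}
  {R R' : ℝ → ℝ → H →L[ℂ] H}

theorem IsChargedEvolution.mono (h : IsChargedEvolution J ℓ σ P A R) (hJ : J' ⊆ J) :
    IsChargedEvolution J' ℓ σ P A R where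
  evolution := h.evolution.mono hJ
  evolution_adjoint := h.evolution_adjoint.mono hJ
  inter t ht s hs := h.inter t (hJ ht) s (hJ hs)
  hasDerivWithinAt t ht s hs v := (h.hasDerivWithinAt t (hJ ht) s (hJ hs) v).mono hJ

theorem IsChargedEvolution.congr (h : IsChargedEvolution J ℓ σ P A R)
    (hR : ∀ t ∈ J, ∀ s ∈ J, R' t s = R t s) : IsChargedEvolution J ℓ σ P A R' where
  evolution := h.evolution.congr hR
  evolution_adjoint := h.evolution_adjoint.congr fun t ht s hs => by rw [hR s hs t ht]
  inter t ht s hs v := by rw [hR t ht s hs, hR s hs t ht, h.inter t ht s hs]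
  hasDerivWithinAt t ht s hs v := by
    rw [hR s hs t ht]
    exact (h.hasDerivWithinAt t ht s hs v).congr_of_mem (fun τ hτ => by rw [hR τ hτ s hs]) ht

theorem isChargedEvolution_of_Icc (hJ : J.OrdConnected)
    (h : ∀ a ∈ J, ∀ b ∈ J, a ≤ b → IsChargedEvolution (Icc a b) ℓ σ P A R) :
    IsChargedEvolution J ℓ σ P A R where
  evolution := isStronglyContinuousEvolution_of_Icc hJ fun a ha b hb hab =>
    (h a ha b hb hab).evolution
  evolution_adjoint := isStronglyContinuousEvolution_of_Icc hJ fun a ha b hb hab =>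
    (h a ha b hb hab).evolution_adjoint
  inter t ht s hs := by
    obtain ⟨a, ha, b, hb, hab, hta, hsa, -, -, -⟩ := exists_Icc_mem_nhdsWithin hJ ht hs
    exact (h a ha b hb hab).inter t hta s hsa
  hasDerivWithinAt t ht s hs v := by
    obtain ⟨a, ha, b, hb, hab, hta, hsa, -, hnt, -⟩ := exists_Icc_mem_nhdsWithin hJ ht hs
    exact ((h a ha b hb hab).hasDerivWithinAt t hta s hsa v).mono_of_mem_nhdsWithin hnt

/-- The derivative in the initial time follows from the one in the final time: on ℓv, the increment
of R(t,·) from s to τ is -R(t,τ)(R(τ,s) - 1), and R(t,τ) converges strongly to R(t,s). -/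
theorem IsChargedEvolution.isEvolutionGeneratedBy (hJ : J.OrdConnected)
    (h : IsChargedEvolution J ℓ σ P A R) :
    IsEvolutionGeneratedBy J ℓ (fun t => σ * A t + P * ℓ) R := by
  refine ⟨h.evolution, fun t s => chargeAdjoint σ (R s t),
    fun t ht s hs v => (h.inter t ht s hs v).symm, h.evolution_adjoint, fun t ht s hs v => ⟨?_, ?_⟩⟩
  · exact h.hasDerivWithinAt t ht s hs v
  · have h1 := h.hasDerivWithinAt s hs s hs v
    have e1 : chargeAdjoint σ (R s s) = 1 := h.evolution_adjoint.1 s hs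
    simp only [e1, one_apply_eq_self] at h1
    rw [hasDerivWithinAt_iff_tendsto_slope] at h1 ⊢
    obtain ⟨C, hC⟩ := h.evolution.eventually_bound hJ ht hs
    have hle : 𝓝[J \ {s}] s ≤ 𝓝[J] s := nhdsWithin_mono _ sdiff_subset
    have h2 := (tendsto_clm_apply_of_bounded (T₀ := R t s) (hle (hC.mono fun _ h => h.1))
      ((h.evolution.tendsto_right ht hs _).mono_left hle) h1).neg
    have e2 : -(R t s) (-Complex.I • (σ (A s v) + P (ℓ v))) =
        Complex.I • R t s ((σ * A s + P * ℓ) v) := by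
      rw [map_smul, neg_smul, neg_neg]
      rfl
    rw [e2] at h2
    refine h2.congr' ?_
    filter_upwards [self_mem_nhdsWithin] with τ hτ
    have e3 : ∀ x, R t τ (R τ s x) = R t s x := fun x => by
      rw [← h.evolution.2.1 t ht τ hτ.1 s hs]; rfl
    have e4 : ∀ (c : ℝ) x, R t τ (c • x) = c • R t τ x := fun c x => (R t τ).map_smul_of_tower c x
    simp only [slope, vsub_eq_sub, e4, map_sub, e3, h.evolution.1 s hs, one_apply_eq_self]
    rw [← smul_neg, neg_sub]

/-- Existence of the evolution of a charged system. -/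
theorem ChargedSystem.exists_evolution (S : ChargedSystem J ℓ σ P A γ) (hJ : J.OrdConnected) :
    ∃ R, IsChargedEvolution J ℓ σ P A R := by
  classical
  choose! Rc hRc using fun (a : ℝ) (ha : a ∈ J) (b : ℝ) (hb : b ∈ J) (hab : a ≤ b) =>
    (S.mono (hJ.out ha hb)).exists_evolution_Icc hab
  -- Each pair of times uses the propagator of the smallest interval containing it; by uniqueness it
  -- agrees with the propagator of any larger one.
  refine ⟨fun t s => Rc (min t s) (max t s) t s, isChargedEvolution_of_Icc hJ fun a ha b hb hab => ?_⟩
  refine (hRc a ha b hb hab).congr fun t ht s hs => ?_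
  have hmin : min t s ∈ Icc a b := by rcases min_choice t s with h | h <;> rwa [h]
  have hmax : max t s ∈ Icc a b := by rcases max_choice t s with h | h <;> rwa [h]
  have hsub := hJ.out ha hb
  have hle : min t s ≤ max t s := min_le_max
  have h1 := hRc _ (hsub hmin) _ (hsub hmax) hle
  have h2 := (hRc a ha b hb hab).mono (Icc_subset_Icc hmin.1 hmax.2)
  exact (h2.isEvolutionGeneratedBy ordConnected_Icc).unique ordConnected_Icc S.denseRange_ℓ
    (h1.isEvolutionGeneratedBy ordConnected_Icc) ⟨min_le_left _ _, le_max_left _ _⟩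
    ⟨min_le_right _ _, le_max_right _ _⟩

end KleinGordon

/-! ### Interpolation between H and the range of ℓ -/

namespace KleinGordon

open Set Filter Topology MeasureTheory
open scoped Interval

variable {H : Type*} [NormedAddCommGroup H] [InnerProductSpace ℂ H] [CompleteSpace H]

/-- Identifies the integrand representing X^p as t^(p-1) X (X + t)⁻¹, written without the inverse.
-/
theorem cfcₙ_rpowIntegrand_mul {X : H →L[ℂ] H} (hX : 0 ≤ X) {p : ℝ} (hp : p ∈ Ioo (0 : ℝ) 1) {t : ℝ}
    (ht : 0 < t) : cfcₙ (Real.rpowIntegrand₀₁ p t) X * (X + (t : ℂ) • (1 : H →L[ℂ] H)) =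
      t ^ (p - 1) • X := by
  have hq : ∀ x ∈ quasispectrum ℝ X, 0 ≤ x := fun x hx => quasispectrum_nonneg_of_nonneg X hX x hx
  have hc : ContinuousOn (Real.rpowIntegrand₀₁ p t) (quasispectrum ℝ X) :=
    (Real.continuousOn_rpowIntegrand₀₁_Ici hp ht).mono hq
  have h1 : cfcₙ (Real.rpowIntegrand₀₁ p t) X * X =
      cfcₙ (fun x => Real.rpowIntegrand₀₁ p t x * x) X := by
    rw [cfcₙ_mul (Real.rpowIntegrand₀₁ p t) (fun x => x) X hc (by simp), cfcₙ_id' ℝ X]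
  have h2 : t • cfcₙ (Real.rpowIntegrand₀₁ p t) X = cfcₙ (fun x => t * Real.rpowIntegrand₀₁ p t x) X :=
    (cfcₙ_const_mul t (Real.rpowIntegrand₀₁ p t) X hc (by simp)).symm
  rw [mul_add, mul_smul_comm, mul_one, h1, Complex.coe_smul, h2,
    ← cfcₙ_add (a := X) (fun x => Real.rpowIntegrand₀₁ p t x * x)
      (fun x => t * Real.rpowIntegrand₀₁ p t x) (hc.mul continuousOn_id) (by simp)
      (continuousOn_const.mul hc) (by simp)]
  have h3 : t ^ (p - 1) • X = cfcₙ (fun x : ℝ => t ^ (p - 1) • x) X := by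
    rw [cfcₙ_smul (t ^ (p - 1)) (fun x : ℝ => x) X, cfcₙ_id' ℝ X]
  rw [h3]
  refine cfcₙ_congr fun x hx => ?_
  have := hq x hx
  rw [Real.rpowIntegrand₀₁_eq_pow_div hp ht.le this]
  have h3 : t + x ≠ 0 := by positivity
  simp only [smul_eq_mul]
  field_simp
  ring

/-- The quadratic forms of fractional powers interpolate. -/
theorem quadForm_nnrpow_le {X T : H →L[ℂ] H} (hX : 0 ≤ X) {κ : ℝ}
    (h0 : ∀ f, ‖T f‖ ^ 2 ≤ κ * ‖f‖ ^ 2) (h1 : ∀ f, quadForm X (T f) ≤ κ * quadForm X f) {p : ℝ≥0}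
    (hp : p ∈ Ioo (0 : ℝ≥0) 1) (f : H) : quadForm (X ^ p) (T f) ≤ κ * quadForm (X ^ p) f := by
  obtain ⟨μ, hμ⟩ := CFC.exists_measure_nnrpow_eq_integral_cfcₙ_rpowIntegrand₀₁ (H →L[ℂ] H) hp
  obtain ⟨hint, heq⟩ := hμ X hX
  have hX' := (ContinuousLinearMap.nonneg_iff_isPositive X).1 hX
  have hXs : ∀ x y, ⟪X x, y⟫_ℂ = ⟪x, X y⟫_ℂ := hX'.inner_left_eq_inner_right
  have hform : ∀ u : H, ∃ Λ : (H →L[ℂ] H) →L[ℝ] ℝ, ∀ S, Λ S = quadForm S u := fun u =>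
    ⟨Complex.reCLM ∘L (innerSL ℂ u).restrictScalars ℝ ∘L
      (ContinuousLinearMap.apply ℂ H u).restrictScalars ℝ, fun S => rfl⟩
  have hquad : ∀ u : H, IntegrableOn (fun t => quadForm (cfcₙ (Real.rpowIntegrand₀₁ p t) X) u)
      (Ioi 0) μ ∧ quadForm (X ^ p) u =
        ∫ t in Ioi 0, quadForm (cfcₙ (Real.rpowIntegrand₀₁ p t) X) u ∂μ := by
    intro u
    obtain ⟨Λ, hΛ⟩ := hform u
    simp only [← hΛ]
    exact ⟨Λ.integrable_comp hint, by rw [heq, Λ.integral_comp_comm hint]⟩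
  rw [(hquad (T f)).2, (hquad f).2, ← integral_const_mul]
  refine setIntegral_mono_on (hquad _).1 ((hquad _).1.const_mul κ) measurableSet_Ioi fun t ht => ?_
  have ht : 0 < t := ht
  have hp' : (p : ℝ) ∈ Ioo (0 : ℝ) 1 := ⟨by exact_mod_cast hp.1, by exact_mod_cast hp.2⟩
  have hG := cfcₙ_rpowIntegrand_mul hX hp' ht
  have hunit := ChargedSystem.isUnit_add_smul hX ht
  set c := t ^ ((p : ℝ) - 1) with hc
  have hc0 : 0 ≤ c := Real.rpow_nonneg ht.le _
  have hval : ∀ y : H, quadForm (cfcₙ (Real.rpowIntegrand₀₁ p t) X) (X y + (t : ℂ) • y) =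
      c * (‖X y‖ ^ 2 + t * quadForm X y) := by
    intro y
    have e1 : cfcₙ (Real.rpowIntegrand₀₁ p t) X (X y + (t : ℂ) • y) = (c : ℂ) • X y := by
      have := congrArg (fun S : H →L[ℂ] H => S y) hG
      rw [← Complex.coe_smul] at this
      exact this
    rw [quadForm, e1, inner_smul_right, Complex.re_ofReal_mul, inner_add_left, inner_smul_left,
      Complex.conj_ofReal, Complex.add_re, Complex.re_ofReal_mul, ← quadForm]
    congr 2
    exact inner_self_eq_norm_sq (𝕜 := ℂ) (X y)
  -- Up to the factor c, the integrand at f is the minimum of ‖u‖² + t X(y) over all splittings f =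
  -- u + ty, attained at u = Xy. The image under T of the optimal splitting of f is a competitor for
  -- T f, and both hypotheses bound its cost by κ times the original one.
  obtain ⟨y, hy⟩ : ∃ y, X y + (t : ℂ) • y = f := ⟨_, apply_inverse_apply hunit f⟩
  obtain ⟨z, hz⟩ : ∃ z, X z + (t : ℂ) • z = T f := ⟨_, apply_inverse_apply hunit (T f)⟩
  rw [← hz, hval z]
  nth_rewrite 1 [← hy]
  rw [hval y]
  -- `T f = T (X y) + t • T y` is another decomposition of `T f`
  set d : H := T y - z with hd
  have e2 : T (X y) = X z - (t : ℂ) • d := by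
    have : X z + (t : ℂ) • z = T (X y) + (t : ℂ) • T y := by rw [hz, ← hy, map_add, map_smul]
    rw [hd, smul_sub, ← sub_eq_iff_eq_add.2 this]
    abel
  have e3 : T y = z + d := by rw [hd]; abel
  have h2 := h0 (X y)
  have h3 := h1 y
  have h4 : 0 ≤ quadForm X d := hX'.re_inner_nonneg_right d
  have h5 : ‖X z - (t : ℂ) • d‖ ^ 2 = ‖X z‖ ^ 2 - 2 * t * (⟪X z, d⟫_ℂ).re + t ^ 2 * ‖d‖ ^ 2 := by
    rw [@norm_sub_sq ℂ, inner_smul_right, norm_smul, Complex.norm_real, Real.norm_of_nonneg ht.le]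
    simp only [RCLike.re_to_complex, Complex.re_ofReal_mul]
    ring
  have h6 : quadForm X (z + d) = quadForm X z + 2 * (⟪X z, d⟫_ℂ).re + quadForm X d := by
    have e1 : ⟪z, X d⟫_ℂ = ⟪X z, d⟫_ℂ := (hXs z d).symm
    have e2 : (⟪d, X z⟫_ℂ).re = (⟪X z, d⟫_ℂ).re := inner_re_symm (𝕜 := ℂ) _ _
    simp only [quadForm, map_add, inner_add_left, inner_add_right, Complex.add_re, e1, e2]
    ring
  rw [e2, h5] at h2
  rw [e3, h6] at h3
  have h7 : ‖X z‖ ^ 2 + t * quadForm X z ≤ κ * (‖X y‖ ^ 2 + t * quadForm X y) := by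
    nlinarith [mul_nonneg ht.le h4, mul_le_mul_of_nonneg_left h3 ht.le,
      mul_nonneg (sq_nonneg t) (sq_nonneg ‖d‖)]
  nlinarith [mul_le_mul_of_nonneg_left h7 hc0]

theorem nnrpow_symm {ℓ : H →L[ℂ] H} (p : ℝ≥0) (x y : H) :
    ⟪(ℓ ^ p) x, y⟫_ℂ = ⟪x, (ℓ ^ p) y⟫_ℂ :=
  ((ContinuousLinearMap.nonneg_iff_isPositive _).1
    (CFC.nnrpow_nonneg (a := ℓ) (x := p))).inner_left_eq_inner_right x y

theorem norm_nnrpow_sq {ℓ : H →L[ℂ] H} (hℓ : 0 ≤ ℓ) {p : ℝ≥0} (hp : 0 < p) (f : H) :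
    ‖(ℓ ^ p) f‖ ^ 2 = quadForm ((ℓ * ℓ) ^ p) f := by
  rw [← CFC.nnrpow_two ℓ hℓ, CFC.nnrpow_nnrpow, two_mul, CFC.nnrpow_add hp hp, quadForm,
    mul_apply_eq_comp, ← nnrpow_symm]
  exact (inner_self_eq_norm_sq (𝕜 := ℂ) _).symm

/-- An operator which is bounded on `H` and on the range of `ℓ` is bounded on the range of `ℓ ^ p`
for `0 < p < 1`. -/
theorem exists_interpolation {ℓ R R' : H →L[ℂ] H} (hℓ : 0 ≤ ℓ) (h : ∀ v, R (ℓ v) = ℓ (R' v))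
    {p : ℝ≥0} (hp : p ∈ Ioo (0 : ℝ≥0) 1) (hd : DenseRange (ℓ ^ p : H →L[ℂ] H)) :
    ∃ T : H →L[ℂ] H, (∀ v, R ((ℓ ^ p) v) = (ℓ ^ p) (T v)) ∧ ‖T‖ ≤ ‖R‖ + ‖R'‖ := by
  set C := ‖R‖ + ‖R'‖ with hC
  have hC0 : 0 ≤ C := by positivity
  have hℓs : ∀ x y, ⟪ℓ x, y⟫_ℂ = ⟪x, ℓ y⟫_ℂ :=
    ((ContinuousLinearMap.nonneg_iff_isPositive ℓ).1 hℓ).inner_left_eq_inner_right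
  have hadj : ∀ f, ℓ (ContinuousLinearMap.adjoint R f) = ContinuousLinearMap.adjoint R' (ℓ f) := by
    intro f
    refine ext_inner_left ℂ fun g => ?_
    rw [← hℓs, ContinuousLinearMap.adjoint_inner_right, h, hℓs,
      ContinuousLinearMap.adjoint_inner_right]
  have hquadℓ : ∀ f, quadForm (ℓ * ℓ) f = ‖ℓ f‖ ^ 2 := fun f => by
    rw [quadForm, mul_apply_eq_comp, ← hℓs]
    exact inner_self_eq_norm_sq (𝕜 := ℂ) _
  have hX : 0 ≤ ℓ * ℓ := by
    have := CFC.nnrpow_nonneg (a := ℓ) (x := 2)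
    rwa [CFC.nnrpow_two ℓ hℓ] at this
  have hbound : ∀ f, ‖(ℓ ^ p) (ContinuousLinearMap.adjoint R f)‖ ≤ C * ‖(ℓ ^ p) f‖ := by
    intro f
    refine le_of_sq_le_sq ?_ (by positivity)
    rw [mul_pow, norm_nnrpow_sq hℓ hp.1, norm_nnrpow_sq hℓ hp.1]
    refine quadForm_nnrpow_le hX (fun g => ?_) (fun g => ?_) hp f
    · rw [← mul_pow]
      refine pow_le_pow_left₀ (norm_nonneg _) (ContinuousLinearMap.le_of_opNorm_le _ ?_ g) 2
      rw [LinearIsometryEquiv.norm_map]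
      linarith [norm_nonneg R']
    · rw [hquadℓ, hquadℓ, hadj, ← mul_pow]
      refine pow_le_pow_left₀ (norm_nonneg _) (ContinuousLinearMap.le_of_opNorm_le _ ?_ _) 2
      rw [LinearIsometryEquiv.norm_map]
      linarith [norm_nonneg R]
  -- The bound says that ℓ^p f ↦ ℓ^p R* f is well defined and bounded on a dense range. The adjoint
  -- of its extension is the required operator.
  set S : H →L[ℂ] H := ((ℓ ^ p) * ContinuousLinearMap.adjoint R : H →L[ℂ] H).toLinearMap.extendOfNorm
    (ℓ ^ p : H →L[ℂ] H).toLinearMap with hS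
  have hSe : ∀ f, S ((ℓ ^ p) f) = (ℓ ^ p) (ContinuousLinearMap.adjoint R f) := fun f =>
    LinearMap.extendOfNorm_eq hd ⟨C, hbound⟩ f
  refine ⟨ContinuousLinearMap.adjoint S, fun v => ?_, ?_⟩
  · refine ext_inner_left ℂ fun g => ?_
    rw [← ContinuousLinearMap.adjoint_inner_left, ← nnrpow_symm, ← hSe, ← nnrpow_symm,
      ContinuousLinearMap.adjoint_inner_right]
  · rw [LinearIsometryEquiv.norm_map]
    exact LinearMap.opNorm_extendOfNorm_le hd hC0 hbound

end KleinGordon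

/-! ### Fractional powers and the evolution on intermediate spaces -/

namespace KleinGordon

open Set Filter Topology MeasureTheory
open scoped Interval

variable {H : Type*} [NormedAddCommGroup H] [InnerProductSpace ℂ H] [CompleteSpace H]

theorem denseRange_of_symm {T : H →L[ℂ] H} (hs : ∀ x y, ⟪T x, y⟫_ℂ = ⟪x, T y⟫_ℂ)
    (hi : Function.Injective T) : DenseRange T := by
  have h : (T.range)ᗮ = ⊥ := by
    rw [Submodule.eq_bot_iff]
    intro x hx
    refine hi ?_
    rw [map_zero, ← inner_self_eq_zero (𝕜 := ℂ), ← hs]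
    exact (Submodule.mem_orthogonal _ _).1 hx (T (T x)) ⟨T x, rfl⟩
  exact Submodule.dense_iff_topologicalClosure_eq_top.2
    ((Submodule.topologicalClosure_eq_top_iff (K := T.range)).2 h)

section Power

variable {ℓ : H →L[ℂ] H}

theorem rpow_symm (p : ℝ) (x y : H) : ⟪(ℓ ^ p) x, y⟫_ℂ = ⟪x, (ℓ ^ p) y⟫_ℂ :=
  ((ContinuousLinearMap.nonneg_iff_isPositive _).1
    (CFC.rpow_nonneg (a := ℓ) (y := p))).inner_left_eq_inner_right x y

theorem rpow_mul_rpow (hℓ : 0 ≤ ℓ) {p q : ℝ} (hp : 0 ≤ p) (hq : 0 ≤ q) :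
    ℓ ^ p * ℓ ^ q = ℓ ^ (p + q) := by
  rcases hp.eq_or_lt with rfl | hp
  · rw [CFC.rpow_zero ℓ hℓ, one_mul, zero_add]
  rcases hq.eq_or_lt with rfl | hq
  · rw [CFC.rpow_zero ℓ hℓ, mul_one, add_zero]
  lift p to ℝ≥0 using hp.le
  lift q to ℝ≥0 using hq.le
  have hp : 0 < p := hp
  have hq : 0 < q := hq
  rw [← CFC.nnrpow_eq_rpow hp, ← CFC.nnrpow_eq_rpow hq, ← NNReal.coe_add,
    ← CFC.nnrpow_eq_rpow (add_pos hp hq), CFC.nnrpow_add hp hq]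

theorem rpow_rpow_one_sub (hℓ : 0 ≤ ℓ) {p : ℝ} (hp : p ∈ Icc (0 : ℝ) 1) (x : H) :
    (ℓ ^ p) ((ℓ ^ (1 - p)) x) = ℓ x := by
  have h := rpow_mul_rpow hℓ hp.1 (sub_nonneg.2 hp.2)
  rw [add_sub_cancel, CFC.rpow_one ℓ hℓ] at h
  exact congrArg (fun S : H →L[ℂ] H => S x) h

theorem rpow_one_sub_rpow (hℓ : 0 ≤ ℓ) {p : ℝ} (hp : p ∈ Icc (0 : ℝ) 1) (x : H) :
    (ℓ ^ (1 - p)) ((ℓ ^ p) x) = ℓ x := by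
  have := rpow_rpow_one_sub hℓ (p := 1 - p) ⟨by linarith [hp.2], by linarith [hp.1]⟩ x
  rwa [sub_sub_cancel] at this

theorem rpow_injective (hℓ : 0 ≤ ℓ) (hi : Function.Injective ℓ) {p : ℝ} (hp : p ∈ Icc (0 : ℝ) 1) :
    Function.Injective (ℓ ^ p : H →L[ℂ] H) := fun x y hxy => by
  refine hi ?_
  rw [← rpow_one_sub_rpow hℓ hp, ← rpow_one_sub_rpow hℓ hp, hxy]

theorem rpow_comm {σ : H →L[ℂ] H} (h : ∀ x, σ (ℓ x) = ℓ (σ x)) (p : ℝ) (x : H) :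
    σ ((ℓ ^ p) x) = (ℓ ^ p) (σ x) := by
  have h1 : Commute ℓ σ := ContinuousLinearMap.ext fun x => (h x).symm
  exact congrArg (fun S : H →L[ℂ] H => S x) (h1.cfc_nnreal fun x : ℝ≥0 => x ^ p).eq.symm

end Power

variable {J : Set ℝ} {ℓ σ P : H →L[ℂ] H} {A : ℝ → H →L[ℂ] H} {γ : ℝ → ℝ}
  {R : ℝ → ℝ → H →L[ℂ] H}

/-- The evolution interpolates. -/
theorem ChargedSystem.exists_evolution_rpow (S : ChargedSystem J ℓ σ P A γ) (hJ : J.OrdConnected)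
    (h : IsChargedEvolution J ℓ σ P A R) {p : ℝ} (hp : p ∈ Icc (0 : ℝ) 1) :
    ∃ T : ℝ → ℝ → H →L[ℂ] H, IsStronglyContinuousEvolution J T ∧
      ∀ t ∈ J, ∀ s ∈ J, ∀ v, R t s ((ℓ ^ p) v) = (ℓ ^ p) (T t s v) := by
  have hinj := fun {p : ℝ} => rpow_injective (p := p) S.ℓ_nonneg S.ℓ_inj
  have hdense : ∀ {p : ℝ}, p ∈ Icc (0 : ℝ) 1 → DenseRange (ℓ ^ p : H →L[ℂ] H) := fun hp =>
    denseRange_of_symm (rpow_symm _) (hinj hp)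
  rcases hp.1.eq_or_lt with rfl | hp0
  · refine ⟨R, h.evolution, fun t _ s _ v => ?_⟩
    rw [CFC.rpow_zero ℓ S.ℓ_nonneg]
    rfl
  rcases hp.2.eq_or_lt with rfl | hp1
  · refine ⟨_, h.evolution_adjoint, fun t ht s hs v => ?_⟩
    rw [CFC.rpow_one ℓ S.ℓ_nonneg]
    exact h.inter t ht s hs v
  have key : ∀ t ∈ J, ∀ s ∈ J, ∃ T : H →L[ℂ] H, (∀ v, R t s ((ℓ ^ p) v) = (ℓ ^ p) (T v)) ∧
      ‖T‖ ≤ ‖R t s‖ + ‖chargeAdjoint σ (R s t)‖ := by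
    intro t ht s hs
    have hd := hdense hp
    lift p to ℝ≥0 using hp0.le
    have hp0 : 0 < p := hp0
    rw [← CFC.nnrpow_eq_rpow hp0] at hd ⊢
    exact exists_interpolation S.ℓ_nonneg (h.inter t ht s hs) ⟨hp0, by exact_mod_cast hp1⟩ hd
  choose! T hT hTb using key
  have hp' : 1 - p ∈ Icc (0 : ℝ) 1 := ⟨by linarith, by linarith⟩
  -- On the dense range of ℓ^(1-p) the interpolated operator is the evolution on the smaller space
  -- followed by ℓ^(1-p), so its strong continuity is inherited from there.
  have hTq : ∀ t ∈ J, ∀ s ∈ J, ∀ v, T t s ((ℓ ^ (1 - p)) v) =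
      (ℓ ^ (1 - p)) (chargeAdjoint σ (R s t) v) := by
    intro t ht s hs v
    refine hinj hp ?_
    rw [← hT t ht s hs, rpow_rpow_one_sub S.ℓ_nonneg hp, rpow_rpow_one_sub S.ℓ_nonneg hp,
      h.inter t ht s hs]
  refine ⟨T, isStronglyContinuousEvolution_of_diagonal (fun t ht => ?_)
    (fun t ht s hs r hr => ?_) (fun s hs => ?_) fun s hs x => ?_, hT⟩
  · ext v
    refine hinj hp ?_
    rw [← hT t ht t ht, h.evolution.1 t ht]
    rfl
  · ext v
    refine hinj hp ?_
    rw [mul_apply_eq_comp, ← hT t ht s hs, ← hT s hs r hr, ← hT t ht r hr,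
      ← h.evolution.2.1 t ht s hs r hr]
    rfl
  all_goals
    obtain ⟨C, hC⟩ := h.evolution.eventually_bound hJ hs hs
    obtain ⟨D, hD⟩ := h.evolution_adjoint.eventually_bound hJ hs hs
    have hbound : ∀ᶠ t in 𝓝[J] s, ‖T t s‖ ≤ C + D ∧ ‖T s t‖ ≤ C + D := by
      filter_upwards [hC, hD, self_mem_nhdsWithin] with t h1 h2 ht
      exact ⟨(hTb t ht s hs).trans (add_le_add h1.2 h2.2),
        (hTb s hs t ht).trans (add_le_add h1.1 h2.1)⟩
  · exact ⟨_, hbound⟩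
  · refine tendsto_clm_of_dense (T₀ := 1) (hbound.mono fun _ h => h.1) (hdense hp') (fun v => ?_) x
    have h1 := h.evolution_adjoint.tendsto_left hs hs v
    have e1 : chargeAdjoint σ (R s s) = 1 := h.evolution_adjoint.1 s hs
    rw [e1] at h1
    refine (((ℓ ^ (1 - p) : H →L[ℂ] H).continuous.tendsto _).comp h1).congr' ?_
    filter_upwards [self_mem_nhdsWithin] with t ht
    exact (hTq t ht s hs v).symm

/-- The evolutions on dual spaces of the scale preserve the charge. -/
theorem ChargedSystem.inner_evolution_rpow (S : ChargedSystem J ℓ σ P A γ)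
    (h : IsChargedEvolution J ℓ σ P A R) {p : ℝ} (hp : p ∈ Icc (0 : ℝ) 1) {t s : ℝ} (ht : t ∈ J)
    (hs : s ∈ J) {T T' : H →L[ℂ] H} (hT : ∀ v, R t s ((ℓ ^ p) v) = (ℓ ^ p) (T v))
    (hT' : ∀ v, R t s ((ℓ ^ (1 - p)) v) = (ℓ ^ (1 - p)) (T' v)) (u v : H) :
    ⟪T' u, σ (T v)⟫_ℂ = ⟪u, σ v⟫_ℂ := by
  have hinj := fun {p : ℝ} => rpow_injective (p := p) S.ℓ_nonneg S.ℓ_inj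
  have hp' : 1 - p ∈ Icc (0 : ℝ) 1 := ⟨by linarith [hp.2], by linarith [hp.1]⟩
  have hdense : DenseRange (ℓ ^ (1 - p) : H →L[ℂ] H) :=
    denseRange_of_symm (rpow_symm _) (hinj hp')
  -- The end point case of the invariance, between the larger and the smaller space, holds by
  -- definition of the charge adjoint; the general case is reduced to it on the range of ℓ^(1-p).
  have hRV : ∀ u v, ⟪R t s u, σ (chargeAdjoint σ (R s t) v)⟫_ℂ = ⟪u, σ v⟫_ℂ := by
    intro u v
    have : R s t (R t s u) = u := by
      have := congrArg (fun S : H →L[ℂ] H => S u) (h.evolution.2.1 s hs t ht s hs)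
      rwa [h.evolution.1 s hs] at this
    rw [chargeAdjoint, mul_apply_eq_comp, mul_apply_eq_comp, S.σ_sq,
      ContinuousLinearMap.adjoint_inner_right, this]
  have hc1 : Continuous fun v => ⟪T' u, σ (T v)⟫_ℂ :=
    continuous_const.inner (σ.continuous.comp T.continuous)
  have hc2 : Continuous fun v => ⟪u, σ v⟫_ℂ := continuous_const.inner σ.continuous
  refine congrFun (hdense.equalizer hc1 hc2 (funext fun w => ?_)) v
  have h1 : T ((ℓ ^ (1 - p)) w) = (ℓ ^ (1 - p)) (chargeAdjoint σ (R s t) w) := by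
    refine hinj hp ?_
    rw [← hT, rpow_rpow_one_sub S.ℓ_nonneg hp, rpow_rpow_one_sub S.ℓ_nonneg hp, h.inter t ht s hs]
  simp only [Function.comp_apply]
  rw [h1, rpow_comm S.σ_comm, ← rpow_symm, ← hT', hRV, rpow_symm, rpow_comm S.σ_comm]

end KleinGordon

/-! ### Change of coordinates, self-adjointness and generation at a fixed time -/

namespace KleinGordon

open Set Filter Topology MeasureTheory
open scoped Interval

section Transport

variable {X X' : Type*} [NormedAddCommGroup X] [NormedSpace ℂ X] [NormedAddCommGroup X']
  [NormedSpace ℂ X'] {V V' : Type*} [NormedAddCommGroup V] [NormedSpace ℂ V]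
  [NormedAddCommGroup V'] [NormedSpace ℂ V']

theorem IsGroupGenerator.transport (e : X ≃L[ℂ] X') {G : Set (X × X)} {G' : Set (X' × X')}
    (hG : ∀ x y, (e x, e y) ∈ G' ↔ (x, y) ∈ G) (h : IsGroupGenerator G) : IsGroupGenerator G' := by
  obtain ⟨U, h0, h1, h2, h3⟩ := h
  refine ⟨fun t => (e : X →L[ℂ] X') ∘L U t ∘L (e.symm : X' →L[ℂ] X), ?_, fun s t => ?_, fun x => ?_,
    fun x y => ?_⟩
  · ext x
    simp [h0]
  · ext x
    simp [h1]
  · exact e.continuous.comp (h2 _)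
  · obtain ⟨x, rfl⟩ := e.surjective x
    obtain ⟨y, rfl⟩ := e.surjective y
    rw [hG, h3]
    constructor
    · intro h
      have := (e.toContinuousLinearMap.restrictScalars ℝ).hasFDerivAt.comp_hasDerivAt (0 : ℝ) h
      refine (this.congr_of_eventuallyEq (Eventually.of_forall fun t => ?_)).congr_deriv ?_
      · simp
      · simp
    · intro h
      have := (e.symm.toContinuousLinearMap.restrictScalars ℝ).hasFDerivAt.comp_hasDerivAt (0 : ℝ) h
      refine (this.congr_of_eventuallyEq (Eventually.of_forall fun t => ?_)).congr_deriv ?_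
      · simp
      · simp

theorem IsSelfAdjointGraph.transport (e : X ≃L[ℂ] X') {G : Set (X × X)} {G' : Set (X' × X')}
    {g : X →L⋆[ℂ] X →L[ℂ] ℂ} {g' : X' →L⋆[ℂ] X' →L[ℂ] ℂ} (hg : ∀ x y, g' (e x) (e y) = g x y)
    (hG : ∀ x y, (e x, e y) ∈ G' ↔ (x, y) ∈ G) (h : IsSelfAdjointGraph g G) :
    IsSelfAdjointGraph g' G' := by
  refine ⟨?_, fun y z => ?_⟩
  · have h1 : Prod.fst '' G' = e '' (Prod.fst '' G) := by
      ext x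
      constructor
      · rintro ⟨⟨a, b⟩, h, rfl⟩
        obtain ⟨a, rfl⟩ := e.surjective a
        obtain ⟨b, rfl⟩ := e.surjective b
        exact ⟨a, ⟨(a, b), (hG _ _).1 h, rfl⟩, rfl⟩
      · rintro ⟨_, ⟨⟨a, b⟩, h, rfl⟩, rfl⟩
        exact ⟨(e a, e b), (hG _ _).2 h, rfl⟩
    rw [h1]
    exact e.surjective.denseRange.dense_image e.continuous h.1
  · obtain ⟨y, rfl⟩ := e.surjective y
    obtain ⟨z, rfl⟩ := e.surjective z
    rw [hG, h.2]
    constructor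
    · rintro h1 ⟨a, b⟩ hab
      obtain ⟨a, rfl⟩ := e.surjective a
      obtain ⟨b, rfl⟩ := e.surjective b
      simpa only [hg] using h1 (a, b) ((hG _ _).1 hab)
    · rintro h1 ⟨a, b⟩ hab
      simpa only [hg] using h1 (e a, e b) ((hG _ _).2 hab)

theorem IsCompatibleInner.transport (e : X ≃L[ℂ] X') {g : X →L⋆[ℂ] X →L[ℂ] ℂ}
    {g' : X' →L⋆[ℂ] X' →L[ℂ] ℂ} (hg : ∀ x y, g' (e x) (e y) = g x y) (h : IsCompatibleInner g) :
    IsCompatibleInner g' := by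
  obtain ⟨h1, c, hc, h2⟩ := h
  refine ⟨fun v w => ?_, c / (‖(e : X →L[ℂ] X')‖ ^ 2 + 1), by positivity, fun v => ?_⟩
  · obtain ⟨v, rfl⟩ := e.surjective v
    obtain ⟨w, rfl⟩ := e.surjective w
    rw [hg, hg, h1]
  · obtain ⟨v, rfl⟩ := e.surjective v
    rw [hg]
    refine le_trans ?_ (h2 v)
    rw [div_mul_eq_mul_div, div_le_iff₀ (by positivity), mul_assoc]
    refine mul_le_mul_of_nonneg_left ?_ hc.le
    have := pow_le_pow_left₀ (norm_nonneg _) ((e : X →L[ℂ] X').le_opNorm v) 2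
    rw [mul_pow] at this
    have h3 : ‖(e : X →L[ℂ] X') v‖ = ‖e v‖ := rfl
    rw [h3] at this
    nlinarith [sq_nonneg ‖v‖]

/-- A sesquilinear form in other coordinates. -/
noncomputable def transportForm (e : X ≃L[ℂ] X') (g : X →L⋆[ℂ] X →L[ℂ] ℂ) : X' →L⋆[ℂ] X' →L[ℂ] ℂ :=
  g.bilinearComp (e.symm : X' →L[ℂ] X) (e.symm : X' →L[ℂ] X)

theorem transportForm_apply (e : X ≃L[ℂ] X') (g : X →L⋆[ℂ] X →L[ℂ] ℂ) (x y : X) :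
    transportForm e g (e x) (e y) = g x y := by
  simp [transportForm]

variable {ι : V →L[ℂ] X} {ι' : V' →L[ℂ] X'} {e : X ≃L[ℂ] X'} {f : V ≃L[ℂ] V'}

theorem mem_opGraph_transport {B : V →L[ℂ] X} {B' : V' →L[ℂ] X'} (hι : ∀ v, ι' (f v) = e (ι v))
    (hB : ∀ v, B' (f v) = e (B v)) (x y : X) : (e x, e y) ∈ opGraph ι' B' ↔ (x, y) ∈ opGraph ι B := by
  constructor
  · rintro ⟨v, h1, h2⟩
    obtain ⟨v, rfl⟩ := f.surjective v
    exact ⟨v, e.injective ((hι v).symm.trans h1), e.injective ((hB v).symm.trans h2)⟩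
  · rintro ⟨v, h1, h2⟩
    exact ⟨f v, (hι v).trans (congrArg e h1), (hB v).trans (congrArg e h2)⟩

theorem mem_partGraph_transport {B : V →L[ℂ] X} {B' : V' →L[ℂ] X'} (hι : ∀ v, ι' (f v) = e (ι v))
    (hB : ∀ v, B' (f v) = e (B v)) (v w : V) :
    (f v, f w) ∈ partGraph ι' B' ↔ (v, w) ∈ partGraph ι B := by
  change B' (f v) = ι' (f w) ↔ B v = ι w
  rw [hι, hB]
  exact e.injective.eq_iff

theorem innerNorm_transport {g : X →L⋆[ℂ] X →L[ℂ] ℂ} (x : X) :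
    innerNorm (transportForm e g) (e x) = innerNorm g x := by
  rw [innerNorm, innerNorm, transportForm_apply]

theorem AlmostUnitaryHypotheses.transport {J : Set ℝ} {B : ℝ → V →L[ℂ] X} {B' : ℝ → V' →L[ℂ] X'}
    (hι : ∀ v, ι' (f v) = e (ι v)) (hB : ∀ t ∈ J, ∀ v, B' t (f v) = e (B t v))
    (h : AlmostUnitaryHypotheses J ι B) : AlmostUnitaryHypotheses J ι' B' := by
  obtain ⟨hc, gX, gV, C, h1, h2, h3, h4⟩ := h
  refine ⟨?_, fun t => transportForm e (gX t), fun t => transportForm f (gV t), C, fun t ht => ?_,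
    h2, h3, fun s hs t ht => ⟨fun w => ?_, fun v => ?_⟩⟩
  · have h5 : ContinuousOn (fun t => ((e : X →L[ℂ] X') ∘L B t) ∘L (f.symm : V' →L[ℂ] V)) J :=
      (continuousOn_const.clm_comp hc).clm_comp continuousOn_const
    refine h5.congr fun t ht => ContinuousLinearMap.ext fun v => ?_
    obtain ⟨v, rfl⟩ := f.surjective v
    simp [hB t ht]
  · obtain ⟨h5, h6, h7, h8⟩ := h1 t ht
    exact ⟨h5.transport e (transportForm_apply e _), h6.transport f (transportForm_apply f _),
      h7.transport e (transportForm_apply e _) (mem_opGraph_transport hι (hB t ht)),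
      h8.transport f (transportForm_apply f _) (mem_partGraph_transport hι (hB t ht))⟩
  · obtain ⟨w, rfl⟩ := e.surjective w
    rw [innerNorm_transport, innerNorm_transport]
    exact (h4 s hs t ht).1 w
  · obtain ⟨v, rfl⟩ := f.surjective v
    rw [innerNorm_transport, innerNorm_transport]
    exact (h4 s hs t ht).2 v

end Transport

variable {H : Type*} [NormedAddCommGroup H] [InnerProductSpace ℂ H] [CompleteSpace H]
variable {J : Set ℝ} {ℓ σ P : H →L[ℂ] H} {A : ℝ → H →L[ℂ] H} {γ : ℝ → ℝ}

/-- The sesquilinear form `(u, v) ↦ (u|T v)`. -/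
noncomputable def innerForm (T : H →L[ℂ] H) : H →L⋆[ℂ] H →L[ℂ] ℂ :=
  (innerSL ℂ).bilinearComp (ContinuousLinearMap.id ℂ H) T

theorem innerForm_apply (T : H →L[ℂ] H) (u v : H) : innerForm T u v = ⟪u, T v⟫_ℂ := rfl

theorem innerNorm_innerForm (T : H →L[ℂ] H) (u : H) : innerNorm (innerForm T) u = √(quadForm T u) :=
  rfl

theorem isCompatibleInner_innerForm {T : H →L[ℂ] H} (hs : ∀ x y, ⟪T x, y⟫_ℂ = ⟪x, T y⟫_ℂ)
    (hc : ∃ m : ℝ, 0 < m ∧ ∀ x, m * ‖x‖ ^ 2 ≤ quadForm T x) : IsCompatibleInner (innerForm T) :=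
  ⟨fun v w => by rw [innerForm_apply, innerForm_apply, inner_conj_symm, hs], hc⟩

theorem innerNorm_innerForm_le {T T' : H →L[ℂ] H} {c : ℝ}
    (h : ∀ x, quadForm T x ≤ Real.exp (2 * c) * quadForm T' x) (x : H) :
    innerNorm (innerForm T) x ≤ innerNorm (innerForm T') x * Real.exp c := by
  rw [innerNorm_innerForm, innerNorm_innerForm]
  refine (Real.sqrt_le_sqrt (h x)).trans (le_of_eq ?_)
  rw [two_mul, Real.exp_add, Real.sqrt_mul (by positivity), Real.sqrt_mul_self (Real.exp_nonneg _),
    mul_comm]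

namespace ChargedSystem

variable (S : ChargedSystem J ℓ σ P A γ)
include S

/-- Paired in the dual energy, σA(t) becomes the charge pairing with v, and ℓ becomes ℓA(t)⁻¹σ on
the other side. The adjoint relation then reads y = ℓA(t)⁻¹σz, which is membership in the graph. -/
theorem isSelfAdjointGraph_opGraph {t : ℝ} (ht : t ∈ J) :
    IsSelfAdjointGraph (innerForm (dualEnergy σ A t)) (opGraph ℓ (σ * A t)) := by
  have hu := S.isUnit_A ht
  have hG : ∀ x v, ⟪x, dualEnergy σ A t (σ (A t v))⟫_ℂ = ⟪x, σ v⟫_ℂ := fun x v => by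
    rw [dualEnergy, mul_apply_eq_comp, mul_apply_eq_comp, S.σ_sq, inverse_apply_apply hu]
  have hZ : ∀ z v, ⟪z, dualEnergy σ A t (ℓ v)⟫_ℂ = ⟪ℓ (Ring.inverse (A t) (σ z)), σ v⟫_ℂ :=
    fun z v => by
      rw [dualEnergy, mul_apply_eq_comp, mul_apply_eq_comp, ← S.σ_symm,
        ← inverse_symm hu (S.A_symm t ht), S.σ_comm, S.ℓ_symm]
  refine ⟨?_, fun y z => ⟨?_, fun h => ?_⟩⟩
  · have : Prod.fst '' opGraph ℓ (σ * A t) = range ℓ := by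
      ext x
      constructor
      · rintro ⟨⟨a, b⟩, ⟨v, h1, -⟩, rfl⟩
        exact ⟨v, h1⟩
      · rintro ⟨v, rfl⟩
        exact ⟨(ℓ v, (σ * A t) v), ⟨v, rfl, rfl⟩, rfl⟩
    rw [this]
    exact S.denseRange_ℓ
  · rintro ⟨w, rfl, rfl⟩ ⟨a, b⟩ ⟨v, rfl, rfl⟩
    change ⟪ℓ w, dualEnergy σ A t (σ (A t v))⟫_ℂ = ⟪σ (A t w), dualEnergy σ A t (ℓ v)⟫_ℂ
    rw [hG, hZ, S.σ_sq, inverse_apply_apply hu]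
  · have h1 : y = ℓ (Ring.inverse (A t) (σ z)) := by
      refine ext_inner_right ℂ fun v => ?_
      have h2 := h (ℓ (σ v), σ (A t (σ v))) ⟨σ v, rfl, rfl⟩
      change ⟪y, dualEnergy σ A t (σ (A t (σ v)))⟫_ℂ = ⟪z, dualEnergy σ A t (ℓ (σ v))⟫_ℂ at h2
      rwa [hG, hZ, S.σ_sq] at h2
    refine ⟨_, h1.symm, ?_⟩
    rw [mul_apply_eq_comp, apply_inverse_apply hu, S.σ_sq]

/-- The part of σA(t) has inverse A(t)⁻¹σℓ, everywhere defined, with dense range, and symmetric for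
the energy form because σℓ is symmetric. -/
theorem isSelfAdjointGraph_partGraph {t : ℝ} (ht : t ∈ J) :
    IsSelfAdjointGraph (innerForm (A t)) (partGraph ℓ (σ * A t)) := by
  have hu := S.isUnit_A ht
  have hmem : ∀ v w, (v, w) ∈ partGraph ℓ (σ * A t) ↔ A t v = σ (ℓ w) := by
    intro v w
    change σ (A t v) = ℓ w ↔ _
    constructor
    · intro h; rw [← h, S.σ_sq]
    · intro h; rw [h, S.σ_sq]
  refine ⟨?_, fun y z => ⟨?_, fun h => ?_⟩⟩
  · have : Prod.fst '' partGraph ℓ (σ * A t) = range ((Ring.inverse (A t) : H →L[ℂ] H) ∘ σ ∘ ℓ) := by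
      ext x
      constructor
      · rintro ⟨⟨v, w⟩, h, rfl⟩
        refine ⟨w, ?_⟩
        rw [Function.comp_apply, Function.comp_apply, ← (hmem v w).1 h, inverse_apply_apply hu]
      · rintro ⟨w, rfl⟩
        refine ⟨(Ring.inverse (A t) (σ (ℓ w)), w), (hmem _ _).2 ?_, rfl⟩
        rw [apply_inverse_apply hu]
    rw [this]
    refine DenseRange.comp ?_ (DenseRange.comp ?_ S.denseRange_ℓ σ.continuous)
      (Ring.inverse (A t)).continuous
    · exact Function.Surjective.denseRange fun x => ⟨A t x, inverse_apply_apply hu x⟩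
    · exact Function.Surjective.denseRange fun x => ⟨σ x, S.σ_sq x⟩
  · rintro h1 ⟨v, w⟩ h2
    rw [hmem] at h1 h2
    change ⟪y, A t w⟫_ℂ = ⟪z, A t v⟫_ℂ
    rw [h2, ← S.A_symm t ht, h1, S.σ_symm, S.ℓ_symm, S.σ_comm]
  · rw [hmem]
    refine ext_inner_right ℂ fun w => ?_
    have h2 := h (Ring.inverse (A t) (σ (ℓ w)), w) ((hmem _ _).2 (apply_inverse_apply hu _))
    change ⟪y, A t w⟫_ℂ = ⟪z, A t (Ring.inverse (A t) (σ (ℓ w)))⟫_ℂ at h2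
    rw [apply_inverse_apply hu, ← S.A_symm t ht] at h2
    rw [h2, S.σ_symm, S.ℓ_symm, S.σ_comm]

theorem almostUnitaryHypotheses {C : ℝ → ℝ} (hC : ∀ τ, 0 ≤ C τ) (hCi : LocallyIntegrableOn C J)
    (hγ : ∀ s ∈ J, ∀ t ∈ J, |γ t - γ s| = 2 * |∫ τ in s..t, C τ|) :
    AlmostUnitaryHypotheses J ℓ fun t => σ * A t := by
  refine ⟨continuousOn_const.mul S.A_cont, fun t => innerForm (dualEnergy σ A t),
    fun t => innerForm (A t), C, fun t ht => ⟨?_, ?_, S.isSelfAdjointGraph_opGraph ht,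
      S.isSelfAdjointGraph_partGraph ht⟩, hC, hCi, fun s hs t ht => ⟨?_, ?_⟩⟩
  · exact isCompatibleInner_innerForm (S.dualEnergy_symm ht) (S.dualEnergy_coercive ht)
  · exact isCompatibleInner_innerForm (S.A_symm t ht) (S.A_coercive t ht)
  · exact innerNorm_innerForm_le fun x => by
      rw [← hγ s hs t ht]
      exact S.dualEnergy_comp ht hs x
  · exact innerNorm_innerForm_le fun x => by
      rw [← hγ s hs t ht]
      exact S.A_comp t ht s hs x

theorem isGroupGenerator {t : ℝ} (ht : t ∈ J) :
    IsGroupGenerator (opGraph ℓ (σ * A t + P * ℓ)) ∧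
      IsGroupGenerator (partGraph ℓ (σ * A t + P * ℓ)) := by
  have hu := S.isUnit_A ht
  -- The system frozen at time t is a charged system on all of ℝ with constant γ. Its evolution is
  -- the group, once the generator is seen to be closed.
  have S' : ChargedSystem univ ℓ σ P (fun _ => A t) fun _ => 0 :=
    { S with
      A_symm := fun _ _ => S.A_symm t ht
      A_coercive := fun _ _ => S.A_coercive t ht
      A_cont := continuousOn_const
      γ_cont := continuousOn_const
      γ_mono := monotoneOn_const
      A_comp := fun _ _ _ _ x => by simp }
  obtain ⟨R, hR⟩ := S'.exists_evolution ordConnected_univ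
  refine (hR.isEvolutionGeneratedBy ordConnected_univ).isGroupGenerator S.ℓ_inj S.denseRange_ℓ ?_
  intro v x y hx hy
  have h1 : Tendsto (fun n => Ring.inverse (A t) (σ ((σ * A t + P * ℓ) (v n) - P (ℓ (v n))))) atTop
      (𝓝 (Ring.inverse (A t) (σ (y - P x)))) :=
    ((Ring.inverse (A t)).continuous.tendsto _).comp ((σ.continuous.tendsto _).comp
      (hy.sub ((P.continuous.tendsto _).comp hx)))
  have h2 : ∀ n, Ring.inverse (A t) (σ ((σ * A t + P * ℓ) (v n) - P (ℓ (v n)))) = v n := fun n => by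
    have : (σ * A t + P * ℓ) (v n) - P (ℓ (v n)) = σ (A t (v n)) := by
      change σ (A t (v n)) + P (ℓ (v n)) - P (ℓ (v n)) = _
      abel
    rw [this, S.σ_sq, inverse_apply_apply hu]
  simp only [h2] at h1
  exact ⟨_, tendsto_nhds_unique ((ℓ.continuous.tendsto _).comp h1) hx,
    tendsto_nhds_unique (((σ * A t + P * ℓ).continuous.tendsto _).comp h1) hy⟩

theorem inner_generator {t : ℝ} (ht : t ∈ J) (v w : H) :
    ⟪(σ * A t + P * ℓ) v, σ w⟫_ℂ = conj ⟪(σ * A t + P * ℓ) w, σ v⟫_ℂ := by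
  have h : ∀ v w, ⟪(σ * A t + P * ℓ) v, σ w⟫_ℂ = ⟪A t v, w⟫_ℂ + ⟪σ (P (ℓ v)), w⟫_ℂ := fun v w => by
    change ⟪σ (A t v) + P (ℓ v), σ w⟫_ℂ = _
    rw [← S.σ_symm, map_add, S.σ_sq, inner_add_left]
  rw [h, h, map_add, inner_conj_symm, inner_conj_symm, S.A_symm t ht, S.P_symm,
    S.ℓ_symm, ← S.σ_comm, ← S.P_comm]

end ChargedSystem

end KleinGordon

/-! ### Absolute norm continuity and comparison of energy forms -/

namespace KleinGordon

open Set Filter Topology MeasureTheory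
open scoped Interval

section AbsNormContinuous

variable {X : Type*} [NormedAddCommGroup X] [NormedSpace ℂ X] {J : Set ℝ} {A : ℝ → X →L[ℂ] X}

theorem intervalIntegrable_of_Icc {f : ℝ → ℝ}
    (hf : ∀ a ∈ J, ∀ b ∈ J, a ≤ b → IntegrableOn f (Icc a b)) {s t : ℝ} (hs : s ∈ J) (ht : t ∈ J) :
    IntervalIntegrable f volume s t := by
  rcases le_total s t with h | h
  · exact (intervalIntegrable_iff_integrableOn_Icc_of_le h).2 (hf s hs t ht h)
  · exact ((intervalIntegrable_iff_integrableOn_Icc_of_le h).2 (hf t ht s hs h)).symm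

theorem continuousOn_integral_of_Icc {f : ℝ → ℝ} (hJ : J.OrdConnected)
    (hf : ∀ a ∈ J, ∀ b ∈ J, a ≤ b → IntegrableOn f (Icc a b)) {s : ℝ} (hs : s ∈ J) :
    ContinuousOn (fun t => ∫ τ in s..t, f τ) J := by
  intro t ht
  obtain ⟨a, ha, b, hb, hab, hta, hsa, -, hnt, -⟩ := exists_Icc_mem_nhdsWithin hJ ht hs
  have h1 := intervalIntegral.continuousOn_primitive_interval' (a := s)
    (intervalIntegrable_of_Icc hf ha hb) (by rwa [uIcc_of_le hab])
  rw [uIcc_of_le hab] at h1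
  exact (h1 t hta).mono_of_mem_nhdsWithin hnt

theorem AbsNormContinuousOn.continuousOn (hJ : J.OrdConnected) (h : AbsNormContinuousOn J A) :
    ContinuousOn A J := by
  obtain ⟨c, hc0, hci, hc⟩ := h
  have hci' : ∀ a ∈ J, ∀ b ∈ J, a ≤ b → IntegrableOn c (Icc a b) := fun a ha b hb _ =>
    hci.mono_set (hJ.out ha hb)
  intro t ht
  have h1 := (continuousOn_integral_of_Icc hJ hci' ht t ht).abs
  rw [ContinuousWithinAt, tendsto_iff_norm_sub_tendsto_zero]
  have h2 : Tendsto (fun x => |∫ τ in t..x, c τ|) (𝓝[J] t) (𝓝 0) := by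
    simpa [ContinuousWithinAt] using h1
  refine squeeze_zero' (Eventually.of_forall fun _ => norm_nonneg _) ?_ h2
  filter_upwards [self_mem_nhdsWithin] with s hs
  rcases le_total t s with hts | hts
  · exact (hc t ht s hs hts).trans (le_abs_self _)
  · rw [norm_sub_rev, intervalIntegral.integral_symm, abs_neg]
    exact (hc s hs t ht hts).trans (le_abs_self _)

end AbsNormContinuous

/-- A multiplicative estimate needs to be known only immediately to the right of each point:
exp(-γ)f decreases and exp(γ)f increases, by the Dini derivative criterion. -/
theorem le_exp_mul_of_local {f γ : ℝ → ℝ} {s t : ℝ} (hst : s ≤ t) (hf : ContinuousOn f (Icc s t))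
    (hγ : ContinuousOn γ (Icc s t))
    (h : ∀ x ∈ Ico s t, ∀ᶠ z in 𝓝[>] x, f z ≤ Real.exp (γ z - γ x) * f x ∧
      f x ≤ Real.exp (γ z - γ x) * f z) :
    f t ≤ Real.exp (γ t - γ s) * f s ∧ f s ≤ Real.exp (γ t - γ s) * f t := by
  have slope_lt : ∀ (g : ℝ → ℝ) (x z r : ℝ), x < z → 0 < r → g z ≤ g x → slope g x z < r := by
    intro g x z r hxz hr hg
    rw [slope_def_field]
    exact (div_nonpos_of_nonpos_of_nonneg (by linarith) (by linarith)).trans_lt hr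
  have h1 : Real.exp (-γ t) * f t ≤ Real.exp (-γ s) * f s := by
    refine antitone_of_slope (f := fun z => Real.exp (-γ z) * f z) hst
      ((Real.continuous_exp.comp_continuousOn hγ.neg).mul hf) fun x hx r hr => Eventually.frequently ?_
    filter_upwards [h x hx, self_mem_nhdsWithin] with z hz hxz
    refine slope_lt _ _ _ _ hxz hr ?_
    refine (mul_le_mul_of_nonneg_left hz.1 (Real.exp_nonneg _)).trans (le_of_eq ?_)
    rw [← mul_assoc, ← Real.exp_add]
    ring_nf
  have h2 : -(Real.exp (γ t) * f t) ≤ -(Real.exp (γ s) * f s) := by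
    refine antitone_of_slope (f := fun z => -(Real.exp (γ z) * f z)) hst
      ((Real.continuous_exp.comp_continuousOn hγ).mul hf).neg fun x hx r hr => Eventually.frequently ?_
    filter_upwards [h x hx, self_mem_nhdsWithin] with z hz hxz
    refine slope_lt _ _ _ _ hxz hr (neg_le_neg ?_)
    refine (mul_le_mul_of_nonneg_left hz.2 (Real.exp_nonneg _)).trans (le_of_eq ?_)
    rw [← mul_assoc, ← Real.exp_add]
    ring_nf
  constructor
  · have := mul_le_mul_of_nonneg_left h1 (Real.exp_nonneg (γ t))
    rw [← mul_assoc, ← Real.exp_add, add_neg_cancel, Real.exp_zero, one_mul, ← mul_assoc,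
      ← Real.exp_add] at this
    simpa only [sub_eq_add_neg] using this
  · have := mul_le_mul_of_nonneg_left (neg_le_neg_iff.1 h2) (Real.exp_nonneg (-γ s))
    rw [← mul_assoc, ← Real.exp_add, neg_add_cancel, Real.exp_zero, one_mul, ← mul_assoc,
      ← Real.exp_add, neg_add_eq_sub] at this
    exact this

variable {H : Type*} [NormedAddCommGroup H] [InnerProductSpace ℂ H] [CompleteSpace H]

theorem sq_norm_le_mul_quadForm {T : H →L[ℂ] H} (hT : IsUnit T)
    (hs : ∀ x y, ⟪T x, y⟫_ℂ = ⟪x, T y⟫_ℂ) (h0 : ∀ x, 0 ≤ quadForm T x) (x : H) :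
    ‖x‖ ^ 2 ≤ (‖Ring.inverse T‖ + 1) * quadForm T x := by
  have hu : IsUnit (Ring.inverse T) := IsUnit.ringInverse hT
  have h1 : ∀ y, quadForm (1 : H →L[ℂ] H) y = ‖y‖ ^ 2 := fun y => inner_self_eq_norm_sq (𝕜 := ℂ) y
  have h2 : ∀ y, quadForm (Ring.inverse T) y ≤ (‖Ring.inverse T‖ + 1) * quadForm 1 y := fun y => by
    rw [h1]
    have h3 : quadForm (Ring.inverse T) y ≤ ‖y‖ * (‖Ring.inverse T‖ * ‖y‖) :=
      (Complex.re_le_norm _).trans ((norm_inner_le_norm _ _).trans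
        (mul_le_mul_of_nonneg_left ((Ring.inverse T).le_opNorm y) (norm_nonneg _)))
    nlinarith [sq_nonneg ‖y‖]
  have h4 := quadForm_inverse_le (by positivity) hu isUnit_one (inverse_symm hT hs)
    (fun y => by
      have := h0 (Ring.inverse T y)
      rw [quadForm, apply_inverse_apply hT] at this
      rw [quadForm, ← inverse_symm hT hs]
      exact this) h2 x
  rwa [Ring.inverse_one, h1, Ring.inverse_inverse hT] at h4

/-- Positive definite forms which depend on time in an absolutely continuous way are comparable, in
a locally absolutely continuous way. -/
theorem exists_comparison {J : Set ℝ} (hJ : J.OrdConnected) {t₀ : ℝ} (ht₀ : t₀ ∈ J)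
    {A : ℝ → H →L[ℂ] H} (hA : AbsNormContinuousOn J A)
    (hsym : ∀ t ∈ J, ∀ x y, ⟪A t x, y⟫_ℂ = ⟪x, A t y⟫_ℂ)
    (hm : ∀ t ∈ J, ∃ m : ℝ, 0 < m ∧ ∀ x, m * ‖x‖ ^ 2 ≤ quadForm (A t) x) :
    ∃ (C γ : ℝ → ℝ), (∀ τ, 0 ≤ C τ) ∧ LocallyIntegrableOn C J ∧ ContinuousOn γ J ∧ MonotoneOn γ J ∧
      (∀ s ∈ J, ∀ t ∈ J, |γ t - γ s| = 2 * |∫ τ in s..t, C τ|) ∧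
      ∀ t ∈ J, ∀ s ∈ J, ∀ x, quadForm (A t) x ≤ Real.exp |γ t - γ s| * quadForm (A s) x := by
  have hAc := hA.continuousOn hJ
  obtain ⟨c, hc0, hci, hc⟩ := hA
  have hunit : ∀ t ∈ J, IsUnit (A t) := fun t ht => by
    obtain ⟨m, hm0, hm⟩ := hm t ht
    exact isUnit_of_coercive hm0 hm
  have hpos : ∀ t ∈ J, ∀ x, 0 ≤ quadForm (A t) x := fun t ht x => by
    obtain ⟨m, hm0, hm⟩ := hm t ht
    exact le_trans (by positivity) (hm x)
  set N : ℝ → ℝ := fun t => ‖Ring.inverse (A t)‖ + 1 with hN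
  have hN1 : ∀ t, 1 ≤ N t := fun t => by simp [hN]
  have hNc : ContinuousOn N J := by
    intro t ht
    have h1 : ContinuousAt Ring.inverse (A t) := by
      obtain ⟨u, hu⟩ := hunit t ht
      rw [← hu]
      exact NormedRing.inverse_continuousAt u
    exact (h1.comp_continuousWithinAt (hAc t ht)).norm.add continuousWithinAt_const
  -- The increment of the form is relative to ‖x‖², and N converts this into an estimate relative to
  -- the form. Since N may be unbounded near the ends of J, C is only locally integrable.
  set C : ℝ → ℝ := fun τ => c τ * N τ with hC
  have hC0 : ∀ τ, 0 ≤ C τ := fun τ => mul_nonneg (hc0 τ) (zero_le_one.trans (hN1 τ))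
  have hcI : ∀ a ∈ J, ∀ b ∈ J, a ≤ b → IntegrableOn c (Icc a b) := fun a ha b hb _ =>
    hci.mono_set (hJ.out ha hb)
  have hCI : ∀ a ∈ J, ∀ b ∈ J, a ≤ b → IntegrableOn C (Icc a b) := fun a ha b hb hab =>
    (hcI a ha b hb hab).mul_continuousOn (hNc.mono (hJ.out ha hb)) isCompact_Icc
  have hint : ∀ s ∈ J, ∀ t ∈ J, IntervalIntegrable C volume s t := fun s hs t ht =>
    intervalIntegrable_of_Icc hCI hs ht
  -- The factor 2 makes room for the oscillation of N on short intervals. It also matches the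
  -- passage from quadratic forms to norms, which halves the exponent.
  set γ : ℝ → ℝ := fun t => 2 * ∫ τ in t₀..t, C τ with hγ
  have hγsub : ∀ s ∈ J, ∀ t ∈ J, γ t - γ s = 2 * ∫ τ in s..t, C τ := fun s hs t ht => by
    rw [hγ, ← intervalIntegral.integral_interval_sub_left (hint t₀ ht₀ t ht) (hint t₀ ht₀ s hs)]
    ring
  have hγc : ContinuousOn γ J := (continuousOn_integral_of_Icc hJ hCI ht₀).const_mul 2
  have hγm : MonotoneOn γ J := fun s hs t ht hst => by
    have h1 := hγsub s hs t ht
    have h2 : 0 ≤ ∫ τ in s..t, C τ := intervalIntegral.integral_nonneg hst fun τ _ => hC0 τ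
    linarith
  refine ⟨C, γ, hC0, fun t ht => ?_, hγc, hγm, fun s hs t ht => ?_, ?_⟩
  · obtain ⟨a, ha, b, hb, hab, -, -, -, hnt, -⟩ := exists_Icc_mem_nhdsWithin hJ ht ht
    exact ⟨_, hnt, hCI a ha b hb hab⟩
  · rw [hγsub s hs t ht, abs_mul, abs_two]
  · have key : ∀ s ∈ J, ∀ t ∈ J, s ≤ t → ∀ x,
        quadForm (A t) x ≤ Real.exp (γ t - γ s) * quadForm (A s) x ∧
        quadForm (A s) x ≤ Real.exp (γ t - γ s) * quadForm (A t) x := by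
      intro s hs t ht hst x
      have hsub := hJ.out hs ht
      refine le_exp_mul_of_local (f := fun τ => quadForm (A τ) x) hst ?_ (hγc.mono hsub)
        fun r hr => ?_
      · have h1 : ContinuousOn (fun τ => ⟪x, A τ x⟫_ℂ) (Icc s t) :=
          continuousOn_const.inner ((hAc.mono hsub).clm_apply continuousOn_const)
        exact Complex.continuous_re.comp_continuousOn h1
      · have hrJ := hsub (Ico_subset_Icc_self hr)
        have hIcc : Icc r t ⊆ J := (Icc_subset_Icc_left hr.1).trans hsub
        -- Two values of N then differ by less than 1/2, and since N ≥ 1 each is at most twice the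
        -- other.
        have h1 : ∀ᶠ z in 𝓝[Icc r t] r, N z ∈ Ioo (N r - 1 / 4) (N r + 1 / 4) :=
          (hNc.mono hIcc r ⟨le_rfl, hr.2.le⟩).eventually
            (Ioo_mem_nhds (by linarith) (by linarith))
        rw [eventually_nhdsWithin_iff, Metric.eventually_nhds_iff] at h1
        obtain ⟨ε, hε, h1⟩ := h1
        have h2 : Ioo r (min t (r + ε)) ∈ 𝓝[>] r :=
          Ioo_mem_nhdsGT (lt_min hr.2 (by linarith))
        filter_upwards [h2] with z hz
        have hzt : z < t := hz.2.trans_le (min_le_left _ _)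
        have hzε : z < r + ε := hz.2.trans_le (min_le_right _ _)
        have hzJ : z ∈ J := hIcc ⟨hz.1.le, hzt.le⟩
        have h3 : ∀ τ ∈ Icc r z, N τ ∈ Ioo (N r - 1 / 4) (N r + 1 / 4) := fun τ hτ =>
          h1 (by rw [Real.dist_eq, abs_of_nonneg (by linarith [hτ.1])]; linarith [hτ.2])
            ⟨hτ.1, hτ.2.trans hzt.le⟩
        have h4 : ∀ q ∈ Icc r z, N q * ∫ τ in r..z, c τ ≤ γ z - γ r := by
          intro q hq
          rw [hγsub r hrJ z hzJ, ← intervalIntegral.integral_const_mul,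
            ← intervalIntegral.integral_const_mul]
          refine intervalIntegral.integral_mono_on hz.1.le
            ((intervalIntegrable_of_Icc hcI hrJ hzJ).const_mul _)
            ((hint r hrJ z hzJ).const_mul _) fun τ hτ => ?_
          have h5 := h3 τ hτ
          have h6 := h3 q hq
          have h7 : N q ≤ 2 * N τ := by linarith [h5.1, h6.2, hN1 τ]
          calc N q * c τ ≤ 2 * N τ * c τ := mul_le_mul_of_nonneg_right h7 (hc0 τ)
            _ = 2 * (c τ * N τ) := by ring
        have h5 : |quadForm (A z) x - quadForm (A r) x| ≤ (∫ τ in r..z, c τ) * ‖x‖ ^ 2 := by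
          have e1 : quadForm (A z) x - quadForm (A r) x = (⟪x, (A z - A r) x⟫_ℂ).re := by
            rw [quadForm, quadForm, sub_apply, inner_sub_right, Complex.sub_re]
          rw [e1]
          refine (Complex.abs_re_le_norm _).trans ((norm_inner_le_norm _ _).trans ?_)
          have h6 := (A z - A r).le_of_opNorm_le (hc r hrJ z hzJ hz.1.le) x
          calc _ ≤ ‖x‖ * ((∫ τ in r..z, c τ) * ‖x‖) := mul_le_mul_of_nonneg_left h6 (norm_nonneg _)
            _ = _ := by ring
        have h6 : ∀ q ∈ Icc r z, (∫ τ in r..z, c τ) * ‖x‖ ^ 2 ≤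
            (γ z - γ r) * quadForm (A q) x := by
          intro q hq
          have hqJ : q ∈ J := hIcc ⟨hq.1, hq.2.trans hzt.le⟩
          have h7 := sq_norm_le_mul_quadForm (hunit q hqJ) (hsym q hqJ) (hpos q hqJ) x
          have h8 : 0 ≤ ∫ τ in r..z, c τ := intervalIntegral.integral_nonneg hz.1.le fun τ _ => hc0 τ
          calc _ ≤ (∫ τ in r..z, c τ) * (N q * quadForm (A q) x) := mul_le_mul_of_nonneg_left h7 h8
            _ = N q * (∫ τ in r..z, c τ) * quadForm (A q) x := by ring
            _ ≤ _ := mul_le_mul_of_nonneg_right (h4 q hq) (hpos q hqJ x)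
        have h7 := h6 r ⟨le_rfl, hz.1.le⟩
        have h8 := h6 z ⟨hz.1.le, le_rfl⟩
        have h9 := Real.add_one_le_exp (γ z - γ r)
        have h10 := mul_le_mul_of_nonneg_right h9 (hpos r hrJ x)
        have h11 := mul_le_mul_of_nonneg_right h9 (hpos z hzJ x)
        rw [abs_le] at h5
        constructor <;> linarith
    intro t ht s hs x
    rcases le_total s t with h | h
    · rw [abs_of_nonneg (sub_nonneg.2 (hγm hs ht h))]
      exact (key s hs t ht h x).1
    · rw [abs_sub_comm, abs_of_nonneg (sub_nonneg.2 (hγm ht hs h))]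
      exact (key t ht s hs h x).2

end KleinGordon

/-! ### Operator matrices on K ⊕ K -/

namespace KleinGordon

open Set Filter Topology MeasureTheory
open scoped Interval

variable {K : Type*} [NormedAddCommGroup K] [InnerProductSpace ℂ K] [CompleteSpace K]

/-- The operator on `K ⊕ K` with a given matrix. -/
noncomputable def block (a b c d : K →L[ℂ] K) : WithLp 2 (K × K) →L[ℂ] WithLp 2 (K × K) :=
  ((WithLp.prodContinuousLinearEquiv 2 ℂ K K).symm : K × K →L[ℂ] WithLp 2 (K × K)) ∘L
    (a.coprod b).prod (c.coprod d) ∘L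
    (WithLp.prodContinuousLinearEquiv 2 ℂ K K : WithLp 2 (K × K) →L[ℂ] K × K)

section Block

variable (a b c d : K →L[ℂ] K) (x : WithLp 2 (K × K))

theorem block_fst : (block a b c d x).fst = a x.fst + b x.snd := rfl

theorem block_snd : (block a b c d x).snd = c x.fst + d x.snd := rfl

theorem withLp_ext {x y : WithLp 2 (K × K)} (h1 : x.fst = y.fst) (h2 : x.snd = y.snd) : x = y :=
  (WithLp.equiv 2 (K × K)).injective (Prod.ext h1 h2)

theorem inner_withLp (x y : WithLp 2 (K × K)) :
    ⟪x, y⟫_ℂ = ⟪x.fst, y.fst⟫_ℂ + ⟪x.snd, y.snd⟫_ℂ :=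
  WithLp.prod_inner_apply x y

theorem block_symm {a b c d : K →L[ℂ] K} (ha : ∀ x y, ⟪a x, y⟫_ℂ = ⟪x, a y⟫_ℂ)
    (hd : ∀ x y, ⟪d x, y⟫_ℂ = ⟪x, d y⟫_ℂ) (hb : ∀ x y, ⟪b x, y⟫_ℂ = ⟪x, c y⟫_ℂ)
    (x y : WithLp 2 (K × K)) : ⟪block a b c d x, y⟫_ℂ = ⟪x, block a b c d y⟫_ℂ := by
  have hc : ∀ x y, ⟪c x, y⟫_ℂ = ⟪x, b y⟫_ℂ := fun x y => by
    rw [← inner_conj_symm, ← hb, inner_conj_symm]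
  simp only [inner_withLp, block_fst, block_snd, inner_add_left, inner_add_right, ha, hb,
    hc, hd]
  ring

theorem norm_block_le : ∃ κ : ℝ, 0 ≤ κ ∧ ∀ a b c d : K →L[ℂ] K,
    ‖block a b c d‖ ≤ κ * (‖a‖ + ‖b‖ + ‖c‖ + ‖d‖) := by
  set e : WithLp 2 (K × K) →L[ℂ] K × K :=
    (WithLp.prodContinuousLinearEquiv 2 ℂ K K : WithLp 2 (K × K) →L[ℂ] K × K)
  set e' : K × K →L[ℂ] WithLp 2 (K × K) :=
    ((WithLp.prodContinuousLinearEquiv 2 ℂ K K).symm : K × K →L[ℂ] WithLp 2 (K × K))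
  refine ⟨‖e'‖ * ‖e‖, by positivity, fun a b c d => ?_⟩
  have h : ‖(a.coprod b).prod (c.coprod d)‖ ≤ ‖a‖ + ‖b‖ + ‖c‖ + ‖d‖ := by
    refine ContinuousLinearMap.opNorm_le_bound _ (by positivity) fun x => ?_
    have h1 := a.le_opNorm x.1
    have h2 := b.le_opNorm x.2
    have h3 := c.le_opNorm x.1
    have h4 := d.le_opNorm x.2
    have h5 := norm_fst_le x
    have h6 := norm_snd_le x
    have h7 : ∀ T : K →L[ℂ] K, ∀ y, ‖y‖ ≤ ‖x‖ → ‖T y‖ ≤ ‖T‖ * ‖x‖ := fun T y hy =>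
      (T.le_opNorm y).trans (mul_le_mul_of_nonneg_left hy (norm_nonneg _))
    have h8 : ∀ T : K →L[ℂ] K, 0 ≤ ‖T‖ * ‖x‖ := fun T => by positivity
    rw [ContinuousLinearMap.prod_apply, Prod.norm_def, max_le_iff]
    constructor
    · have := norm_add_le (a x.1) (b x.2)
      change ‖a x.1 + b x.2‖ ≤ _
      linarith [h7 a _ h5, h7 b _ h6, h8 c, h8 d]
    · have := norm_add_le (c x.1) (d x.2)
      change ‖c x.1 + d x.2‖ ≤ _
      linarith [h7 c _ h5, h7 d _ h6, h8 a, h8 b]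
  calc ‖block a b c d‖ ≤ ‖e'‖ * (‖(a.coprod b).prod (c.coprod d)‖ * ‖e‖) :=
        (ContinuousLinearMap.opNorm_comp_le _ _).trans
          (mul_le_mul_of_nonneg_left (ContinuousLinearMap.opNorm_comp_le _ _) (norm_nonneg _))
    _ ≤ ‖e'‖ * ((‖a‖ + ‖b‖ + ‖c‖ + ‖d‖) * ‖e‖) := by gcongr
    _ = _ := by ring

theorem block_sub (a b c d a' b' c' d' : K →L[ℂ] K) :
    block a b c d - block a' b' c' d' = block (a - a') (b - b') (c - c') (d - d') := by
  ext x
  refine withLp_ext ?_ ?_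
  · change a x.fst + b x.snd - (a' x.fst + b' x.snd) = (a - a') x.fst + (b - b') x.snd
    simp only [sub_apply]
    abel
  · change c x.fst + d x.snd - (c' x.fst + d' x.snd) = (c - c') x.fst + (d - d') x.snd
    simp only [sub_apply]
    abel

theorem AbsNormContinuousOn.block {J : Set ℝ} {a c d : ℝ → K →L[ℂ] K} (ha : AbsNormContinuousOn J a)
    (hc : AbsNormContinuousOn J c) (hd : AbsNormContinuousOn J d) (hJ : J.OrdConnected) :
    AbsNormContinuousOn J fun t =>
      block (a t) (ContinuousLinearMap.adjoint (c t)) (c t) (d t) := by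
  obtain ⟨κ, hκ, hb⟩ := norm_block_le (K := K)
  obtain ⟨f, hf0, hfi, hf⟩ := ha
  obtain ⟨g, hg0, hgi, hg⟩ := hc
  obtain ⟨k, hk0, hki, hk⟩ := hd
  refine ⟨fun τ => κ * (f τ + g τ + g τ + k τ), fun τ => ?_,
    (((hfi.add hgi).add hgi).add hki).const_mul κ, fun s hs t ht hst => ?_⟩
  · exact mul_nonneg hκ (add_nonneg (add_nonneg (add_nonneg (hf0 τ) (hg0 τ)) (hg0 τ)) (hk0 τ))
  · have hI : ∀ {u : ℝ → ℝ}, IntegrableOn u J → IntervalIntegrable u volume s t := fun hu =>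
      intervalIntegrable_of_Icc (fun a ha b hb _ => hu.mono_set (hJ.out ha hb)) hs ht
    rw [block_sub, intervalIntegral.integral_const_mul,
      intervalIntegral.integral_add (((hI hfi).add (hI hgi)).add (hI hgi)) (hI hki),
      intervalIntegral.integral_add ((hI hfi).add (hI hgi)) (hI hgi),
      intervalIntegral.integral_add (hI hfi) (hI hgi)]
    refine (hb _ _ _ _).trans (mul_le_mul_of_nonneg_left ?_ hκ)
    rw [← map_sub, LinearIsometryEquiv.norm_map]
    linarith [hf s hs t ht hst, hg s hs t ht hst, hk s hs t ht hst]

/-- Two copies of an operator. -/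
noncomputable def diag (T : K →L[ℂ] K) : WithLp 2 (K × K) →L[ℂ] WithLp 2 (K × K) := block T 0 0 T

theorem diag_fst (T : K →L[ℂ] K) (x : WithLp 2 (K × K)) : (diag T x).fst = T x.fst := by
  rw [diag, block_fst, zero_apply, add_zero]

theorem diag_snd (T : K →L[ℂ] K) (x : WithLp 2 (K × K)) : (diag T x).snd = T x.snd := by
  rw [diag, block_snd, zero_apply, zero_add]

/-- Two copies of an operator, as a homomorphism of star algebras. -/
noncomputable def diagHom :
    (K →L[ℂ] K) →⋆ₐ[ℂ] (WithLp 2 (K × K) →L[ℂ] WithLp 2 (K × K)) where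
  toFun := diag
  map_one' := ContinuousLinearMap.ext fun x => withLp_ext (diag_fst _ _) (diag_snd _ _)
  map_mul' S T := ContinuousLinearMap.ext fun x => withLp_ext
    (by rw [mul_apply_eq_comp, diag_fst, diag_fst, diag_fst]; rfl)
    (by rw [mul_apply_eq_comp, diag_snd, diag_snd, diag_snd]; rfl)
  map_zero' := ContinuousLinearMap.ext fun x => withLp_ext (diag_fst _ _) (diag_snd _ _)
  map_add' S T := ContinuousLinearMap.ext fun x => withLp_ext
    (by rw [add_apply, diag_fst, WithLp.add_fst, diag_fst, diag_fst]; rfl)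
    (by rw [add_apply, diag_snd, WithLp.add_snd, diag_snd, diag_snd]; rfl)
  commutes' r := ContinuousLinearMap.ext fun x => withLp_ext (diag_fst _ _) (diag_snd _ _)
  map_star' T := by
    refine ContinuousLinearMap.ext fun x => ext_inner_left ℂ fun y => ?_
    rw [ContinuousLinearMap.star_eq_adjoint, ContinuousLinearMap.star_eq_adjoint,
      ContinuousLinearMap.adjoint_inner_right]
    simp only [inner_withLp, diag_fst, diag_snd, ContinuousLinearMap.adjoint_inner_right]

theorem continuous_diagHom : Continuous (diagHom (K := K)) := by
  obtain ⟨κ, hκ, hb⟩ := norm_block_le (K := K)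
  refine AddMonoidHomClass.continuous_of_bound diagHom (2 * κ) fun T => ?_
  refine (hb T 0 0 T).trans (le_of_eq ?_)
  rw [norm_zero]
  ring

theorem diag_nonneg {T : K →L[ℂ] K} (hT : 0 ≤ T) : 0 ≤ diag T := by
  have h := (ContinuousLinearMap.nonneg_iff_isPositive T).1 hT
  rw [ContinuousLinearMap.nonneg_iff_isPositive]
  refine ⟨fun x y => ?_, fun x => ?_⟩
  · change ⟪diag T x, y⟫_ℂ = ⟪x, diag T y⟫_ℂ
    simp only [inner_withLp, diag_fst, diag_snd, h.inner_left_eq_inner_right]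
  · have h1 := h.re_inner_nonneg_left x.fst
    have h2 := h.re_inner_nonneg_left x.snd
    change 0 ≤ RCLike.re ⟪diag T x, x⟫_ℂ
    rw [inner_withLp, diag_fst, diag_snd, map_add]
    exact add_nonneg h1 h2

/-- A continuous homomorphism of star algebras commutes with the continuous functional calculus. -/
theorem diag_rpow {T : K →L[ℂ] K} (hT : 0 ≤ T) {p : ℝ} (hp : 0 ≤ p) : diag T ^ p = diag (T ^ p) := by
  have hc : ContinuousOn (fun x : ℝ≥0 => x ^ p) (spectrum ℝ≥0 T) :=
    (NNReal.continuous_rpow_const hp).continuousOn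
  exact (StarAlgHomClass.map_cfc (R := ℝ≥0) (S := ℂ) (diagHom (K := K)) (fun x : ℝ≥0 => x ^ p) T hc
    continuous_diagHom hT (diag_nonneg hT)).symm

/-- The exchange of the two components. -/
noncomputable def swap : WithLp 2 (K × K) →L[ℂ] WithLp 2 (K × K) := block 0 1 1 0

theorem swap_fst : (swap x).fst = x.snd := by
  rw [swap, block_fst, zero_apply, zero_add]
  rfl

theorem swap_snd : (swap x).snd = x.fst := by
  rw [swap, block_snd, zero_apply, add_zero]
  rfl

end Block

end KleinGordon

/-! ### Coordinates on the scale W_λ -/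

namespace KleinGordon

open Set Filter Topology MeasureTheory
open scoped Interval

variable {K : Type*} [NormedAddCommGroup K] [InnerProductSpace ℂ K] [CompleteSpace K]

namespace Data

variable {J : Set ℝ} (D : Data K J)

theorem negPow_symm (s : ℝ≥0) (x y : K) : ⟪D.negPow 0 s x, y⟫_ℂ = ⟪x, D.negPow 0 s y⟫_ℂ :=
  rpow_symm (ℓ := D.L₀inv 0) s x y

/-- The isometry `L₀(0)^(-γ/2) : K → K_γ`. -/
noncomputable def posEquiv (γ : ℝ≥0) : K ≃L[ℂ] D.KPos γ :=
  (⟨D.equivK γ, D.norm_equivK γ⟩ : K ≃ₗᵢ[ℂ] D.KPos γ).toContinuousLinearEquiv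

theorem posEquiv_apply (γ : ℝ≥0) (x : K) : D.posEquiv γ x = D.equivK γ x := rfl

theorem toK_posEquiv (γ : ℝ≥0) (x : K) : D.toK (D.posEquiv γ x) = D.negPow 0 (γ / 2) x := rfl

theorem incl_posEquiv {p q : ℝ≥0} (h : q ≤ p) (x : K) :
    D.incl h (D.posEquiv p x) = D.posEquiv q (D.negPow 0 ((p - q) / 2) x) := by
  refine D.toK_injective q ?_
  rw [D.toK_incl, posEquiv_apply, posEquiv_apply, D.equivK_factor h]

/-- The vector `y` as a functional `L₀(0)^(-γ/2) x ↦ (x|y)` on `K_γ`. -/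
noncomputable def negMap (γ : ℝ≥0) : K →L[ℂ] D.KNeg γ :=
  (ContinuousLinearMap.precomp ℂ ((D.posEquiv γ).symm : D.KPos γ →L[ℂ] K)) ∘L (innerSL ℂ).flip

theorem negMap_apply (γ : ℝ≥0) (y x : K) : D.negMap γ y (D.posEquiv γ x) = ⟪x, y⟫_ℂ := by
  change ⟪(D.posEquiv γ).symm (D.posEquiv γ x), y⟫_ℂ = _
  rw [ContinuousLinearEquiv.symm_apply_apply]

theorem negMap_injective (γ : ℝ≥0) : Function.Injective (D.negMap γ) := fun y z h =>
  ext_inner_left ℂ fun x => by rw [← negMap_apply, ← negMap_apply, h]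

/-- The Riesz theorem; antilinear functionals are conjugated first. -/
theorem negMap_surjective (γ : ℝ≥0) : Function.Surjective (D.negMap γ) := by
  intro φ
  let ψ : StrongDual ℂ K := ((starL ℂ : ℂ ≃L⋆[ℂ] ℂ) : ℂ →L⋆[ℂ] ℂ).comp
    (φ.comp (D.posEquiv γ : K →L[ℂ] D.KPos γ))
  refine ⟨(InnerProductSpace.toDual ℂ K).symm ψ, ContinuousLinearMap.ext fun f => ?_⟩
  obtain ⟨x, rfl⟩ := (D.posEquiv γ).surjective f
  rw [negMap_apply, ← inner_conj_symm, InnerProductSpace.toDual_symm_apply]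
  exact Complex.conj_conj _

/-- The identification of `K` with `K_{-γ}`. -/
noncomputable def negEquiv (γ : ℝ≥0) : K ≃L[ℂ] D.KNeg γ :=
  ContinuousLinearEquiv.ofBijective (D.negMap γ) (LinearMap.ker_eq_bot.2 (D.negMap_injective γ))
    (LinearMap.range_eq_top.2 (D.negMap_surjective γ))

theorem negEquiv_apply (γ : ℝ≥0) (y x : K) : D.negEquiv γ y (D.posEquiv γ x) = ⟪x, y⟫_ℂ :=
  D.negMap_apply γ y x

/-- The identification of `K ⊕ K` with `W_λ`. -/
noncomputable def coord (lam : ℝ) : WithLp 2 (K × K) ≃L[ℂ] D.Wsp lam :=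
  (WithLp.prodContinuousLinearEquiv 2 ℂ K K).trans
    ((D.posEquiv (Real.toNNReal (1 / 2 + lam))).prodCongr
      (D.negEquiv (Real.toNNReal (1 / 2 - lam))))

theorem coord_fst (lam : ℝ) (x : WithLp 2 (K × K)) :
    (D.coord lam x).1 = D.posEquiv (Real.toNNReal (1 / 2 + lam)) x.fst := rfl

theorem coord_snd (lam : ℝ) (x : WithLp 2 (K × K)) :
    (D.coord lam x).2 = D.negEquiv (Real.toNNReal (1 / 2 - lam)) x.snd := rfl

/-- The operator `L₀(0)^(-1/2)`, acting on both components. -/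
noncomputable def ℓ : WithLp 2 (K × K) →L[ℂ] WithLp 2 (K × K) := diag (D.negPow 0 (1 / 2))

theorem negPow_nonneg (s : ℝ≥0) : 0 ≤ D.negPow 0 s := CFC.rpow_nonneg

theorem ℓ_nonneg : 0 ≤ D.ℓ := diag_nonneg (D.negPow_nonneg _)

theorem ℓ_rpow {p : ℝ} (hp : 0 ≤ p) : D.ℓ ^ p = diag (D.negPow 0 (Real.toNNReal p / 2)) := by
  rw [ℓ, diag_rpow (D.negPow_nonneg _) hp, negPow, negPow,
    CFC.rpow_rpow_of_exponent_nonneg _ _ _ (by positivity) hp (D.L₀inv_nonneg D.zero_mem)]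
  congr 2
  rw [NNReal.coe_div, NNReal.coe_div, Real.coe_toNNReal p hp]
  push_cast
  ring

theorem ℓ_injective : Function.Injective D.ℓ := fun x y h => by
  have hi := D.negPow_injective D.zero_mem (1 / 2)
  refine withLp_ext (hi ?_) (hi ?_)
  · rw [← diag_fst, ← diag_fst]
    exact congrArg WithLp.fst h
  · rw [← diag_snd, ← diag_snd]
    exact congrArg WithLp.snd h

/-- In both components the index drops by λ + 1/2, and a drop by δ is L₀(0)^(-δ/2) in coordinates.
For functionals this comes from restriction and the symmetry of that power. -/
theorem inclW_coord {lam : ℝ} (h : -(1 / 2) ≤ lam) (hl : lam ≤ 1 / 2) (x : WithLp 2 (K × K)) :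
    D.inclW h (D.coord lam x) = D.coord (-(1 / 2)) ((D.ℓ ^ (lam + 1 / 2)) x) := by
  have hp : (0 : ℝ) ≤ lam + 1 / 2 := by linarith
  have e1 : Real.toNNReal (1 / 2 + lam) - Real.toNNReal (1 / 2 + -(1 / 2)) =
      Real.toNNReal (lam + 1 / 2) := by
    rw [add_neg_cancel, Real.toNNReal_zero, tsub_zero, add_comm]
  have e2 : Real.toNNReal (1 / 2 - -(1 / 2)) - Real.toNNReal (1 / 2 - lam) =
      Real.toNNReal (lam + 1 / 2) := by
    rw [← NNReal.coe_inj, NNReal.coe_sub (Real.toNNReal_le_toNNReal (by linarith)),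
      Real.coe_toNNReal _ (by norm_num), Real.coe_toNNReal _ (by linarith), Real.coe_toNNReal _ hp]
    ring
  rw [D.ℓ_rpow hp]
  refine Prod.ext ?_ ?_
  · rw [coord_fst, diag_fst, ← e1, ← D.incl_posEquiv (Real.toNNReal_le_toNNReal (by linarith))]
    rfl
  · refine ContinuousLinearMap.ext fun f => ?_
    obtain ⟨z, rfl⟩ := (D.posEquiv _).surjective f
    rw [coord_snd, diag_snd, negEquiv_apply, ← e2, ← negPow_symm, ← negEquiv_apply,
      ← D.incl_posEquiv (Real.toNNReal_le_toNNReal (by linarith))]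
    rfl

theorem ι_coord (x : WithLp 2 (K × K)) : D.ι (D.coord (1 / 2) x) = D.coord (-(1 / 2)) (D.ℓ x) := by
  have h := D.inclW_coord (lam := 1 / 2) (by norm_num) le_rfl x
  have e : D.ℓ ^ ((1 / 2 : ℝ) + 1 / 2) = D.ℓ := by rw [add_halves, CFC.rpow_one _ D.ℓ_nonneg]
  rwa [e] at h

/-- For opposite indices the inclusions in the definition of the charge are between equal spaces, so
the powers of L₀(0) cancel and the pairing has the same form for all λ. -/
theorem charge_coord {mu lam : ℝ} (h : 0 ≤ mu + lam) (hml : mu + lam = 0) (x y : WithLp 2 (K × K)) :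
    D.charge h (D.coord mu x) (D.coord lam y) = ⟪x, swap y⟫_ℂ := by
  have e1 : Real.toNNReal (1 / 2 + mu) - Real.toNNReal (1 / 2 - lam) = 0 := by
    rw [eq_neg_of_add_eq_zero_left hml, ← sub_eq_add_neg, tsub_self]
  have e2 : Real.toNNReal (1 / 2 + lam) - Real.toNNReal (1 / 2 - mu) = 0 := by
    rw [eq_neg_of_add_eq_zero_left hml, sub_neg_eq_add, tsub_self]
  rw [charge, coord_fst, coord_fst, coord_snd, coord_snd, D.incl_posEquiv, D.incl_posEquiv, e1, e2,
    zero_div, D.negPow_zero D.zero_mem, negEquiv_apply, negEquiv_apply, inner_conj_symm,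
    inner_withLp, swap_fst, swap_snd]
  rfl

theorem domain_sqrtL₀ (t : ℝ) (x : K) :
    x ∈ (D.sqrtL₀ t).domain ↔ ∃ y, D.negPow t (1 / 2) y = x := by
  rw [sqrtL₀, LinearPMap.inverse_domain]
  constructor
  · rintro ⟨⟨y, hy⟩, h⟩
    exact ⟨y, h⟩
  · rintro ⟨y, h⟩
    exact ⟨⟨y, trivial⟩, h⟩

theorem ap_sqrtL₀_negPow (x : K) : ap (D.sqrtL₀ 0) (D.negPow 0 (1 / 2) x) = x := by
  have h : D.negPow 0 (1 / 2) x ∈ (D.sqrtL₀ 0).domain := (D.domain_sqrtL₀ 0 _).2 ⟨x, rfl⟩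
  rw [ap_of_mem h]
  refine LinearPMap.inverse_apply_eq (f := (D.negPow 0 (1 / 2) : K →ₗ[ℂ] K).toPMap ⊤)
    (y := ⟨_, h⟩) (x := ⟨x, trivial⟩) ?_ rfl
  rw [LinearMap.ker_eq_bot]
  intro y z hyz
  exact Subtype.ext (D.negPow_injective D.zero_mem _ hyz)

end Data

end KleinGordon

/-! ### The energy matrix and its charged system -/

namespace KleinGordon

open Set Filter Topology MeasureTheory
open scoped Interval

variable {K : Type*} [NormedAddCommGroup K] [InnerProductSpace ℂ K] [CompleteSpace K]

theorem swap_swap (x : WithLp 2 (K × K)) : swap (swap x) = x :=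
  withLp_ext (by rw [swap_fst, swap_snd]) (by rw [swap_snd, swap_fst])

theorem swap_symm (x y : WithLp 2 (K × K)) : ⟪swap x, y⟫_ℂ = ⟪x, swap y⟫_ℂ :=
  block_symm (fun _ _ => by simp) (fun _ _ => by simp) (fun _ _ => rfl) x y

/-- Coercivity of the energy form. -/
theorem block_coercive {a m α : K →L[ℂ] K} {N : K → ℝ} {c r : ℝ} (hα : IsSelfAdjoint α)
    (hαu : IsUnit α) (hc : 0 < c) (hr : r < 1) (ha : ∀ x, (⟪x, a x⟫_ℂ).re = N x ^ 2)
    (hN0 : ∀ x, 0 ≤ N x) (hN : ∀ x, c * ‖x‖ ^ 2 ≤ N x ^ 2)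
    (hm : ∀ x y, ‖⟪y, m x⟫_ℂ‖ ≤ r * ‖α y‖ * N x) :
    ∃ k : ℝ, 0 < k ∧ ∀ x,
      k * ‖x‖ ^ 2 ≤ quadForm (block a (ContinuousLinearMap.adjoint m) m (α * α)) x := by
  set d : ℝ := 1 / (‖Ring.inverse α‖ ^ 2 + 1) with hd
  have hd0 : 0 < d := by positivity
  have hdα : ∀ y, d * ‖y‖ ^ 2 ≤ ‖α y‖ ^ 2 := fun y => by
    rw [hd, one_div_mul_eq_div, div_le_iff₀ (by positivity)]
    have h1 := (Ring.inverse α).le_opNorm (α y)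
    rw [inverse_apply_apply hαu] at h1
    have h2 := pow_le_pow_left₀ (norm_nonneg _) h1 2
    rw [mul_pow] at h2
    nlinarith [sq_nonneg ‖α y‖]
  have hαs : ∀ x y, ⟪α x, y⟫_ℂ = ⟪x, α y⟫_ℂ := fun x y => by
    conv_lhs => rw [← ContinuousLinearMap.isSelfAdjoint_iff'.1 hα]
    exact ContinuousLinearMap.adjoint_inner_left α y x
  -- The constant in the bound on W may be negative; the argument needs one in [0, 1).
  set q : ℝ := max r 0 with hq
  have hq1 : q < 1 := max_lt hr one_pos
  refine ⟨(1 - q) * min c d, mul_pos (by linarith) (lt_min hc hd0), fun x => ?_⟩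
  have e1 : quadForm (block a (ContinuousLinearMap.adjoint m) m (α * α)) x =
      N x.fst ^ 2 + 2 * (⟪x.snd, m x.fst⟫_ℂ).re + ‖α x.snd‖ ^ 2 := by
    have h1 : ⟪x.snd, (α * α) x.snd⟫_ℂ = ⟪α x.snd, α x.snd⟫_ℂ := (hαs _ _).symm
    have h2 : (⟪α x.snd, α x.snd⟫_ℂ).re = ‖α x.snd‖ ^ 2 := inner_self_eq_norm_sq (𝕜 := ℂ) _
    have h3 : (⟪m x.fst, x.snd⟫_ℂ).re = (⟪x.snd, m x.fst⟫_ℂ).re := inner_re_symm (𝕜 := ℂ) _ _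
    rw [quadForm, inner_withLp, block_fst, block_snd, inner_add_right, inner_add_right, h1,
      ContinuousLinearMap.adjoint_inner_right]
    simp only [Complex.add_re, ha, h2, h3]
    ring
  have e2 : ‖x‖ ^ 2 = ‖x.fst‖ ^ 2 + ‖x.snd‖ ^ 2 := WithLp.prod_norm_sq_eq_of_L2 x
  have h1 : |(⟪x.snd, m x.fst⟫_ℂ).re| ≤ q * ‖α x.snd‖ * N x.fst := by
    refine (Complex.abs_re_le_norm _).trans ((hm _ _).trans ?_)
    have := hN0 x.fst
    gcongr
    exact le_max_left _ _
  have h2 := hN x.fst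
  have h3 := hdα x.snd
  rw [e1, e2]
  rw [abs_le] at h1
  have h4 : 0 ≤ q := le_max_right _ _
  -- The cross term is at most 2q‖αy‖N(x) ≤ q(N(x)² + ‖αy‖²), so q < 1 leaves a positive fraction of
  -- the diagonal.
  have h5 : (1 - q) * (N x.fst ^ 2 + ‖α x.snd‖ ^ 2) ≤
      N x.fst ^ 2 + 2 * (⟪x.snd, m x.fst⟫_ℂ).re + ‖α x.snd‖ ^ 2 := by
    nlinarith [mul_nonneg h4 (sq_nonneg (N x.fst - ‖α x.snd‖))]
  refine le_trans ?_ h5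
  rw [mul_assoc]
  refine mul_le_mul_of_nonneg_left ?_ (by linarith)
  have h6 := mul_le_mul_of_nonneg_right (min_le_left c d) (sq_nonneg ‖x.fst‖)
  have h7 := mul_le_mul_of_nonneg_right (min_le_right c d) (sq_nonneg ‖x.snd‖)
  linarith

namespace Data

variable {J : Set ℝ} (D : Data K J)

theorem ℓ_symm (x y : WithLp 2 (K × K)) : ⟪D.ℓ x, y⟫_ℂ = ⟪x, D.ℓ y⟫_ℂ :=
  ((ContinuousLinearMap.nonneg_iff_isPositive _).1 D.ℓ_nonneg).inner_left_eq_inner_right x y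

theorem swap_ℓ (x : WithLp 2 (K × K)) : swap (D.ℓ x) = D.ℓ (swap x) :=
  withLp_ext (by rw [swap_fst, ℓ, diag_snd, diag_fst, swap_fst])
    (by rw [swap_snd, ℓ, diag_fst, diag_snd, swap_snd])

/-- The bounded perturbation which replaces `L₀` by `L`. -/
noncomputable def pert : WithLp 2 (K × K) →L[ℂ] WithLp 2 (K × K) :=
  block 0 0 (-(D.b : ℂ) • D.negPow 0 (1 / 2)) 0

theorem pert_fst (x : WithLp 2 (K × K)) : (D.pert x).fst = 0 := by
  rw [pert, block_fst, zero_apply, zero_apply, add_zero]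

theorem pert_snd (x : WithLp 2 (K × K)) :
    (D.pert x).snd = -(D.b : ℂ) • D.negPow 0 (1 / 2) x.fst := by
  rw [pert, block_snd, zero_apply, add_zero]
  rfl

/-- `T` is the matrix of the energy form at time `t`. -/
def IsEnergy (t : ℝ) (T : WithLp 2 (K × K) →L[ℂ] WithLp 2 (K × K)) : Prop :=
  ∃ a m : K →L[ℂ] K, T = block a (ContinuousLinearMap.adjoint m) m (D.α t * D.α t) ∧
    (∀ f g, ⟪f, a g⟫_ℂ = ⟪ap (D.sqrtL₀ t) (D.negPow 0 (1 / 2) f),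
      ap (D.sqrtL₀ t) (D.negPow 0 (1 / 2) g)⟫_ℂ) ∧
    ∀ f, m f = ap (D.W t) (D.negPow 0 (1 / 2) f)

variable {D}

theorem IsEnergy.symm {t : ℝ} (ht : t ∈ J) {T : WithLp 2 (K × K) →L[ℂ] WithLp 2 (K × K)}
    (h : D.IsEnergy t T) (x y : WithLp 2 (K × K)) : ⟪T x, y⟫_ℂ = ⟪x, T y⟫_ℂ := by
  obtain ⟨a, m, rfl, ha, -⟩ := h
  refine block_symm (fun x y => ?_) (fun x y => ?_) (fun x y => ?_) x y
  · rw [← inner_conj_symm, ha, inner_conj_symm, ha]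
  · have hαs : ∀ x y, ⟪D.α t x, y⟫_ℂ = ⟪x, D.α t y⟫_ℂ := fun x y => by
      conv_lhs => rw [← ContinuousLinearMap.isSelfAdjoint_iff'.1 (D.isSelfAdjoint_α t ht)]
      exact ContinuousLinearMap.adjoint_inner_left _ y x
    exact (hαs _ _).trans (hαs _ _)
  · exact ContinuousLinearMap.adjoint_inner_left m y x

theorem IsEnergy.coercive (hD : D.Assumption) {t : ℝ} (ht : t ∈ J)
    {T : WithLp 2 (K × K) →L[ℂ] WithLp 2 (K × K)} (h : D.IsEnergy t T) :
    ∃ k : ℝ, 0 < k ∧ ∀ x, k * ‖x‖ ^ 2 ≤ quadForm T x := by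
  obtain ⟨a, m, rfl, ha, hm⟩ := h
  obtain ⟨c₁, c₂, hc₁, hdom, hcomp⟩ := hD.comparable t ht
  obtain ⟨r, hr, hW⟩ := hD.W_bound
  have hmem : ∀ x, D.negPow 0 (1 / 2) x ∈ (D.sqrtL₀ 0).domain := fun x =>
    (D.domain_sqrtL₀ 0 _).2 ⟨x, rfl⟩
  refine block_coercive (N := fun x => ‖ap (D.sqrtL₀ t) (D.negPow 0 (1 / 2) x)‖)
    (D.isSelfAdjoint_α t ht) (D.isUnit_α t ht) hc₁ hr (fun x => ?_) (fun x => norm_nonneg _)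
    (fun x => ?_) fun x y => ?_
  · rw [ha]
    exact inner_self_eq_norm_sq (𝕜 := ℂ) _
  · have := (hcomp _ (hmem x)).1
    rwa [D.ap_sqrtL₀_negPow] at this
  · rw [hm]
    refine hW t ht y _ ?_
    rw [hdom]
    exact hmem x

variable (D)

/-- The charged system in the coordinates `K ⊕ K`. -/
theorem exists_chargedSystem (hD : D.Assumption) :
    ∃ (A : ℝ → WithLp 2 (K × K) →L[ℂ] WithLp 2 (K × K)) (C γ : ℝ → ℝ),
      (∀ t ∈ J, D.IsEnergy t (A t)) ∧ ChargedSystem J D.ℓ swap D.pert A γ ∧ (∀ τ, 0 ≤ C τ) ∧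
      LocallyIntegrableOn C J ∧ ∀ s ∈ J, ∀ t ∈ J, |γ t - γ s| = 2 * |∫ τ in s..t, C τ| := by
  obtain ⟨a, ha, ha'⟩ := hD.L_absCont
  obtain ⟨m, hm, hm'⟩ := hD.W_absCont
  have hA := ha.block hm hD.α_absCont D.ordConnected
  have hE : ∀ t ∈ J, D.IsEnergy t
      (block (a t) (ContinuousLinearMap.adjoint (m t)) (m t) (D.α t * D.α t)) := fun t ht =>
    ⟨a t, m t, rfl, ha' t ht, fun f => (hm' t ht f).2⟩
  obtain ⟨C, γ, hC0, hCi, hγc, hγm, hγC, hcomp⟩ := exists_comparison D.ordConnected D.zero_mem hA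
    (fun t ht => (hE t ht).symm ht) fun t ht => (hE t ht).coercive hD ht
  refine ⟨_, C, γ, hE, ?_, hC0, hCi, hγC⟩
  exact
    { ℓ_nonneg := D.ℓ_nonneg
      ℓ_inj := D.ℓ_injective
      σ_symm := swap_symm
      σ_sq := swap_swap
      σ_comm := D.swap_ℓ
      P_comm := fun x => withLp_ext
        (by rw [pert_fst, ℓ, diag_fst, pert_fst, map_zero])
        (by rw [pert_snd, ℓ, diag_fst, diag_snd, pert_snd, map_smul])
      P_symm := fun x y => by
        have h : ∀ x y, ⟪swap (D.pert x), y⟫_ℂ = -(D.b : ℂ) * ⟪D.negPow 0 (1 / 2) x.fst, y.fst⟫_ℂ :=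
          fun x y => by
            rw [inner_withLp, swap_fst, swap_snd, pert_fst, pert_snd, inner_zero_left, add_zero,
              inner_smul_left, map_neg, Complex.conj_ofReal]
        rw [h, ← inner_conj_symm x, h, map_mul, map_neg, Complex.conj_ofReal, inner_conj_symm,
          negPow_symm]
      A_symm := fun t ht => (hE t ht).symm ht
      A_coercive := fun t ht => (hE t ht).coercive hD ht
      A_cont := hA.continuousOn D.ordConnected
      γ_cont := hγc
      γ_mono := hγm
      A_comp := hcomp }

/-- An operator on `K ⊕ K`, as an operator from `W_{1/2}` to `W_{-1/2}`. -/
noncomputable def fromCoord (T : WithLp 2 (K × K) →L[ℂ] WithLp 2 (K × K)) :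
    D.Wsp (1 / 2) →L[ℂ] D.Wsp (-(1 / 2)) :=
  (D.coord (-(1 / 2)) : WithLp 2 (K × K) →L[ℂ] D.Wsp (-(1 / 2))) ∘L T ∘L
    ((D.coord (1 / 2)).symm : D.Wsp (1 / 2) →L[ℂ] WithLp 2 (K × K))

theorem fromCoord_coord (T : WithLp 2 (K × K) →L[ℂ] WithLp 2 (K × K)) (x : WithLp 2 (K × K)) :
    D.fromCoord T (D.coord (1 / 2) x) = D.coord (-(1 / 2)) (T x) := by
  simp [fromCoord]

theorem toK_posEquiv_zero {q : ℝ≥0} (hq : q = 0) (x : K) : D.toK (D.posEquiv q x) = x := by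
  rw [toK_posEquiv, hq, zero_div, D.negPow_zero D.zero_mem]
  rfl

theorem toK_posEquiv_one {q : ℝ≥0} (hq : q = 1) (x : K) :
    D.toK (D.posEquiv q x) = D.negPow 0 (1 / 2) x := by
  rw [toK_posEquiv, hq]

/-- Testing the second component on L₀(0)^(-1/2)x turns a and m* into the forms of L₀(t) and W(t)*.
The term -b(f|x) uses two factors L₀(0)^(-1/2), one from `pert` and one from ℓ. -/
theorem isKGGenerator_fromCoord {t : ℝ} {T : WithLp 2 (K × K) →L[ℂ] WithLp 2 (K × K)}
    (h : D.IsEnergy t T) : D.IsKGGenerator t (D.fromCoord (swap * T + D.pert * D.ℓ)) := by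
  obtain ⟨a, m, rfl, ha, hm⟩ := h
  have q0 : Real.toNNReal (1 / 2 - 1 / 2) = 0 := by rw [sub_self, Real.toNNReal_zero]
  have q0' : Real.toNNReal (1 / 2 + -(1 / 2)) = 0 := by rw [add_neg_cancel, Real.toNNReal_zero]
  have q1 : Real.toNNReal (1 / 2 + 1 / 2) = 1 := by rw [add_halves, Real.toNNReal_one]
  have q1' : Real.toNNReal (1 / 2 - -(1 / 2)) = 1 := by
    rw [sub_neg_eq_add, add_halves, Real.toNNReal_one]
  intro u y hy
  obtain ⟨z, rfl⟩ := (D.coord (1 / 2)).surjective u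
  have hz : z.snd = y := ext_inner_left ℂ fun x => by
    have := hy (D.posEquiv _ x)
    rwa [coord_snd, negEquiv_apply, D.toK_posEquiv_zero q0] at this
  rw [fromCoord_coord, coord_fst, coord_snd, coord_fst, D.toK_posEquiv_zero q0',
    D.toK_posEquiv_one q1]
  have hfst : ((swap * block a (ContinuousLinearMap.adjoint m) m (D.α t * D.α t) +
      D.pert * D.ℓ : WithLp 2 (K × K) →L[ℂ] WithLp 2 (K × K)) z).fst = m z.fst + D.α t (D.α t z.snd) := by
    rw [add_apply, WithLp.add_fst, mul_apply_eq_comp, mul_apply_eq_comp, swap_fst, pert_fst,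
      block_snd, add_zero]
    rfl
  have hsnd : ((swap * block a (ContinuousLinearMap.adjoint m) m (D.α t * D.α t) +
      D.pert * D.ℓ : WithLp 2 (K × K) →L[ℂ] WithLp 2 (K × K)) z).snd = a z.fst + ContinuousLinearMap.adjoint m z.snd +
        -(D.b : ℂ) • D.negPow 0 (1 / 2) (D.negPow 0 (1 / 2) z.fst) := by
    rw [add_apply, WithLp.add_snd, mul_apply_eq_comp, mul_apply_eq_comp, swap_snd, pert_snd,
      block_fst, ℓ, diag_fst]
  refine ⟨?_, fun f => ?_⟩
  · rw [hfst, hm, hz]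
  · obtain ⟨x, rfl⟩ := (D.posEquiv _).surjective f
    rw [negEquiv_apply, hsnd, D.toK_posEquiv_one q1', inner_add_right, inner_add_right, ha,
      ContinuousLinearMap.adjoint_inner_right, inner_smul_right, ← negPow_symm, hm, hz]
    ring

theorem completeSpace_Wsp (lam : ℝ) : CompleteSpace (D.Wsp lam) :=
  ((D.coord lam).isUniformEmbedding.isUniformInducing.completeSpace_congr
    (D.coord lam).surjective).1 inferInstance

end Data

end KleinGordon

/-! ### Transfer to the spaces W_λ and conclusion -/

namespace KleinGordon

open Set Filter Topology MeasureTheory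
open scoped Interval

variable {K : Type*} [NormedAddCommGroup K] [InnerProductSpace ℂ K] [CompleteSpace K]

namespace Data

variable {J : Set ℝ} (D : Data K J)

theorem Q_coord (x y : WithLp 2 (K × K)) :
    D.Q (D.coord (-(1 / 2)) x) (D.coord (1 / 2) y) = ⟪x, swap y⟫_ℂ :=
  D.charge_coord _ (by norm_num) x y

theorem Q₀_coord (x y : WithLp 2 (K × K)) :
    D.Q₀ (D.coord 0 x) (D.coord 0 y) = ⟪x, swap y⟫_ℂ :=
  D.charge_coord _ (by norm_num) x y

theorem isNestedPair : IsNestedPair D.ι D.Q := by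
  refine ⟨fun u v huv => ?_, fun y => ?_, ⟨(innerForm swap).bilinearComp
    ((D.coord (-(1 / 2))).symm : D.Wsp (-(1 / 2)) →L[ℂ] WithLp 2 (K × K))
    ((D.coord (1 / 2)).symm : D.Wsp (1 / 2) →L[ℂ] WithLp 2 (K × K)), fun u v => ?_⟩, fun u v => ?_⟩
  · obtain ⟨x, rfl⟩ := (D.coord _).surjective u
    obtain ⟨y, rfl⟩ := (D.coord _).surjective v
    rw [ι_coord, ι_coord] at huv
    rw [D.ℓ_injective ((D.coord _).injective huv)]
  · have h : DenseRange (D.coord (-(1 / 2)) ∘ D.ℓ) :=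
      (D.coord _).surjective.denseRange.comp (denseRange_of_symm D.ℓ_symm D.ℓ_injective)
        (D.coord _).continuous
    refine closure_mono ?_ (h y)
    rintro _ ⟨x, rfl⟩
    exact ⟨D.coord (1 / 2) x, D.ι_coord x⟩
  · obtain ⟨x, rfl⟩ := (D.coord _).surjective u
    obtain ⟨y, rfl⟩ := (D.coord _).surjective v
    rw [Q_coord]
    simp [innerForm_apply]
  · obtain ⟨x, rfl⟩ := (D.coord _).surjective u
    obtain ⟨y, rfl⟩ := (D.coord _).surjective v
    rw [ι_coord, ι_coord, Q_coord, Q_coord, inner_conj_symm, swap_symm, ℓ_symm, swap_ℓ]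

/-- An operator on `K ⊕ K`, as an operator on `W_λ`. -/
noncomputable def onScale (lam : ℝ) (T : WithLp 2 (K × K) →L[ℂ] WithLp 2 (K × K)) :
    D.Wsp lam →L[ℂ] D.Wsp lam :=
  (D.coord lam : WithLp 2 (K × K) →L[ℂ] D.Wsp lam) ∘L T ∘L
    ((D.coord lam).symm : D.Wsp lam →L[ℂ] WithLp 2 (K × K))

theorem onScale_coord (lam : ℝ) (T : WithLp 2 (K × K) →L[ℂ] WithLp 2 (K × K))
    (x : WithLp 2 (K × K)) : D.onScale lam T (D.coord lam x) = D.coord lam (T x) := by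
  simp [onScale]

/-- The swap serves as the admissible involution: composed with the charge it gives back the Hilbert
inner product of K ⊕ K. -/
theorem isKreinSpace : IsKreinSpace D.Q₀ := by
  refine ⟨⟨transportForm (D.coord 0) (innerForm swap), fun v w => ?_⟩, fun v w => ?_,
    D.onScale 0 swap, ContinuousLinearMap.ext fun v => ?_, fun v w => ?_,
    transportForm (D.coord 0) (innerForm 1), fun v w => ?_,
    (isCompatibleInner_innerForm (fun _ _ => rfl) ⟨1, one_pos, fun x => ?_⟩).transport (D.coord 0)
      (transportForm_apply _ _)⟩
  · obtain ⟨x, rfl⟩ := (D.coord _).surjective v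
    obtain ⟨y, rfl⟩ := (D.coord _).surjective w
    rw [transportForm_apply, innerForm_apply, Q₀_coord]
  · obtain ⟨x, rfl⟩ := (D.coord _).surjective v
    obtain ⟨y, rfl⟩ := (D.coord _).surjective w
    rw [Q₀_coord, Q₀_coord, inner_conj_symm, swap_symm]
  · obtain ⟨x, rfl⟩ := (D.coord _).surjective v
    rw [mul_apply_eq_comp, onScale_coord, onScale_coord, swap_swap]
    rfl
  · obtain ⟨x, rfl⟩ := (D.coord _).surjective v
    obtain ⟨y, rfl⟩ := (D.coord _).surjective w
    rw [onScale_coord, onScale_coord, Q₀_coord, Q₀_coord, swap_swap, swap_symm]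
  · obtain ⟨x, rfl⟩ := (D.coord _).surjective v
    obtain ⟨y, rfl⟩ := (D.coord _).surjective w
    rw [onScale_coord, transportForm_apply, innerForm_apply, Q₀_coord, swap_swap]
    rfl
  · rw [one_mul]
    exact (inner_self_eq_norm_sq (𝕜 := ℂ) x).ge

theorem isPseudoUnitary_onScale {T T' : WithLp 2 (K × K) →L[ℂ] WithLp 2 (K × K)}
    (h : T * T' = 1) (h' : T' * T = 1) (hT : ∀ x y, ⟪T x, swap (T y)⟫_ℂ = ⟪x, swap y⟫_ℂ) :
    IsPseudoUnitary D.Q₀ (D.onScale 0 T) := by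
  have hmul : ∀ {T T' : WithLp 2 (K × K) →L[ℂ] WithLp 2 (K × K)}, T * T' = 1 →
      D.onScale 0 T * D.onScale 0 T' = 1 := fun {T T'} h => ContinuousLinearMap.ext fun v => by
    obtain ⟨x, rfl⟩ := (D.coord _).surjective v
    rw [mul_apply_eq_comp, onScale_coord, onScale_coord, ← mul_apply_eq_comp, h]
    rfl
  refine ⟨fun v hv => ?_, ⟨⟨_, _, hmul h, hmul h'⟩, rfl⟩, fun v w => ?_⟩
  · obtain ⟨x, rfl⟩ := (D.coord _).surjective v
    have h1 := hv (D.coord 0 (swap x))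
    rw [Q₀_coord, swap_swap, inner_self_eq_zero] at h1
    rw [h1, map_zero]
  · obtain ⟨x, rfl⟩ := (D.coord _).surjective v
    obtain ⟨y, rfl⟩ := (D.coord _).surjective w
    rw [onScale_coord, onScale_coord, Q₀_coord, Q₀_coord, hT]

section Charged

variable {D} {A : ℝ → WithLp 2 (K × K) →L[ℂ] WithLp 2 (K × K)} {C γ : ℝ → ℝ}
  (S : ChargedSystem J D.ℓ swap D.pert A γ)
include S

theorem perturbedAlmostUnitaryHypotheses (hC : ∀ τ, 0 ≤ C τ) (hCi : LocallyIntegrableOn C J)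
    (hγ : ∀ s ∈ J, ∀ t ∈ J, |γ t - γ s| = 2 * |∫ τ in s..t, C τ|) :
    PerturbedAlmostUnitaryHypotheses J D.ι fun t =>
      D.fromCoord (swap * A t + D.pert * D.ℓ) := by
  refine ⟨fun t => D.fromCoord (swap * A t), fun _ => D.onScale (-(1 / 2)) D.pert,
    (S.almostUnitaryHypotheses hC hCi hγ).transport D.ι_coord
      (fun t _ v => D.fromCoord_coord _ v), continuousOn_const,
    fun t _ => ContinuousLinearMap.ext fun u => ?_⟩
  obtain ⟨x, rfl⟩ := (D.coord _).surjective u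
  rw [add_apply, ContinuousLinearMap.comp_apply, fromCoord_coord, fromCoord_coord, ι_coord,
    onScale_coord, ← map_add]
  rfl

theorem infinitesimallyPreserves {t : ℝ} (ht : t ∈ J) :
    InfinitesimallyPreserves D.ι D.Q (D.fromCoord (swap * A t + D.pert * D.ℓ)) := by
  obtain ⟨h1, h2⟩ := S.isGroupGenerator ht
  refine ⟨h1.transport _ (mem_opGraph_transport D.ι_coord (D.fromCoord_coord _)),
    h2.transport _ (mem_partGraph_transport D.ι_coord (D.fromCoord_coord _)), fun v w => ?_⟩
  obtain ⟨x, rfl⟩ := (D.coord _).surjective v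
  obtain ⟨y, rfl⟩ := (D.coord _).surjective w
  rw [fromCoord_coord, fromCoord_coord, Q_coord, Q_coord, S.inner_generator ht]

theorem exists_scale_evolution {R : ℝ → ℝ → WithLp 2 (K × K) →L[ℂ] WithLp 2 (K × K)}
    (hR : IsChargedEvolution J D.ℓ swap D.pert A R) :
    ∃ T : ℝ → ℝ → ℝ → WithLp 2 (K × K) →L[ℂ] WithLp 2 (K × K),
      ∀ lam ∈ Icc (-(1 / 2) : ℝ) (1 / 2), IsStronglyContinuousEvolution J (T lam) ∧
        ∀ t ∈ J, ∀ s ∈ J, ∀ v, R t s ((D.ℓ ^ (lam + 1 / 2)) v) =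
          (D.ℓ ^ (lam + 1 / 2)) (T lam t s v) := by
  have h : ∀ lam : ℝ, ∃ T : ℝ → ℝ → WithLp 2 (K × K) →L[ℂ] WithLp 2 (K × K),
      lam ∈ Icc (-(1 / 2) : ℝ) (1 / 2) → IsStronglyContinuousEvolution J T ∧
        ∀ t ∈ J, ∀ s ∈ J, ∀ v, R t s ((D.ℓ ^ (lam + 1 / 2)) v) =
          (D.ℓ ^ (lam + 1 / 2)) (T t s v) := fun lam => by
    by_cases hl : lam ∈ Icc (-(1 / 2) : ℝ) (1 / 2)
    · obtain ⟨T, hT⟩ := S.exists_evolution_rpow D.ordConnected hR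
        (p := lam + 1 / 2) ⟨by linarith [hl.1], by linarith [hl.2]⟩
      exact ⟨T, fun _ => hT⟩
    · exact ⟨0, fun h => absurd h hl⟩
  choose T hT using h
  exact ⟨T, hT⟩

end Charged

end Data

end KleinGordon

theorem mainTheorem5 {K : Type*} [NormedAddCommGroup K] [InnerProductSpace ℂ K] [CompleteSpace K]
    (J : Set ℝ) (D : KleinGordon.Data K J) (hD : D.Assumption) :
    ∃ B : ℝ → D.Wsp (1 / 2) →L[ℂ] D.Wsp (-(1 / 2)),
      (∀ t ∈ J, D.IsKGGenerator t (B t)) ∧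
      -- the assumptions of the generation theorem hold
      KleinGordon.IsNestedPair D.ι D.Q ∧
      KleinGordon.PerturbedAlmostUnitaryHypotheses J D.ι B ∧
      (∀ t ∈ J, KleinGordon.InfinitesimallyPreserves D.ι D.Q (B t)) ∧
      -- the evolution on the scale
      ∃ R : (lam : ℝ) → ℝ → ℝ → D.Wsp lam →L[ℂ] D.Wsp lam,
        KleinGordon.IsEvolutionGeneratedBy J D.ι B (R (-(1 / 2))) ∧
        (∀ R' : ℝ → ℝ → D.Wsp (-(1 / 2)) →L[ℂ] D.Wsp (-(1 / 2)),
          KleinGordon.IsEvolutionGeneratedBy J D.ι B R' →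
            ∀ t ∈ J, ∀ s ∈ J, R' t s = R (-(1 / 2)) t s) ∧
        (∀ lam : ℝ, ∀ hl : -(1 / 2) ≤ lam, lam ≤ 1 / 2 →
          KleinGordon.IsStronglyContinuousEvolution J (R lam) ∧
          (∀ t ∈ J, ∀ s ∈ J, ∀ u : D.Wsp lam,
            D.inclW hl (R lam t s u) = R (-(1 / 2)) t s (D.inclW hl u)) ∧
          -- pseudo-unitarity in the sense of the pairing between `W_{-λ}` and `W_λ`
          ∀ t ∈ J, ∀ s ∈ J, ∀ (u : D.Wsp (-lam)) (v : D.Wsp lam),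
            D.charge (neg_add_cancel lam).ge (R (-lam) t s u) (R lam t s v) =
              D.charge (neg_add_cancel lam).ge u v) ∧
        -- pseudo-unitarity on the Krein space `W_0`
        KleinGordon.IsKreinSpace D.Q₀ ∧
        ∀ t ∈ J, ∀ s ∈ J, KleinGordon.IsPseudoUnitary D.Q₀ (R 0 t s) := by
  obtain ⟨A, C, γ, hE, S, hC, hCi, hγ⟩ := D.exists_chargedSystem hD
  obtain ⟨R₀, hR₀⟩ := S.exists_evolution D.ordConnected
  obtain ⟨T, hT⟩ := KleinGordon.Data.exists_scale_evolution S hR₀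
  -- The family T was chosen separately for each λ; at λ = -1/2 the power of ℓ is the identity, so
  -- the choice there is forced.
  have hT0 : ∀ t ∈ J, ∀ s ∈ J, ∀ x, T (-(1 / 2)) t s x = R₀ t s x := fun t ht s hs x => by
    have h := (hT (-(1 / 2)) ⟨le_rfl, by norm_num⟩).2 t ht s hs x
    rw [neg_add_cancel, CFC.rpow_zero D.ℓ D.ℓ_nonneg] at h
    exact h.symm
  have hgen : KleinGordon.IsEvolutionGeneratedBy J D.ι
      (fun t => D.fromCoord (KleinGordon.swap * A t + D.pert * D.ℓ))
      fun t s => D.onScale (-(1 / 2)) (T (-(1 / 2)) t s) :=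
    (hR₀.isEvolutionGeneratedBy D.ordConnected).transport (D.coord _) (D.coord _) D.ι_coord
      (fun t _ v => D.fromCoord_coord _ v)
      fun t ht s hs x => by rw [D.onScale_coord, hT0 t ht s hs]
  have hpair : ∀ lam ∈ Set.Icc (-(1 / 2) : ℝ) (1 / 2), ∀ t ∈ J, ∀ s ∈ J, ∀ x y,
      inner ℂ (T (-lam) t s x) (KleinGordon.swap (T lam t s y)) =
        inner ℂ x (KleinGordon.swap y) := fun lam hl t ht s hs x y => by
    refine S.inner_evolution_rpow hR₀ (p := lam + 1 / 2)
      ⟨by linarith [hl.1], by linarith [hl.2]⟩ ht hs ((hT lam hl).2 t ht s hs) (fun v => ?_) x y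
    have h := (hT (-lam) ⟨by linarith [hl.2], by linarith [hl.1]⟩).2 t ht s hs v
    -- The exponents belonging to λ and -λ add up to 1, so W_λ and W_{-λ} are dual for the charge.
    have e : 1 - (lam + 1 / 2) = -lam + 1 / 2 := by ring
    rwa [e]
  -- Uniqueness obtains local boundedness from the Banach–Steinhaus theorem, which requires
  -- completeness of W_{-1/2}.
  have := D.completeSpace_Wsp (-(1 / 2))
  refine ⟨fun t => D.fromCoord (KleinGordon.swap * A t + D.pert * D.ℓ),
    fun t ht => D.isKGGenerator_fromCoord (hE t ht), D.isNestedPair,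
    KleinGordon.Data.perturbedAlmostUnitaryHypotheses S hC hCi hγ,
    fun t ht => KleinGordon.Data.infinitesimallyPreserves S ht,
    fun lam t s => D.onScale lam (T lam t s), hgen,
    fun R' hR' t ht s hs => hgen.unique D.ordConnected D.isNestedPair.2.1 hR' ht hs,
    fun lam hl hl' => ⟨(hT lam ⟨hl, hl'⟩).1.transport (D.coord lam)
      fun t _ s _ x => D.onScale_coord lam _ x, fun t ht s hs u => ?_, fun t ht s hs u v => ?_⟩,
    D.isKreinSpace, fun t ht s hs => ?_⟩
  · obtain ⟨x, rfl⟩ := (D.coord lam).surjective u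
    rw [D.onScale_coord, D.inclW_coord hl hl', D.inclW_coord hl hl', D.onScale_coord, hT0 t ht s hs,
      (hT lam ⟨hl, hl'⟩).2 t ht s hs]
  · obtain ⟨x, rfl⟩ := (D.coord (-lam)).surjective u
    obtain ⟨y, rfl⟩ := (D.coord lam).surjective v
    rw [D.onScale_coord, D.onScale_coord, D.charge_coord _ (neg_add_cancel lam),
      D.charge_coord _ (neg_add_cancel lam), hpair lam ⟨hl, hl'⟩ t ht s hs]
  · have h0 : (0 : ℝ) ∈ Set.Icc (-(1 / 2) : ℝ) (1 / 2) := ⟨by norm_num, by norm_num⟩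
    have he := (hT 0 h0).1
    refine D.isPseudoUnitary_onScale ((he.2.1 t ht s hs t ht).trans (he.1 t ht))
      ((he.2.1 s hs t ht s hs).trans (he.1 s hs)) fun x y => ?_
    have h := hpair 0 h0 t ht s hs x y
    rwa [neg_zero] at h
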